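/- For $n\ge 2$, let $\{Z_{a,b,j}\}_{1\le a,b\le 3,\ 1\le j\le n}$ be independent standard Gaussian random variables and define the random $2^n\times 2^n$ Hermitian matrix \[H_n:=\frac{1}{\sqrt{9n}}\sum_{j=1}^n\sum_{a,b=1}^3 Z_{a,b,j}\,\sigma^{(a)}_j\sigma^{(b)}_{j+1},\qquad \sigma^{(a)}_j:=I_2^{\otimes(j-1)}\otimes\sigma^{(a)}\otimes I_2^{\otimes(n-j)},\] where the labelling is cyclic ($\sigma^{(b)}_{n+1}:=\sigma^{(b)}_1$), $I_2$ is the $2\times2$ identity matrix and \[\sigma^{(1)}=\begin{bmatrix}0&1\\1&0\end{bmatrix},\quad \sigma^{(2)}=\begin{bmatrix}0&-i\\i&0\end{bmatrix},\quad \sigma^{(3)}=\begin{bmatrix}1&0\\0&-1\end{bmatrix}.\] Let $\mu_n:=2^{-n}\sum_{k=1}^{2^n}\delta_{\lambda_k}$ be its empirical spectral measure, where $\lambda_1,\dots,\lambda_{2^n}$ are the eigenvalues of $H_n$ with multiplicity, and let $\gamma$ be the standard Gaussian distribution on $\mathbb{R}$. For probability measures $\mu,\nu$ on $\mathbb{R}$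 let \[d_{BL}(\mu,\nu):=\sup\left\{\left|\int f\,d\mu-\int f\,d\nu\right| : f:\mathbb{R}\to\mathbb{R},\ \|f\|_\infty+|f|_L\le 1\right\},\] where $|f|_L$ is the Lipschitz constant of $f$. Then there are universal constants $C,C',c>0$ such that: (a) for every $n\ge2$, $\displaystyle \mathbb{E}\,d_{BL}(\mu_n,\gamma)\le \frac{C}{n^{1/6}}$; (b) for every $n\ge2$ and every $t\ge0$, $\displaystyle \mathbb{P}\left[d_{BL}(\mu_n,\gamma)\ge\frac{C}{n^{1/6}}+t\right]\le Ce^{-cnt^2}$; (c) if the matrices $H_n$, $n\ge2$, are all defined on one probability space (with an arbitrary joint distribution of the coefficients for different $n$), then with probability $1$, $\displaystyle d_{BL}(\mu_n,\gamma)\le \frac{C'}{n^{1/6}}$ for all sufficiently large $n$. -/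

import Mathlib

open MeasureTheory ProbabilityTheory Filter Topology
open scoped ENNReal NNReal

universe u

noncomputable section

/-- The three non-trivial Pauli matrices `σ⁽¹⁾, σ⁽²⁾, σ⁽³⁾`. -/
def pauli : Fin 3 → Matrix (Fin 2) (Fin 2) ℂ :=
  ![!![0, 1; 1, 0], !![0, -Complex.I; Complex.I, 0], !![1, 0; 0, -1]]

/-- The Kronecker product `A₁ ⊗ ⋯ ⊗ Aₙ` of `n` matrices of size `2 × 2`. The rows and the columns
of this `2ⁿ × 2ⁿ` matrix are indexed by the functions `Fin n → Fin 2`. -/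
def tensorProd {n : ℕ} (A : Fin n → Matrix (Fin 2) (Fin 2) ℂ) :
    Matrix (Fin n → Fin 2) (Fin n → Fin 2) ℂ :=
  Matrix.of fun s t => ∏ k, A k (s k) (t k)

/-- `I₂ ⊗ ⋯ ⊗ I₂ ⊗ σ⁽ᵃ⁾ ⊗ I₂ ⊗ ⋯ ⊗ I₂`, with `σ⁽ᵃ⁾` in position `j`. -/
def sitePauli {n : ℕ} (a : Fin 3) (j : Fin n) : Matrix (Fin n → Fin 2) (Fin n → Fin 2) ℂ :=
  tensorProd (Function.update (fun _ => 1) j (pauli a))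

/-- The nearest-neighbour Hamiltonian on the cyclic chain of `n` sites with the coupling
coefficients `x a b j`; `finRotate n` sends `j` to `j + 1` cyclically. -/
def hamiltonian {n : ℕ} (x : Fin 3 → Fin 3 → Fin n → ℝ) :
    Matrix (Fin n → Fin 2) (Fin n → Fin 2) ℂ :=
  ((1 / Real.sqrt (9 * n) : ℝ) : ℂ) • ∑ j : Fin n, ∑ a : Fin 3, ∑ b : Fin 3,
    ((x a b j : ℝ) : ℂ) • (sitePauli a j * sitePauli b (finRotate n j))

theorem pauli_isHermitian (a : Fin 3) : (pauli a).IsHermitian := by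
  fin_cases a <;> ext i j <;> fin_cases i <;> fin_cases j <;>
    simp [pauli, Matrix.conjTranspose_apply]

theorem tensorProd_mul {n : ℕ} (A B : Fin n → Matrix (Fin 2) (Fin 2) ℂ) :
    tensorProd A * tensorProd B = tensorProd (fun k => A k * B k) := by
  ext s t
  simp only [tensorProd, Matrix.mul_apply, Matrix.of_apply, ← Finset.prod_mul_distrib]
  rw [Finset.prod_univ_sum]
  simp

theorem sitePauli_isHermitian {n : ℕ} (a : Fin 3) (j : Fin n) : (sitePauli a j).IsHermitian := by
  ext s t
  simp only [sitePauli, tensorProd, Matrix.conjTranspose_apply, Matrix.of_apply, star_prod]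
  refine Finset.prod_congr rfl fun k _ => ?_
  by_cases h : k = j
  · subst h
    simpa using (pauli_isHermitian a).apply (s k) (t k)
  · simp only [Function.update_of_ne h]
    exact Matrix.isHermitian_one.apply (s k) (t k)

theorem sitePauli_commute {n : ℕ} (a b : Fin 3) {j k : Fin n} (h : j ≠ k) :
    Commute (sitePauli a j) (sitePauli b k) := by
  simp only [Commute, SemiconjBy, sitePauli, tensorProd_mul]
  congr 1
  funext i
  by_cases hj : i = j
  · subst hj
    simp [Function.update_of_ne h]
  · simp [Function.update_of_ne hj]

theorem finRotate_ne_self {n : ℕ} (hn : 2 ≤ n) (j : Fin n) : j ≠ finRotate n j := by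
  obtain ⟨m, rfl⟩ : ∃ m, n = m + 2 := ⟨n - 2, by omega⟩
  rw [finRotate_apply]
  intro h
  simp at h

/-- For `n ≥ 2` the Hamiltonian is Hermitian. (For `n = 1` it need not be.) -/
theorem hamiltonian_isHermitian {n : ℕ} (hn : 2 ≤ n) (x : Fin 3 → Fin 3 → Fin n → ℝ) :
    (hamiltonian x).IsHermitian := by
  have key : ∀ (a b : Fin 3) (j : Fin n),
      (sitePauli a j * sitePauli b (finRotate n j)).IsHermitian := fun a b j => by
    rw [Matrix.IsHermitian, Matrix.conjTranspose_mul, (sitePauli_isHermitian _ _).eq,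
      (sitePauli_isHermitian _ _).eq]
    exact (sitePauli_commute a b (finRotate_ne_self hn j)).eq.symm
  simp only [Matrix.IsHermitian, hamiltonian, Matrix.conjTranspose_smul,
    Matrix.conjTranspose_sum, (key _ _ _).eq, Complex.star_def, Complex.conj_ofReal]

/-- The empirical spectral measure of a Hermitian matrix: equal mass at each eigenvalue, counted
with multiplicity. -/
def spectralMeasure {ι : Type*} [Fintype ι] [DecidableEq ι] {A : Matrix ι ι ℂ}
    (hA : A.IsHermitian) : Measure ℝ :=
  (Fintype.card ι : ℝ≥0∞)⁻¹ • ∑ i, Measure.dirac (hA.eigenvalues i)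

/-- The empirical spectral measure of the Hamiltonian with coupling coefficients `x`. -/
def chainMeasure {n : ℕ} (hn : 2 ≤ n) (x : Fin 3 → Fin 3 → Fin n → ℝ) : Measure ℝ :=
  spectralMeasure (hamiltonian_isHermitian hn x)

/-- The bounded-Lipschitz norm `‖f‖_∞ + |f|_L` (possibly infinite), where `|f|_L` is the
smallest Lipschitz constant of `f`. -/
def blNorm (f : ℝ → ℝ) : ℝ≥0∞ :=
  (⨆ x, ‖f x‖ₑ) + ⨆ (x) (y), edist (f x) (f y) / edist x y

/-- The bounded-Lipschitz distance between probability measures on `ℝ`. -/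
def dBL (μ ν : Measure ℝ) : ℝ :=
  sSup {r : ℝ | ∃ f : ℝ → ℝ, blNorm f ≤ 1 ∧ r = |∫ x, f x ∂μ - ∫ x, f x ∂ν|}

/-- The `9n` coefficients `Z a b j` are independent standard Gaussian random variables. -/
structure IsGaussianCoupling {Ω : Type u} [MeasurableSpace Ω] (P : Measure Ω) {n : ℕ}
    (Z : Fin 3 → Fin 3 → Fin n → Ω → ℝ) : Prop where
  indep : iIndepFun (fun i : Fin 3 × Fin 3 × Fin n => Z i.1 i.2.1 i.2.2) P
  law : ∀ a b j, HasLaw (Z a b j) (gaussianReal 0 1) P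

end

/-! Integrals against $\mu_n$ are normalised traces: $\int s\,d\mu_n=\mathrm{ntr}\,s(H_n)$. The
proof bounds the fluctuation and the bias of these statistics by $O(n^{-1/2})$ each, and then passes
to the supremum over $s$ by interpolation.

Fluctuations. For $n\ge3$ the bonds $\sigma^{(a)}_j\sigma^{(b)}_{j+1}$ are orthonormal for the
normalised Hilbert-Schmidt inner product (`trace_bond_mul_bond`), so the map from coefficients to
$H_n$ is $(9n)^{-1/2}$ times an isometry (`hsSq_chainHam`). The squared overlaps of the eigenvectors
of $A$ and $B$ couple their spectral measures, with squared cost $\|A-B\|_{HS}^2$; hence linear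
statistics with 1-Lipschitz $s$ (`abs_ntr_cfc_sub_le`), and $d_{BL}$ itself, are 1-Lipschitz in the
matrix. Gaussian concentration (`LipschitzWith.hasSubgaussianMGF_stdGaussian`, by the Maurey-Pisier
rotation argument) applies to both.

Bias. Let $f$ solve Stein's equation $f'(x)-xf(x)=s(x)-\gamma(s)$ (`exists_stein_solution`). Then
the bias is $\mathbb E\,\mathrm{ntr}(f'(H)-Hf(H))$, and $Hf(H)$ is the sum over bonds of
$x_k(9n)^{-1/2}B_kf(H)$. Expand $f(H)$ around the matrix with $x_k$ set to $0$: the zeroth order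
averages to zero, and since $B_k^2=1$ the first order yields $(9n)^{-1}\mathrm{ntr}f'(H)$ up to a
small error. The remainder is governed by the commutator of $H$ with $B_k$, to which at most 27
bonds contribute, so it is $O(n^{-3/2})$ for each of the $9n$ bonds (`abs_ntr_sub_mul_cfc_sub_le`,
`abs_integral_bond_expansion_le`).

Supremum. With $q=n^{1/6}$, every test function is interpolated on a grid of mesh $1/q$ over an
interval of length about $q$, at cost $O(1/q)$ (`dBL_le_sum_ramp`). The roughly $q^2$ ramp functions
contribute $q^2\cdot O(q^{-3})$, which gives (a). Concentration of $d_{BL}$ around its mean gives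
(b), and Borel-Cantelli with $t=n^{-1/6}$ gives (c). For $n=2$, where bonds coincide, the trivial
bound $d_{BL}\le2$ suffices. -/

/-! ### Gaussian concentration for Lipschitz functions -/

theorem absolutelyContinuous_pi_fin {d : ℕ} {X : Fin d → Type*} [∀ i, MeasurableSpace (X i)]
    {μ ν : ∀ i, Measure (X i)} [∀ i, SigmaFinite (μ i)] [∀ i, SigmaFinite (ν i)]
    (h : ∀ i, μ i ≪ ν i) : Measure.pi μ ≪ Measure.pi ν := by
  induction d with
  | zero =>
    rw [Measure.pi_of_empty, Measure.pi_of_empty]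
  | succ d ih =>
    have h1 := (measurePreserving_piFinSuccAbove μ 0).symm
    have h2 := (measurePreserving_piFinSuccAbove ν 0).symm
    rw [← h1.map_eq, ← h2.map_eq]
    exact ((h 0).prod (ih fun i => h _)).map (MeasurableEquiv.measurable _)

section

variable {E : Type*} [NormedAddCommGroup E] [InnerProductSpace ℝ E]

theorem LipschitzWith.abs_rotation_increment_le {F : E → ℝ} {L : ℝ≥0} (hF : LipschitzWith L F)
    {δ : ℝ} (hδ : 0 ≤ δ) (p : E × E) :
    |F (Real.cos δ • p.1 + Real.sin δ • p.2) - F p.1| ≤ L * δ * (‖p.1‖ + ‖p.2‖) := by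
  have h1 := hF.dist_le_mul (Real.cos δ • p.1 + Real.sin δ • p.2) p.1
  rw [Real.dist_eq, dist_eq_norm] at h1
  refine h1.trans ?_
  rw [mul_assoc]
  refine mul_le_mul_of_nonneg_left ?_ L.2
  have h3 : Real.cos δ • p.1 + Real.sin δ • p.2 - p.1
      = (Real.cos δ - 1) • p.1 + Real.sin δ • p.2 := by
    rw [sub_smul, one_smul]; abel
  rw [h3]
  refine (norm_add_le _ _).trans ?_
  rw [norm_smul, norm_smul, mul_add]
  have hs : |Real.sin δ| ≤ δ := by
    simpa [abs_of_nonneg hδ] using (Real.abs_sin_le_abs (x := δ))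
  have hc : |Real.cos δ - 1| ≤ δ := by
    have := Real.abs_cos_sub_cos_le δ 0
    simpa [abs_of_nonneg hδ] using this
  gcongr
  · simpa using hc
  · simpa using hs

/-- The path `cos θ • p.1 + sin θ • p.2` has velocity `p.2` at `θ = 0`, so this is a difference
quotient with step `π / (2 m)`. -/
theorem tendsto_rotation_increment {F : E → ℝ} (p : E × E) (h : DifferentiableAt ℝ F p.1) :
    Tendsto (fun m : ℕ => (m : ℝ) * (F (Real.cos (Real.pi / 2 / m) • p.1 +
      Real.sin (Real.pi / 2 / m) • p.2) - F p.1)) atTop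
      (𝓝 (Real.pi / 2 * fderiv ℝ F p.1 p.2)) := by
  set g : ℝ → ℝ := fun θ => F (Real.cos θ • p.1 + Real.sin θ • p.2) with hg
  have hpath : HasDerivAt (fun θ : ℝ => Real.cos θ • p.1 + Real.sin θ • p.2) p.2 0 := by
    have h1 := ((Real.hasDerivAt_cos 0).smul_const p.1).add
      ((Real.hasDerivAt_sin 0).smul_const p.2)
    exact HasDerivAt.congr_deriv h1 (by simp)
  have hd : HasDerivAt g (fderiv ℝ F p.1 p.2) 0 := by
    have hF : HasFDerivAt F (fderiv ℝ F p.1)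
        ((fun θ : ℝ => Real.cos θ • p.1 + Real.sin θ • p.2) 0) := by
      simpa using h.hasFDerivAt
    exact hF.comp_hasDerivAt (0 : ℝ) hpath
  have h2 := hd.tendsto_slope_zero
  have h3 : Tendsto (fun m : ℕ => Real.pi / 2 / (m : ℝ)) atTop (𝓝[≠] 0) := by
    refine tendsto_nhdsWithin_iff.2 ⟨tendsto_const_div_atTop_nhds_zero_nat _, ?_⟩
    filter_upwards [eventually_gt_atTop 0] with m hm
    have : (0 : ℝ) < m := by exact_mod_cast hm
    simp only [Set.mem_compl_iff, Set.mem_singleton_iff]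
    positivity
  have h4 := (h2.comp h3).const_mul (Real.pi / 2)
  refine h4.congr' ?_
  filter_upwards [eventually_gt_atTop 0] with m hm
  have : (0 : ℝ) < m := by exact_mod_cast hm
  simp only [Function.comp, smul_eq_mul, hg, zero_add, Real.cos_zero, Real.sin_zero, one_smul,
    zero_smul, add_zero]
  field_simp

theorem LipschitzWith.norm_fderiv_sq_le {F : E → ℝ} {L : ℝ≥0} (hF : LipschitzWith L F) (x : E) :
    ‖fderiv ℝ F x‖ ^ 2 ≤ L ^ 2 := by
  have := norm_fderiv_le_of_lipschitz ℝ hF (x₀ := x)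
  gcongr

end

section

variable {E : Type*} [NormedAddCommGroup E] [InnerProductSpace ℝ E] [FiniteDimensional ℝ E]
  [MeasurableSpace E] [BorelSpace E]

/-- Carries Rademacher's theorem from Lebesgue measure to the Gaussian measure. -/
theorem stdGaussian_absolutelyContinuous : stdGaussian E ≪ (volume : Measure E) := by
  let e := (stdOrthonormalBasis ℝ E).repr
  have h0 : stdGaussian (EuclideanSpace ℝ (Fin (Module.finrank ℝ E))) ≪ volume := by
    rw [← map_pi_eq_stdGaussian, ← (PiLp.volume_preserving_toLp _).map_eq, volume_pi]
    refine (absolutelyContinuous_pi_fin fun i => ?_).map (by fun_prop)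
    exact gaussianReal_absolutelyContinuous _ one_ne_zero
  rw [← stdGaussian_map e.symm, ← (e.symm.measurePreserving).map_eq]
  exact h0.map e.symm.continuous.measurable

theorem integrable_exp_mul_norm (μ : Measure E) [IsGaussian μ] (a : ℝ) :
    Integrable (fun x => Real.exp (a * ‖x‖)) μ := by
  obtain ⟨C, hC, hi⟩ := IsGaussian.exists_integrable_exp_sq μ
  refine (hi.const_mul (Real.exp (a ^ 2 / (4 * C)))).mono' (by fun_prop) (ae_of_all _ fun x => ?_)
  rw [Real.norm_eq_abs, Real.abs_exp, ← Real.exp_add]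
  refine Real.exp_le_exp.2 ?_
  have : a ^ 2 / (4 * C) + C * ‖x‖ ^ 2 - a * ‖x‖ = (a - 2 * C * ‖x‖) ^ 2 / (4 * C) := by
    field_simp
    ring
  have h2 : 0 ≤ (a - 2 * C * ‖x‖) ^ 2 / (4 * C) := by positivity
  linarith

theorem integrable_exp_norm_add (a : ℝ) :
    Integrable (fun p : E × E => Real.exp (a * (‖p.1‖ + ‖p.2‖)))
      ((stdGaussian E).prod (stdGaussian E)) := by
  simp_rw [mul_add, Real.exp_add]
  exact (integrable_exp_mul_norm _ a).mul_prod (integrable_exp_mul_norm _ a)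

theorem integral_exp_dual_stdGaussian (L : StrongDual ℝ E) :
    ∫ y, Real.exp (L y) ∂(stdGaussian E) = Real.exp (‖L‖ ^ 2 / 2) := by
  have h := IsGaussian.map_eq_gaussianReal (μ := stdGaussian E) L
  have h2 := mgf_gaussianReal h 1
  simp only [mgf, one_mul] at h2
  rw [h2, variance_dual_stdGaussian]
  simp

/-- The quarter turn from `p.1` to `p.2` is cut into `m` equal rotations. Then `F p.2 - F p.1` is
the mean of `m` times the increments, Jensen's inequality applies to `exp`, and by rotation
invariance of the Gaussian product measure every increment has the law of the first. Working with
finite `m` means that differentiability of `F` is needed only at `p.1` in the limit. -/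
theorem LipschitzWith.integral_exp_increment_le {F : E → ℝ} {L : ℝ≥0} (hF : LipschitzWith L F)
    (l : ℝ) (m : ℕ) (hm : 0 < m) :
    ∫ p : E × E, Real.exp (l * (F p.2 - F p.1)) ∂((stdGaussian E).prod (stdGaussian E))
      ≤ ∫ p : E × E, Real.exp (l * (m * (F (Real.cos (Real.pi / 2 / m) • p.1 +
        Real.sin (Real.pi / 2 / m) • p.2) - F p.1))) ∂((stdGaussian E).prod (stdGaussian E)) := by
  set γ := (stdGaussian E).prod (stdGaussian E) with hγ
  set δ := Real.pi / 2 / m with hδ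
  have hm' : (0 : ℝ) < m := by exact_mod_cast hm
  have hδ0 : 0 ≤ δ := by have := Real.pi_pos; positivity
  have hFm : Continuous F := hF.continuous
  set G : E × E → ℝ := fun p =>
    Real.exp (l * (m * (F (Real.cos δ • p.1 + Real.sin δ • p.2) - F p.1))) with hG
  have hGc : Continuous G := by fun_prop
  have hGi : Integrable G γ := by
    refine (integrable_exp_norm_add (E := E) (|l| * m * (L * δ))).mono' (by fun_prop)
      (ae_of_all _ fun p => ?_)
    rw [Real.norm_eq_abs, Real.abs_exp]
    refine Real.exp_le_exp.2 ((le_abs_self _).trans ?_)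
    rw [abs_mul, abs_mul, abs_of_pos hm', mul_assoc |l|, mul_assoc |l|, mul_assoc (m : ℝ)]
    gcongr
    exact hF.abs_rotation_increment_le hδ0 p
  have hrot : ∀ θ : ℝ, MeasurePreserving (ContinuousLinearMap.rotation (E := E) θ) γ γ := fun θ =>
    ⟨(ContinuousLinearMap.rotation θ).continuous.measurable,
      IsGaussian.map_rotation_eq_self (by simp) θ⟩
  have hcomp : ∀ θ : ℝ, ∫ p, G (ContinuousLinearMap.rotation θ p) ∂γ = ∫ p, G p ∂γ := fun θ => by
    rw [← integral_map (hrot θ).aemeasurable, (hrot θ).map_eq]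
    rw [(hrot θ).map_eq]; exact hGc.aestronglyMeasurable
  have hcompi : ∀ θ : ℝ, Integrable (fun p => G (ContinuousLinearMap.rotation θ p)) γ := fun θ =>
    (hrot θ).integrable_comp_of_integrable hGi
  have hpt : ∀ p : E × E, Real.exp (l * (F p.2 - F p.1))
      ≤ ∑ k ∈ Finset.range m, (1 / m : ℝ) *
        G (ContinuousLinearMap.rotation (k * δ) p) := by
    intro p
    set Y : ℕ → E := fun k => Real.cos (k * δ) • p.1 + Real.sin (k * δ) • p.2 with hY
    have hstep : ∀ k : ℕ, Real.cos δ • (ContinuousLinearMap.rotation (k * δ) p).1 +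
        Real.sin δ • (ContinuousLinearMap.rotation (k * δ) p).2 = Y (k + 1) := by
      intro k
      simp only [ContinuousLinearMap.rotation_apply, hY]
      push_cast
      rw [add_mul, one_mul, Real.cos_add, Real.sin_add]
      module
    have hG2 : ∀ k : ℕ, G (ContinuousLinearMap.rotation (k * δ) p)
        = Real.exp (m * (l * (F (Y (k + 1)) - F (Y k)))) := by
      intro k
      simp only [hG, hstep]
      congr 1
      rw [ContinuousLinearMap.rotation_apply]
      ring
    have hsum : l * (F p.2 - F p.1)
        = ∑ k ∈ Finset.range m, (1 / m : ℝ) • (m * (l * (F (Y (k + 1)) - F (Y k)))) := by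
      have h1 : ∑ k ∈ Finset.range m, (F (Y (k + 1)) - F (Y k)) = F p.2 - F p.1 := by
        rw [Finset.sum_range_sub (fun k => F (Y k))]
        have e1 : (m : ℝ) * δ = Real.pi / 2 := by rw [hδ]; field_simp
        simp [hY, e1]
      rw [← h1, Finset.mul_sum]
      refine Finset.sum_congr rfl fun k _ => ?_
      rw [smul_eq_mul]
      field_simp
    rw [hsum]
    simp_rw [hG2]
    refine convexOn_exp.map_sum_le (fun _ _ => by positivity) ?_ (fun _ _ => Set.mem_univ _)
    simp
    field_simp
  calc ∫ p, Real.exp (l * (F p.2 - F p.1)) ∂γ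
      ≤ ∫ p, ∑ k ∈ Finset.range m, (1 / m : ℝ) *
        G (ContinuousLinearMap.rotation (k * δ) p) ∂γ := by
        refine integral_mono_of_nonneg (ae_of_all _ fun p => (Real.exp_pos _).le) ?_
          (ae_of_all _ hpt)
        exact integrable_finsetSum _ fun k _ => (hcompi _).const_mul _
    _ = ∫ p, G p ∂γ := by
        rw [integral_finsetSum _ fun k _ => (hcompi _).const_mul _]
        simp_rw [integral_const_mul, hcomp]
        simp
        field_simp

/-- The exponential moment bound behind Gaussian concentration. -/
theorem LipschitzWith.integral_exp_sub_le {F : E → ℝ} {L : ℝ≥0} (hF : LipschitzWith L F) (l : ℝ) :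
    ∫ p : E × E, Real.exp (l * (F p.2 - F p.1)) ∂((stdGaussian E).prod (stdGaussian E))
      ≤ Real.exp (l ^ 2 * (Real.pi / 2) ^ 2 * L ^ 2 / 2) := by
  set γ := (stdGaussian E).prod (stdGaussian E) with hγ
  have hFm : Continuous F := hF.continuous
  have hdiff : ∀ᵐ p ∂γ, DifferentiableAt ℝ F p.1 :=
    Measure.quasiMeasurePreserving_fst.ae
      (stdGaussian_absolutelyContinuous.ae_le hF.ae_differentiableAt)
  have hint : Integrable (fun p : E × E => Real.exp (|l| * (L * (Real.pi / 2)) *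
      (‖p.1‖ + ‖p.2‖))) γ := integrable_exp_norm_add _
  have hlim : Tendsto (fun m : ℕ => ∫ p : E × E, Real.exp (l * (m * (F (Real.cos (Real.pi / 2 / m)
      • p.1 + Real.sin (Real.pi / 2 / m) • p.2) - F p.1))) ∂γ) atTop
      (𝓝 (∫ p, Real.exp (l * (Real.pi / 2 * fderiv ℝ F p.1 p.2)) ∂γ)) := by
    refine tendsto_integral_of_dominated_convergence _
      (fun m => Continuous.aestronglyMeasurable (by fun_prop)) hint (fun m => ?_) ?_
    · refine ae_of_all _ fun p => ?_
      rw [Real.norm_eq_abs, Real.abs_exp]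
      refine Real.exp_le_exp.2 ((le_abs_self _).trans ?_)
      -- For `m = 0` the factor `m` annihilates the exponent.
      rcases Nat.eq_zero_or_pos m with rfl | hm
      · simp; have := Real.pi_pos; positivity
      have hm' : (0 : ℝ) < m := by exact_mod_cast hm
      have h := hF.abs_rotation_increment_le (δ := Real.pi / 2 / m)
        (by have := Real.pi_pos; positivity) p
      rw [abs_mul, abs_mul, abs_of_pos hm', mul_assoc |l|]
      refine mul_le_mul_of_nonneg_left ?_ (abs_nonneg l)
      calc _ ≤ (m : ℝ) * (L * (Real.pi / 2 / m) * (‖p.1‖ + ‖p.2‖)) := mul_le_mul_of_nonneg_left h hm'.le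
        _ = _ := by field_simp
    · filter_upwards [hdiff] with p hp
      exact (Real.continuous_exp.tendsto _).comp ((tendsto_rotation_increment p hp).const_mul l)
  have hle := ge_of_tendsto hlim
    ((eventually_gt_atTop 0).mono fun m hm => hF.integral_exp_increment_le l m hm)
  refine hle.trans ?_
  -- With `x` fixed, the derivative at `x` applied to a Gaussian `y` is a centred Gaussian of
  -- variance at most `L ^ 2`, whose exponential moment is explicit.
  have hinner : ∀ x : E, ∫ y, Real.exp (l * (Real.pi / 2 * fderiv ℝ F x y)) ∂(stdGaussian E)
      ≤ Real.exp (l ^ 2 * (Real.pi / 2) ^ 2 * L ^ 2 / 2) := by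
    intro x
    have h := integral_exp_dual_stdGaussian ((l * (Real.pi / 2)) • fderiv ℝ F x)
    simp only [smul_apply, smul_eq_mul, mul_assoc] at h
    rw [h]
    refine Real.exp_le_exp.2 ?_
    rw [norm_smul, mul_pow, Real.norm_eq_abs, sq_abs, mul_pow]
    have := hF.norm_fderiv_sq_le x
    gcongr
  have hint2 : Integrable (fun p : E × E => Real.exp (l * (Real.pi / 2 * fderiv ℝ F p.1 p.2))) γ := by
    refine hint.mono' ?_ (ae_of_all _ fun p => ?_)
    · have h1 : Measurable fun p : E × E => fderiv ℝ F p.1 p.2 := by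
        have := (measurable_fderiv ℝ F)
        exact (ContinuousLinearMap.measurable_apply₂).comp
          ((this.comp measurable_fst).prodMk measurable_snd)
      exact (by fun_prop : Measurable fun p : E × E =>
        Real.exp (l * (Real.pi / 2 * fderiv ℝ F p.1 p.2))).aestronglyMeasurable
    · rw [Real.norm_eq_abs, Real.abs_exp]
      refine Real.exp_le_exp.2 ((le_abs_self _).trans ?_)
      have h1 : |fderiv ℝ F p.1 p.2| ≤ L * ‖p.2‖ := by
        refine ((fderiv ℝ F p.1).le_opNorm p.2).trans ?_
        gcongr
        exact norm_fderiv_le_of_lipschitz ℝ hF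
      rw [abs_mul, abs_mul, abs_of_pos (by have := Real.pi_pos; positivity : 0 < Real.pi / 2)]
      calc |l| * (Real.pi / 2 * |fderiv ℝ F p.1 p.2|)
          ≤ |l| * (Real.pi / 2 * (L * ‖p.2‖)) := by gcongr
        _ = |l| * (L * (Real.pi / 2)) * ‖p.2‖ := by ring
        _ ≤ _ := by gcongr; simp
  rw [integral_prod _ hint2]
  calc _ ≤ ∫ x, Real.exp (l ^ 2 * (Real.pi / 2) ^ 2 * L ^ 2 / 2) ∂(stdGaussian E) :=
        integral_mono hint2.integral_prod_left (integrable_const _) hinner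
    _ = _ := by simp

theorem LipschitzWith.integrable_exp_mul_stdGaussian {F : E → ℝ} {L : ℝ≥0}
    (hF : LipschitzWith L F) (t : ℝ) :
    Integrable (fun x => Real.exp (t * F x)) (stdGaussian E) := by
  have hFm : Continuous F := hF.continuous
  refine ((integrable_exp_mul_norm _ (|t| * L)).const_mul (Real.exp (|t| * |F 0|))).mono'
    (by fun_prop) (ae_of_all _ fun x => ?_)
  rw [Real.norm_eq_abs, Real.abs_exp, ← Real.exp_add]
  refine Real.exp_le_exp.2 ((le_abs_self _).trans ?_)
  have h1 := hF.dist_le_mul x 0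
  rw [Real.dist_eq, dist_zero_right] at h1
  have h2 : |F x| ≤ |F 0| + L * ‖x‖ := by
    have := abs_add_le (F x - F 0) (F 0)
    rw [sub_add_cancel] at this
    linarith
  rw [abs_mul, mul_assoc |t|, ← mul_add]
  gcongr

theorem LipschitzWith.integrable_stdGaussian {F : E → ℝ} {L : ℝ≥0}
    (hF : LipschitzWith L F) : Integrable F (stdGaussian E) := by
  have hFm : Continuous F := hF.continuous
  have h1 := hF.integrable_exp_mul_stdGaussian 1
  have h2 := hF.integrable_exp_mul_stdGaussian (-1)
  refine (h1.add h2).mono' (by fun_prop) (ae_of_all _ fun x => ?_)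
  simp only [Pi.add_apply, one_mul, neg_one_mul, Real.norm_eq_abs]
  have e1 := Real.add_one_le_exp (F x)
  have e2 := Real.add_one_le_exp (-F x)
  have e3 := Real.exp_pos (F x)
  have e4 := Real.exp_pos (-F x)
  rw [abs_le]
  constructor <;> linarith

/-- Gaussian concentration: Lipschitz functions of a standard Gaussian vector are sub-Gaussian. -/
theorem LipschitzWith.hasSubgaussianMGF_stdGaussian {F : E → ℝ} {L : ℝ≥0}
    (hF : LipschitzWith L F) :
    HasSubgaussianMGF (fun x => F x - ∫ y, F y ∂(stdGaussian E))
      ((Real.toNNReal (Real.pi / 2)) ^ 2 * L ^ 2) (stdGaussian E) := by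
  set a := ∫ y, F y ∂(stdGaussian E) with ha
  have hexp : ∀ t : ℝ, Integrable (fun x => Real.exp (t * (F x - a))) (stdGaussian E) := by
    intro t
    simp_rw [mul_sub, Real.exp_sub]
    exact (hF.integrable_exp_mul_stdGaussian t).div_const _
  refine ⟨hexp, fun t => ?_⟩
  have h1 := hF.integral_exp_sub_le t
  have hsplit : ∫ p : E × E, Real.exp (t * (F p.2 - F p.1)) ∂((stdGaussian E).prod (stdGaussian E))
      = (∫ x, Real.exp (-t * (F x - a)) ∂(stdGaussian E)) *
        ∫ x, Real.exp (t * (F x - a)) ∂(stdGaussian E) := by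
    rw [← integral_prod_mul]
    refine integral_congr_ae (ae_of_all _ fun p => ?_)
    simp only [← Real.exp_add]
    ring_nf
  -- The double integral factorises into two exponential moments; the one with `-t` is at least one
  -- because the centred function has mean zero, so it can be dropped.
  have hone : 1 ≤ ∫ x, Real.exp (-t * (F x - a)) ∂(stdGaussian E) := by
    have hi : Integrable (fun x => -t * (F x - a)) (stdGaussian E) :=
      (hF.integrable_stdGaussian.sub (integrable_const _)).const_mul _
    have h2 : ∫ x, (-t * (F x - a) + 1) ∂(stdGaussian E) = 1 := by
      rw [integral_add hi (integrable_const _), integral_const_mul,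
        integral_sub hF.integrable_stdGaussian (integrable_const _)]
      simp [ha]
    rw [← h2]
    exact integral_mono (hi.add (integrable_const _)) (hexp _) fun x => Real.add_one_le_exp _
  rw [hsplit] at h1
  have h3 : mgf (fun x => F x - a) (stdGaussian E) t
      = ∫ x, Real.exp (t * (F x - a)) ∂(stdGaussian E) := rfl
  have h4 : 0 ≤ ∫ x, Real.exp (t * (F x - a)) ∂(stdGaussian E) :=
    integral_nonneg fun x => (Real.exp_pos _).le
  have h5 : ((Real.toNNReal (Real.pi / 2) ^ 2 * L ^ 2 : ℝ≥0) : ℝ) * t ^ 2 / 2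
      = t ^ 2 * (Real.pi / 2) ^ 2 * L ^ 2 / 2 := by
    push_cast
    rw [Real.coe_toNNReal _ (by have := Real.pi_pos; positivity)]
    ring
  rw [h3, h5]
  nlinarith

theorem LipschitzWith.integral_abs_sub_integral_le {F : E → ℝ} {L : ℝ≥0}
    (hF : LipschitzWith L F) (hL : 0 < L) :
    ∫ x, |F x - ∫ y, F y ∂(stdGaussian E)| ∂(stdGaussian E)
      ≤ 2 * Real.exp ((Real.pi / 2) ^ 2 / 2) * L := by
  have hs := hF.hasSubgaussianMGF_stdGaussian
  set a := ∫ y, F y ∂(stdGaussian E) with ha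
  have hL' : (0 : ℝ) < L := hL
  -- This is `|u| ≤ exp u + exp (-u)`. Rescaling by `L⁻¹` makes the resulting exponential moment
  -- independent of `L`.
  have hpt : ∀ x, |F x - a| ≤ L * (Real.exp ((L : ℝ)⁻¹ * (F x - a)) +
      Real.exp (-(L : ℝ)⁻¹ * (F x - a))) := by
    intro x
    set u := (L : ℝ)⁻¹ * (F x - a) with hu
    have e0 : F x - a = L * u := by rw [hu]; field_simp
    have e1 := Real.add_one_le_exp u
    have e2 := Real.add_one_le_exp (-u)
    have e3 := Real.exp_pos u
    have e4 := Real.exp_pos (-u)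
    rw [neg_mul, ← hu, e0, abs_mul, abs_of_pos hL']
    refine mul_le_mul_of_nonneg_left ?_ hL'.le
    rw [abs_le]
    constructor <;> linarith
  have hb : ∀ t : ℝ, t ^ 2 = ((L : ℝ)⁻¹) ^ 2 →
      ∫ x, Real.exp (t * (F x - a)) ∂(stdGaussian E) ≤ Real.exp ((Real.pi / 2) ^ 2 / 2) := by
    intro t ht
    refine (hs.mgf_le t).trans (le_of_eq ?_)
    push_cast
    rw [Real.coe_toNNReal _ (by have := Real.pi_pos; positivity), ht]
    congr 1
    field_simp
  have i1 := hs.integrable_exp_mul (L : ℝ)⁻¹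
  have i2 := hs.integrable_exp_mul (-(L : ℝ)⁻¹)
  calc ∫ x, |F x - a| ∂(stdGaussian E)
      ≤ ∫ x, L * (Real.exp ((L : ℝ)⁻¹ * (F x - a)) + Real.exp (-(L : ℝ)⁻¹ * (F x - a)))
          ∂(stdGaussian E) :=
        integral_mono_of_nonneg (ae_of_all _ fun x => abs_nonneg _) ((i1.add i2).const_mul _)
          (ae_of_all _ hpt)
    _ ≤ _ := by
        rw [integral_const_mul, integral_add i1 i2]
        have b1 := hb (L : ℝ)⁻¹ rfl
        have b2 := hb (-(L : ℝ)⁻¹) (by ring)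
        nlinarith

end

section

variable {ι : Type*} [Fintype ι]

theorem measurePreserving_toLp_stdGaussian :
    MeasurePreserving (WithLp.toLp 2 : (ι → ℝ) → EuclideanSpace ℝ ι)
      (Measure.pi fun _ => gaussianReal 0 1) (stdGaussian (EuclideanSpace ℝ ι)) :=
  ⟨by fun_prop, map_pi_eq_stdGaussian⟩

/-- The Euclidean distance is written out because the metric on `ι → ℝ` is the sup metric. -/
theorem lipschitzWith_comp_ofLp {F : (ι → ℝ) → ℝ} {L : ℝ≥0}
    (hF : ∀ x y, |F x - F y| ≤ L * √(∑ i, (x i - y i) ^ 2)) :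
    LipschitzWith L (fun x : EuclideanSpace ℝ ι => F (WithLp.ofLp x)) := by
  refine LipschitzWith.of_dist_le_mul fun x y => ?_
  rw [Real.dist_eq, EuclideanSpace.dist_eq]
  simpa [Real.dist_eq, sq_abs] using hF (WithLp.ofLp x) (WithLp.ofLp y)

theorem integrable_pi_gaussian_of_lipschitz {F : (ι → ℝ) → ℝ} {L : ℝ≥0}
    (hF : ∀ x y, |F x - F y| ≤ L * √(∑ i, (x i - y i) ^ 2)) :
    Integrable F (Measure.pi fun _ => gaussianReal 0 1) :=
  measurePreserving_toLp_stdGaussian.integrable_comp_of_integrable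
    (lipschitzWith_comp_ofLp hF).integrable_stdGaussian

theorem integral_toLp_stdGaussian {F : (ι → ℝ) → ℝ} {L : ℝ≥0}
    (hF : ∀ x y, |F x - F y| ≤ L * √(∑ i, (x i - y i) ^ 2)) :
    ∫ x, F (WithLp.ofLp x) ∂(stdGaussian (EuclideanSpace ℝ ι))
      = ∫ x, F x ∂(Measure.pi fun _ => gaussianReal 0 1) := by
  rw [← measurePreserving_toLp_stdGaussian.map_eq, integral_map (by fun_prop)]
  rw [measurePreserving_toLp_stdGaussian.map_eq]
  exact (lipschitzWith_comp_ofLp hF).continuous.aestronglyMeasurable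

theorem hasSubgaussianMGF_pi_gaussian_of_lipschitz {F : (ι → ℝ) → ℝ} {L : ℝ≥0}
    (hF : ∀ x y, |F x - F y| ≤ L * √(∑ i, (x i - y i) ^ 2)) :
    HasSubgaussianMGF (fun x => F x - ∫ y, F y ∂(Measure.pi fun _ => gaussianReal 0 1))
      ((Real.toNNReal (Real.pi / 2)) ^ 2 * L ^ 2) (Measure.pi fun _ => gaussianReal 0 1) := by
  have h := (lipschitzWith_comp_ofLp hF).hasSubgaussianMGF_stdGaussian
  rw [integral_toLp_stdGaussian hF, ← measurePreserving_toLp_stdGaussian.map_eq] at h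
  exact h.of_map (by fun_prop)

theorem integral_abs_sub_integral_pi_gaussian_le {F : (ι → ℝ) → ℝ} {L : ℝ≥0} (hL : 0 < L)
    (hF : ∀ x y, |F x - F y| ≤ L * √(∑ i, (x i - y i) ^ 2)) :
    ∫ x, |F x - ∫ y, F y ∂(Measure.pi fun _ => gaussianReal 0 1)|
        ∂(Measure.pi fun _ => gaussianReal 0 1)
      ≤ 2 * Real.exp ((Real.pi / 2) ^ 2 / 2) * L := by
  have h := (lipschitzWith_comp_ofLp hF).integral_abs_sub_integral_le hL
  rw [integral_toLp_stdGaussian hF, ← measurePreserving_toLp_stdGaussian.map_eq,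
    integral_map (by fun_prop)] at h
  · exact h
  · rw [measurePreserving_toLp_stdGaussian.map_eq]
    have := (lipschitzWith_comp_ofLp hF).continuous
    exact (this.sub continuous_const).abs.aestronglyMeasurable

end

/-! ### Normalised Hilbert-Schmidt norm and the coupling of two spectra -/

noncomputable section

open Matrix

section HilbertSchmidt

variable {ι : Type*} [Fintype ι]

/-- The square of the Hilbert-Schmidt norm, normalised so that the identity has norm one. -/
def hsSq (M : Matrix ι ι ℂ) : ℝ := (Fintype.card ι : ℝ)⁻¹ * ∑ i, ∑ j, ‖M i j‖ ^ 2

/-- The real part of the normalised trace. -/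
def ntr (M : Matrix ι ι ℂ) : ℝ := (Fintype.card ι : ℝ)⁻¹ * M.trace.re

theorem hsSq_nonneg (M : Matrix ι ι ℂ) : 0 ≤ hsSq M := by
  unfold hsSq; positivity

theorem hsSq_eq_ntr (M : Matrix ι ι ℂ) : hsSq M = ntr (M * Mᴴ) := by
  unfold hsSq ntr
  congr 1
  simp only [Matrix.trace, Matrix.diag, Matrix.mul_apply, Matrix.conjTranspose_apply,
    Complex.re_sum]
  refine Finset.sum_congr rfl fun i _ => Finset.sum_congr rfl fun j _ => ?_
  rw [Complex.star_def, Complex.mul_conj, Complex.ofReal_re, Complex.normSq_eq_norm_sq]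

theorem hsSq_smul (c : ℂ) (M : Matrix ι ι ℂ) : hsSq (c • M) = ‖c‖ ^ 2 * hsSq M := by
  simp only [hsSq, Matrix.smul_apply, smul_eq_mul, norm_mul, mul_pow, ← Finset.mul_sum]
  ring

/-- Cauchy-Schwarz in each entry. The factor is the number of terms, which is harmless for the
bounded number of bonds near a given one. -/
theorem hsSq_sum_le {κ : Type*} (s : Finset κ) (M : κ → Matrix ι ι ℂ) :
    hsSq (∑ k ∈ s, M k) ≤ s.card * ∑ k ∈ s, hsSq (M k) := by
  simp only [hsSq, ← Finset.mul_sum]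
  rw [mul_left_comm]
  refine mul_le_mul_of_nonneg_left ?_ (by positivity)
  rw [Finset.sum_comm (s := s), Finset.mul_sum]
  refine Finset.sum_le_sum fun i _ => ?_
  rw [Finset.sum_comm (s := s), Finset.mul_sum]
  refine Finset.sum_le_sum fun j _ => ?_
  rw [Matrix.sum_apply]
  refine le_trans ?_ (sq_sum_le_card_mul_sum_sq (s := s) (f := fun k => ‖M k i j‖))
  gcongr
  exact norm_sum_le _ _

theorem hsSq_add_le (M N : Matrix ι ι ℂ) : hsSq (M + N) ≤ 2 * (hsSq M + hsSq N) := by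
  simpa using hsSq_sum_le Finset.univ ![M, N]

theorem hsSq_neg (M : Matrix ι ι ℂ) : hsSq (-M) = hsSq M := by
  simp [hsSq]

theorem hsSq_sub_comm (M N : Matrix ι ι ℂ) : hsSq (M - N) = hsSq (N - M) := by
  rw [← hsSq_neg, neg_sub]

theorem continuous_hsSq : Continuous (hsSq : Matrix ι ι ℂ → ℝ) := by
  unfold hsSq
  refine continuous_const.mul (continuous_finsetSum _ fun i _ => continuous_finsetSum _ fun j _ => ?_)
  exact ((continuous_apply_apply i j).norm.pow 2)

theorem norm_entry_sq_le_hsSq (M : Matrix ι ι ℂ) (i j : ι) :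
    ‖M i j‖ ^ 2 ≤ Fintype.card ι * hsSq M := by
  have hN : (Fintype.card ι : ℝ) ≠ 0 := by
    have : 0 < Fintype.card ι := Fintype.card_pos_iff.2 ⟨i⟩
    positivity
  rw [hsSq, mul_inv_cancel_left₀ hN]
  exact (Finset.single_le_sum (f := fun j => ‖M i j‖ ^ 2) (fun _ _ => by positivity)
    (Finset.mem_univ j)).trans
    (Finset.single_le_sum (f := fun i => ∑ j, ‖M i j‖ ^ 2) (fun _ _ => by positivity)
    (Finset.mem_univ i))

theorem continuous_ntr : Continuous (ntr : Matrix ι ι ℂ → ℝ) := by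
  unfold ntr
  exact continuous_const.mul (Complex.continuous_re.comp (Continuous.matrix_trace continuous_id))

theorem ntr_sub (M N : Matrix ι ι ℂ) : ntr (M - N) = ntr M - ntr N := by
  simp [ntr, mul_sub]

theorem ntr_smul (c : ℝ) (M : Matrix ι ι ℂ) : ntr ((c : ℂ) • M) = c * ntr M := by
  simp [ntr]; ring

theorem ntr_sum {κ : Type*} (s : Finset κ) (M : κ → Matrix ι ι ℂ) :
    ntr (∑ k ∈ s, M k) = ∑ k ∈ s, ntr (M k) := by
  simp [ntr, Matrix.trace_sum, Finset.mul_sum]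

theorem abs_ntr_mul_le (P M : Matrix ι ι ℂ) : |ntr (P * M)| ≤ (hsSq P + hsSq M) / 2 := by
  unfold ntr hsSq
  have hN : (0 : ℝ) ≤ (Fintype.card ι : ℝ)⁻¹ := by positivity
  rw [abs_mul, abs_of_nonneg hN, ← mul_add, mul_div_assoc]
  refine mul_le_mul_of_nonneg_left ?_ hN
  refine (Complex.abs_re_le_norm _).trans ?_
  simp only [Matrix.trace, Matrix.diag, Matrix.mul_apply]
  rw [Finset.sum_comm (f := fun i j => ‖M i j‖ ^ 2), ← Finset.sum_add_distrib, Finset.sum_div]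
  refine (norm_sum_le _ _).trans (Finset.sum_le_sum fun i _ => ?_)
  rw [← Finset.sum_add_distrib, Finset.sum_div]
  refine (norm_sum_le _ _).trans (Finset.sum_le_sum fun j _ => ?_)
  rw [norm_mul]
  nlinarith [sq_nonneg (‖P i j‖ - ‖M j i‖)]

end HilbertSchmidt

section Spectral

variable {ι : Type*} [Fintype ι] [DecidableEq ι] {A B : Matrix ι ι ℂ}

theorem hsSq_unitary_mul {P : Matrix ι ι ℂ} (hP : Pᴴ * P = 1) (M : Matrix ι ι ℂ) :
    hsSq (P * M) = hsSq M := by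
  rw [hsSq_eq_ntr, hsSq_eq_ntr, ntr, ntr, Matrix.conjTranspose_mul, Matrix.mul_assoc P,
    Matrix.trace_mul_comm P, Matrix.mul_assoc M, Matrix.mul_assoc Mᴴ, hP, Matrix.mul_one]

theorem hsSq_one [Nonempty ι] : hsSq (1 : Matrix ι ι ℂ) = 1 := by
  rw [hsSq_eq_ntr]
  simp [ntr]

theorem hsSq_unitary [Nonempty ι] {P : Matrix ι ι ℂ} (hP : Pᴴ * P = 1) : hsSq P = 1 := by
  rw [← Matrix.mul_one P, hsSq_unitary_mul hP, hsSq_one]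

theorem hermitian_cfc_eq_mul (hA : A.IsHermitian) (f : ℝ → ℝ) :
    hA.cfc f = (hA.eigenvectorUnitary : Matrix ι ι ℂ) *
      diagonal (fun i => (f (hA.eigenvalues i) : ℂ)) *
      star (hA.eigenvectorUnitary : Matrix ι ι ℂ) := by
  rw [Matrix.IsHermitian.cfc, Unitary.conjStarAlgAut_apply]
  rfl

theorem hermitian_cfc_id (hA : A.IsHermitian) : hA.cfc (fun x => x) = A := by
  conv_rhs => rw [hA.spectral_theorem, Unitary.conjStarAlgAut_apply]
  rw [hermitian_cfc_eq_mul]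
  rfl

theorem star_eigenvectorUnitary_mul (hA : A.IsHermitian) :
    star (hA.eigenvectorUnitary : Matrix ι ι ℂ) * (hA.eigenvectorUnitary : Matrix ι ι ℂ) = 1 :=
  Unitary.coe_star_mul_self _

theorem eigenvectorUnitary_mul_star (hA : A.IsHermitian) :
    (hA.eigenvectorUnitary : Matrix ι ι ℂ) * star (hA.eigenvectorUnitary : Matrix ι ι ℂ) = 1 :=
  Unitary.coe_mul_star_self _

theorem hermitian_cfc_one (hA : A.IsHermitian) : hA.cfc (fun _ => 1) = 1 := by
  rw [hermitian_cfc_eq_mul]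
  simp

theorem hermitian_cfc_mul (hA : A.IsHermitian) (f g : ℝ → ℝ) :
    hA.cfc f * hA.cfc g = hA.cfc fun x => f x * g x := by
  simp only [hermitian_cfc_eq_mul]
  set U := (hA.eigenvectorUnitary : Matrix ι ι ℂ)
  have hU : star U * U = 1 := star_eigenvectorUnitary_mul hA
  set D := diagonal fun i => (f (hA.eigenvalues i) : ℂ) with hD
  set E := diagonal fun i => (g (hA.eigenvalues i) : ℂ) with hE
  have h : U * D * star U * (U * E * star U) = U * (D * E) * star U := by
    calc _ = U * D * (star U * U) * E * star U := by simp only [Matrix.mul_assoc]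
      _ = _ := by rw [hU, Matrix.mul_one, Matrix.mul_assoc U]
  rw [h, hD, hE, diagonal_mul_diagonal]
  congr 3
  ext i
  push_cast
  rfl

theorem hermitian_mul_cfc (hA : A.IsHermitian) (f : ℝ → ℝ) :
    A * hA.cfc f = hA.cfc fun x => x * f x := by
  rw [← hermitian_cfc_mul hA (fun x => x) f, hermitian_cfc_id]

theorem hermitian_cfc_sq (hA : A.IsHermitian) : hA.cfc (fun x => x ^ 2) = A * A := by
  have h := hermitian_mul_cfc hA fun x => x
  rw [hermitian_cfc_id] at h
  rw [h]
  simp only [sq]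

theorem hermitian_cfc_isHermitian (hA : A.IsHermitian) (f : ℝ → ℝ) : (hA.cfc f).IsHermitian := by
  rw [hermitian_cfc_eq_mul, Matrix.IsHermitian, conjTranspose_mul, conjTranspose_mul, star_eq_conjTranspose,
    conjTranspose_conjTranspose, diagonal_conjTranspose, Matrix.mul_assoc]
  congr 3
  ext i
  simp

theorem ntr_cfc (hA : A.IsHermitian) (f : ℝ → ℝ) :
    ntr (hA.cfc f) = (Fintype.card ι : ℝ)⁻¹ * ∑ i, f (hA.eigenvalues i) := by
  rw [ntr, hermitian_cfc_eq_mul, trace_mul_cycle, star_eigenvectorUnitary_mul]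
  simp [Matrix.trace]

/-- A matrix expressed in an eigenbasis of `A` on the left and an eigenbasis of `B` on the
right. -/
def mixedBasis (hA : A.IsHermitian) (hB : B.IsHermitian) (X : Matrix ι ι ℂ) : Matrix ι ι ℂ :=
  star (hA.eigenvectorUnitary : Matrix ι ι ℂ) * X * (hB.eigenvectorUnitary : Matrix ι ι ℂ)

/-- The squared overlaps of the eigenvectors of `A` with those of `B`, normalised to be a coupling
of the two spectral measures. -/
def overlap (hA : A.IsHermitian) (hB : B.IsHermitian) (i j : ι) : ℝ :=
  (Fintype.card ι : ℝ)⁻¹ * ‖mixedBasis hA hB 1 i j‖ ^ 2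

theorem overlap_nonneg (hA : A.IsHermitian) (hB : B.IsHermitian) (i j : ι) :
    0 ≤ overlap hA hB i j := by
  unfold overlap; positivity

theorem mixedBasis_sub (hA : A.IsHermitian) (hB : B.IsHermitian) (X Y : Matrix ι ι ℂ) :
    mixedBasis hA hB (X - Y) = mixedBasis hA hB X - mixedBasis hA hB Y := by
  simp [mixedBasis, Matrix.mul_sub, Matrix.sub_mul]

/-- Functions of `A` on the left and of `B` on the right are simultaneously diagonalised in the
mixed basis: the product becomes an entrywise multiplier of the overlap matrix. Differences are then
treated as if `A` and `B` were scalars. -/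
theorem mixedBasis_cfc_mul_cfc (hA : A.IsHermitian) (hB : B.IsHermitian) (f g : ℝ → ℝ) (i j : ι) :
    mixedBasis hA hB (hA.cfc f * hB.cfc g) i j
      = ((f (hA.eigenvalues i) * g (hB.eigenvalues j) : ℝ) : ℂ) * mixedBasis hA hB 1 i j := by
  have h : mixedBasis hA hB (hA.cfc f * hB.cfc g)
      = diagonal (fun i => (f (hA.eigenvalues i) : ℂ)) * mixedBasis hA hB 1 *
        diagonal (fun i => (g (hB.eigenvalues i) : ℂ)) := by
    simp only [mixedBasis, hermitian_cfc_eq_mul, Matrix.mul_one]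
    set U := (hA.eigenvectorUnitary : Matrix ι ι ℂ)
    set W := (hB.eigenvectorUnitary : Matrix ι ι ℂ)
    have hU : star U * U = 1 := star_eigenvectorUnitary_mul hA
    have hW : star W * W = 1 := star_eigenvectorUnitary_mul hB
    calc _ = (star U * U) * diagonal (fun i => (f (hA.eigenvalues i) : ℂ)) * (star U * W) *
          diagonal (fun i => (g (hB.eigenvalues i) : ℂ)) * (star W * W) := by
          simp only [Matrix.mul_assoc]
      _ = _ := by rw [hU, hW, Matrix.one_mul, Matrix.mul_one]
  rw [h, Matrix.mul_diagonal, Matrix.diagonal_mul]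
  push_cast
  ring

theorem mixedBasis_cfc_sub_cfc (hA : A.IsHermitian) (hB : B.IsHermitian) (f : ℝ → ℝ) (i j : ι) :
    mixedBasis hA hB (hA.cfc f - hB.cfc f) i j
      = ((f (hA.eigenvalues i) - f (hB.eigenvalues j) : ℝ) : ℂ) * mixedBasis hA hB 1 i j := by
  have h1 := mixedBasis_cfc_mul_cfc hA hB f (fun _ => 1) i j
  have h2 := mixedBasis_cfc_mul_cfc hA hB (fun _ => 1) f i j
  rw [hermitian_cfc_one, Matrix.mul_one] at h1
  rw [hermitian_cfc_one, Matrix.one_mul] at h2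
  rw [mixedBasis_sub, Matrix.sub_apply, h1, h2]
  push_cast
  ring

theorem mixedBasis_sub_self (hA : A.IsHermitian) (hB : B.IsHermitian) (i j : ι) :
    mixedBasis hA hB (A - B) i j
      = ((hA.eigenvalues i - hB.eigenvalues j : ℝ) : ℂ) * mixedBasis hA hB 1 i j := by
  have := mixedBasis_cfc_sub_cfc hA hB (fun x => x) i j
  rwa [hermitian_cfc_id, hermitian_cfc_id] at this

/-- With `D = A - B` the matrix is `A² - 2AB + B² = [B, D] + D²`. Its Hilbert-Schmidt norm thus
gives the fourth moment of the eigenvalue differences under the coupling, and is small when `B`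
nearly commutes with `D`. -/
theorem mixedBasis_second_difference (hA : A.IsHermitian) (hB : B.IsHermitian) (i j : ι) :
    mixedBasis hA hB (A * (A - B) - (A - B) * B) i j
      = (((hA.eigenvalues i - hB.eigenvalues j) ^ 2 : ℝ) : ℂ) * mixedBasis hA hB 1 i j := by
  have h1 := mixedBasis_cfc_mul_cfc hA hB (fun x => x ^ 2) (fun _ => 1) i j
  have h2 := mixedBasis_cfc_mul_cfc hA hB (fun _ => 1) (fun x => x ^ 2) i j
  have h3 := mixedBasis_cfc_mul_cfc hA hB (fun x => x) (fun x => x) i j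
  rw [hermitian_cfc_one, Matrix.mul_one, hermitian_cfc_sq] at h1
  rw [hermitian_cfc_one, Matrix.one_mul, hermitian_cfc_sq] at h2
  rw [hermitian_cfc_id, hermitian_cfc_id] at h3
  have e : A * (A - B) - (A - B) * B = (A * A - A * B) - (A * B - B * B) := by noncomm_ring
  rw [e, mixedBasis_sub, mixedBasis_sub, mixedBasis_sub]
  simp only [Matrix.sub_apply]
  rw [h1, h2, h3]
  push_cast
  ring

theorem ntr_mul_cfc_mul (hA : A.IsHermitian) (hB : B.IsHermitian) (X Y : Matrix ι ι ℂ)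
    (g : ℝ → ℝ) (p q : ι → ι → ℝ)
    (hX : ∀ i j, mixedBasis hA hB X i j = (p i j : ℂ) * mixedBasis hA hB 1 i j)
    (hY : ∀ i j, mixedBasis hA hB Y i j = (q i j : ℂ) * mixedBasis hA hB 1 i j) :
    ntr (X * hB.cfc g * Yᴴ)
      = ∑ i, ∑ j, overlap hA hB i j * (p i j * q i j * g (hB.eigenvalues j)) := by
  have h : (X * hB.cfc g * Yᴴ).trace = (mixedBasis hA hB X *
      diagonal (fun i => (g (hB.eigenvalues i) : ℂ)) * (mixedBasis hA hB Y)ᴴ).trace := by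
    simp only [mixedBasis, hermitian_cfc_eq_mul, conjTranspose_mul, star_eq_conjTranspose,
      conjTranspose_conjTranspose]
    set U := (hA.eigenvectorUnitary : Matrix ι ι ℂ)
    set W := (hB.eigenvectorUnitary : Matrix ι ι ℂ)
    have hU : U * Uᴴ = 1 := eigenvectorUnitary_mul_star hA
    conv_rhs => rw [show Uᴴ * X * W * diagonal (fun i => (g (hB.eigenvalues i) : ℂ)) *
      (Wᴴ * (Yᴴ * U)) = Uᴴ * (X * W * diagonal (fun i => (g (hB.eigenvalues i) : ℂ)) * (Wᴴ * (Yᴴ * U))) by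
        simp only [Matrix.mul_assoc], Matrix.trace_mul_comm]
    simp only [Matrix.mul_assoc, hU, Matrix.mul_one]
  rw [ntr, h]
  simp only [Matrix.trace, Matrix.diag, Matrix.mul_apply (N := (mixedBasis hA hB Y)ᴴ),
    Matrix.mul_diagonal, conjTranspose_apply, Complex.re_sum, hX, hY, Finset.mul_sum, overlap]
  refine Finset.sum_congr rfl fun i _ => Finset.sum_congr rfl fun j _ => ?_
  have : ((p i j : ℂ) * mixedBasis hA hB 1 i j * (g (hB.eigenvalues j) : ℂ) *
      star ((q i j : ℂ) * mixedBasis hA hB 1 i j))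
      = ((p i j * q i j * g (hB.eigenvalues j) : ℝ) : ℂ) *
        (mixedBasis hA hB 1 i j * star (mixedBasis hA hB 1 i j)) := by
    simp only [star_mul', Complex.star_def, Complex.conj_ofReal]
    push_cast
    ring
  rw [this, Complex.star_def, Complex.mul_conj, ← Complex.ofReal_mul, Complex.ofReal_re,
    Complex.normSq_eq_norm_sq]
  ring

theorem hsSq_eq_sum_overlap (hA : A.IsHermitian) (hB : B.IsHermitian) (X : Matrix ι ι ℂ)
    (p : ι → ι → ℝ)
    (hX : ∀ i j, mixedBasis hA hB X i j = (p i j : ℂ) * mixedBasis hA hB 1 i j) :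
    hsSq X = ∑ i, ∑ j, overlap hA hB i j * p i j ^ 2 := by
  have := ntr_mul_cfc_mul hA hB X X (fun _ => 1) p p hX hX
  rw [hermitian_cfc_one, Matrix.mul_one] at this
  rw [hsSq_eq_ntr, this]
  simp [sq]

/-- The change of basis is unitary, so its columns are unit vectors; with the companion for rows
this says that the marginals of the coupling are the two spectral measures. -/
theorem sum_overlap_left (hA : A.IsHermitian) (hB : B.IsHermitian) (j : ι) :
    ∑ i, overlap hA hB i j = (Fintype.card ι : ℝ)⁻¹ := by
  have h : (mixedBasis hA hB 1)ᴴ * mixedBasis hA hB 1 = 1 := by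
    simp only [mixedBasis, Matrix.mul_one, conjTranspose_mul, star_eq_conjTranspose,
      conjTranspose_conjTranspose]
    rw [Matrix.mul_assoc, ← Matrix.mul_assoc (hA.eigenvectorUnitary : Matrix ι ι ℂ),
      ← star_eq_conjTranspose (hA.eigenvectorUnitary : Matrix ι ι ℂ), eigenvectorUnitary_mul_star,
      Matrix.one_mul, ← star_eq_conjTranspose, star_eigenvectorUnitary_mul]
  have h2 := congrArg Complex.re (congrFun (congrFun h j) j)
  simp only [Matrix.mul_apply, conjTranspose_apply, Matrix.one_apply_eq, Complex.re_sum,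
    Complex.star_def, ← Complex.normSq_eq_conj_mul_self, Complex.ofReal_re, Complex.one_re,
    Complex.normSq_eq_norm_sq] at h2
  simp only [overlap, ← Finset.mul_sum, h2, mul_one]

theorem sum_overlap_right (hA : A.IsHermitian) (hB : B.IsHermitian) (i : ι) :
    ∑ j, overlap hA hB i j = (Fintype.card ι : ℝ)⁻¹ := by
  have h : mixedBasis hA hB 1 * (mixedBasis hA hB 1)ᴴ = 1 := by
    simp only [mixedBasis, Matrix.mul_one, conjTranspose_mul, star_eq_conjTranspose,
      conjTranspose_conjTranspose]
    rw [Matrix.mul_assoc, ← Matrix.mul_assoc (hB.eigenvectorUnitary : Matrix ι ι ℂ),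
      ← star_eq_conjTranspose (hB.eigenvectorUnitary : Matrix ι ι ℂ), eigenvectorUnitary_mul_star,
      Matrix.one_mul, ← star_eq_conjTranspose, star_eigenvectorUnitary_mul]
  have h2 := congrArg Complex.re (congrFun (congrFun h i) i)
  simp only [Matrix.mul_apply, conjTranspose_apply, Matrix.one_apply_eq, Complex.re_sum,
    Complex.star_def, Complex.mul_conj, Complex.ofReal_re, Complex.one_re,
    Complex.normSq_eq_norm_sq] at h2
  simp only [overlap, ← Finset.mul_sum, h2, mul_one]

theorem ntr_cfc_left (hA : A.IsHermitian) (hB : B.IsHermitian) (f : ℝ → ℝ) :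
    ntr (hA.cfc f) = ∑ i, ∑ j, overlap hA hB i j * f (hA.eigenvalues i) := by
  simp_rw [ntr_cfc, ← Finset.sum_mul, sum_overlap_right, Finset.mul_sum]

theorem ntr_cfc_right (hA : A.IsHermitian) (hB : B.IsHermitian) (f : ℝ → ℝ) :
    ntr (hB.cfc f) = ∑ i, ∑ j, overlap hA hB i j * f (hB.eigenvalues j) := by
  rw [Finset.sum_comm]
  simp_rw [ntr_cfc, ← Finset.sum_mul, sum_overlap_left, Finset.mul_sum]

theorem sum_overlap_le_one (hA : A.IsHermitian) (hB : B.IsHermitian) :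
    ∑ i, ∑ j, overlap hA hB i j ≤ 1 := by
  simp_rw [sum_overlap_right]
  rw [Finset.sum_const, Finset.card_univ, nsmul_eq_mul]
  exact mul_inv_le_one

/-- Linear statistics with a Lipschitz test function are Lipschitz in the normalised
Hilbert-Schmidt norm. -/
theorem abs_ntr_cfc_sub_le (hA : A.IsHermitian) (hB : B.IsHermitian) {f : ℝ → ℝ} {K : ℝ}
    (hK : 0 ≤ K) (hf : ∀ x y, |f x - f y| ≤ K * |x - y|) :
    |ntr (hA.cfc f) - ntr (hB.cfc f)| ≤ K * √(hsSq (A - B)) := by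
  rw [ntr_cfc_left hA hB, ntr_cfc_right hA hB, ← Finset.sum_sub_distrib]
  simp_rw [← Finset.sum_sub_distrib, ← mul_sub]
  rw [hsSq_eq_sum_overlap hA hB (A - B) _ (mixedBasis_sub_self hA hB)]
  have hprod : ∀ g : ι → ι → ℝ, ∑ i, ∑ j, g i j = ∑ p : ι × ι, g p.1 p.2 := fun g =>
    (Fintype.sum_prod_type' g).symm
  have h1 := sum_overlap_le_one hA hB
  rw [hprod] at h1 ⊢
  rw [hprod]
  set d : ι × ι → ℝ := fun p => |hA.eigenvalues p.1 - hB.eigenvalues p.2|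
  set w : ι × ι → ℝ := fun p => overlap hA hB p.1 p.2
  have hw : ∀ p, 0 ≤ w p := fun p => overlap_nonneg hA hB _ _
  -- Cauchy-Schwarz for weights of total mass at most one.
  have h2 : (∑ p, w p * d p) ^ 2 ≤ ∑ p, w p * d p ^ 2 := by
    have h3 := Finset.sum_mul_sq_le_sq_mul_sq Finset.univ (fun p => √(w p)) (fun p => √(w p) * d p)
    have e1 : ∀ p, √(w p) * (√(w p) * d p) = w p * d p := fun p => by
      rw [← mul_assoc, Real.mul_self_sqrt (hw p)]
    simp only [e1, mul_pow, Real.sq_sqrt (hw _)] at h3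
    have h4 : 0 ≤ ∑ p, w p * d p ^ 2 :=
      Finset.sum_nonneg fun p _ => mul_nonneg (hw p) (sq_nonneg _)
    nlinarith
  calc |∑ p : ι × ι, w p * (f (hA.eigenvalues p.1) - f (hB.eigenvalues p.2))|
      ≤ ∑ p, w p * (K * d p) := by
        refine (Finset.abs_sum_le_sum_abs _ _).trans (Finset.sum_le_sum fun p _ => ?_)
        rw [abs_mul, abs_of_nonneg (hw p)]
        exact mul_le_mul_of_nonneg_left (hf _ _) (hw p)
    _ = K * ∑ p, w p * d p := by
        rw [Finset.mul_sum]
        exact Finset.sum_congr rfl fun p _ => by ring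
    _ ≤ _ := by
        refine mul_le_mul_of_nonneg_left ?_ hK
        refine Real.le_sqrt_of_sq_le (h2.trans (le_of_eq ?_))
        exact Finset.sum_congr rfl fun p _ => by simp only [d, w, sq_abs]

theorem hsSq_cfc_sub_le (hA : A.IsHermitian) (hB : B.IsHermitian) {f : ℝ → ℝ} {K : ℝ}
    (hf : ∀ x y, |f x - f y| ≤ K * |x - y|) :
    hsSq (hA.cfc f - hB.cfc f) ≤ K ^ 2 * hsSq (A - B) := by
  rw [hsSq_eq_sum_overlap hA hB _ _ (mixedBasis_cfc_sub_cfc hA hB f),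
    hsSq_eq_sum_overlap hA hB _ _ (mixedBasis_sub_self hA hB), Finset.mul_sum]
  refine Finset.sum_le_sum fun i _ => ?_
  rw [Finset.mul_sum]
  refine Finset.sum_le_sum fun j _ => ?_
  rw [mul_left_comm]
  refine mul_le_mul_of_nonneg_left ?_ (overlap_nonneg hA hB i j)
  rw [← sq_abs, ← sq_abs (hA.eigenvalues i - _), ← mul_pow]
  have := hf (hA.eigenvalues i) (hB.eigenvalues j)
  gcongr

/-- First-order expansion of `tr ((A - B) (f(A) - f(B)))` when `(A - B)²` is scalar. The remainder
is controlled by the commutator of `A` and `B`. -/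
theorem abs_ntr_sub_mul_cfc_sub_le (hA : A.IsHermitian) (hB : B.IsHermitian) {f f' : ℝ → ℝ}
    {K c d : ℝ} (hc : 0 < c)
    (hf : ∀ x y, |f x - f y - f' y * (x - y)| ≤ K * (x - y) ^ 2)
    (hD : (A - B) * (A - B) = ((d ^ 2 : ℝ) : ℂ) • (1 : Matrix ι ι ℂ)) :
    |ntr ((A - B) * (hA.cfc f - hB.cfc f)) - d ^ 2 * ntr (hB.cfc f')|
      ≤ K / 2 * (c * hsSq (A - B) + c⁻¹ * hsSq (A * (A - B) - (A - B) * B)) := by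
  have h1 : ntr ((A - B) * (hA.cfc f - hB.cfc f)) = ∑ i, ∑ j, overlap hA hB i j *
      ((hA.eigenvalues i - hB.eigenvalues j) *
        (f (hA.eigenvalues i) - f (hB.eigenvalues j))) := by
    have := ntr_mul_cfc_mul hA hB (A - B) (hA.cfc f - hB.cfc f) (fun _ => 1) _ _
      (mixedBasis_sub_self hA hB) (mixedBasis_cfc_sub_cfc hA hB f)
    rw [hermitian_cfc_one, Matrix.mul_one,
      ((hermitian_cfc_isHermitian hA f).sub (hermitian_cfc_isHermitian hB f)).eq] at this
    simpa using this
  have h2 : d ^ 2 * ntr (hB.cfc f') = ∑ i, ∑ j, overlap hA hB i j *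
      ((hA.eigenvalues i - hB.eigenvalues j) ^ 2 * f' (hB.eigenvalues j)) := by
    have := ntr_mul_cfc_mul hA hB (A - B) (A - B) f' _ _
      (mixedBasis_sub_self hA hB) (mixedBasis_sub_self hA hB)
    rw [(hA.sub hB).eq, ntr, trace_mul_cycle, hD, Matrix.smul_mul, Matrix.one_mul, ← ntr,
      ntr_smul] at this
    rw [this]
    simp only [sq]
  rw [h1, h2, hsSq_eq_sum_overlap hA hB _ _ (mixedBasis_sub_self hA hB),
    hsSq_eq_sum_overlap hA hB _ _ (mixedBasis_second_difference hA hB), Finset.mul_sum,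
    Finset.mul_sum, ← Finset.sum_sub_distrib, ← Finset.sum_add_distrib, Finset.mul_sum]
  refine (Finset.abs_sum_le_sum_abs _ _).trans (Finset.sum_le_sum fun i _ => ?_)
  rw [Finset.mul_sum, Finset.mul_sum, ← Finset.sum_sub_distrib, ← Finset.sum_add_distrib,
    Finset.mul_sum]
  refine (Finset.abs_sum_le_sum_abs _ _).trans (Finset.sum_le_sum fun j _ => ?_)
  have hw := overlap_nonneg hA hB i j
  set w := overlap hA hB i j
  set a := hA.eigenvalues i
  set b := hB.eigenvalues j
  have e : w * ((a - b) * (f a - f b)) - w * ((a - b) ^ 2 * f' b)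
      = w * ((a - b) * (f a - f b - f' b * (a - b))) := by ring
  have e2 : K / 2 * (c * (w * (a - b) ^ 2) + c⁻¹ * (w * ((a - b) ^ 2) ^ 2))
      = w * (K * ((a - b) ^ 2 * ((c + c⁻¹ * (a - b) ^ 2) / 2))) := by ring
  rw [e, e2, abs_mul, abs_of_nonneg hw, abs_mul]
  refine mul_le_mul_of_nonneg_left ?_ hw
  -- The Taylor remainder costs a third absolute moment, which AM-GM with the free parameter `c`
  -- splits into the second and fourth moments; both of these are matrix norms.
  have h3 : |a - b| ≤ (c + c⁻¹ * (a - b) ^ 2) / 2 := by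
    rw [← sq_abs (a - b)]
    have h4 : (c + c⁻¹ * |a - b| ^ 2) / 2 - |a - b| = c⁻¹ * (c - |a - b|) ^ 2 / 2 := by
      field_simp
      ring
    have h5 : 0 ≤ c⁻¹ * (c - |a - b|) ^ 2 / 2 := by positivity
    linarith
  calc |a - b| * |f a - f b - f' b * (a - b)|
      ≤ ((c + c⁻¹ * (a - b) ^ 2) / 2) * (K * (a - b) ^ 2) := by
        gcongr
        exact hf a b
    _ = _ := by ring

theorem integral_spectralMeasure (hA : A.IsHermitian) (f : ℝ → ℝ) :
    ∫ x, f x ∂(spectralMeasure hA) = ntr (hA.cfc f) := by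
  rw [spectralMeasure, integral_smul_measure, integral_finsetSum_measure]
  · simp [ntr_cfc]
  · intro i _
    exact integrable_dirac (by simp)

theorem isProbabilityMeasure_spectralMeasure [Nonempty ι] (hA : A.IsHermitian) :
    IsProbabilityMeasure (spectralMeasure hA) := by
  constructor
  simp only [spectralMeasure, Measure.smul_apply, Measure.coe_finsetSum, Finset.sum_apply,
    measure_univ, Finset.sum_const, Finset.card_univ, nsmul_eq_mul, mul_one, smul_eq_mul]
  exact ENNReal.inv_mul_cancel (by simp) (by simp)

theorem integrable_spectralMeasure [Nonempty ι] (hA : A.IsHermitian) (f : ℝ → ℝ) :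
    Integrable f (spectralMeasure hA) := by
  rw [spectralMeasure]
  refine Integrable.smul_measure ?_ ?_
  · exact integrable_finsetSum_measure.2 fun i _ => integrable_dirac (by simp)
  · simp

end Spectral

end

/-! ### The algebra of the interaction terms: orthogonality and locality -/

noncomputable section

open Matrix

theorem trace_tensorProd {n : ℕ} (A : Fin n → Matrix (Fin 2) (Fin 2) ℂ) :
    (tensorProd A).trace = ∏ k, (A k).trace := by
  simp only [tensorProd, Matrix.trace, Matrix.diag, Matrix.of_apply]
  rw [Finset.prod_univ_sum]
  simp

theorem tensorProd_one {n : ℕ} : tensorProd (fun _ : Fin n => (1 : Matrix (Fin 2) (Fin 2) ℂ)) = 1 := by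
  ext s t
  simp only [tensorProd, Matrix.of_apply, Matrix.one_apply]
  rw [Finset.prod_ite_zero]
  simp [funext_iff]

theorem pauli_mul_self (a : Fin 3) : pauli a * pauli a = 1 := by
  fin_cases a <;> ext i j <;> fin_cases i <;> fin_cases j <;> simp [pauli]

theorem trace_pauli (a : Fin 3) : (pauli a).trace = 0 := by
  fin_cases a <;> simp [pauli, Matrix.trace]

theorem trace_pauli_mul {a b : Fin 3} (h : a ≠ b) : (pauli a * pauli b).trace = 0 := by
  fin_cases a <;> fin_cases b <;> simp_all [pauli, Matrix.trace]

theorem sitePauli_mul_self {n : ℕ} (a : Fin 3) (j : Fin n) :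
    sitePauli a j * sitePauli a j = 1 := by
  rw [sitePauli, tensorProd_mul, ← tensorProd_one]
  congr 1
  funext i
  by_cases h : i = j
  · subst h; simp [pauli_mul_self]
  · simp [Function.update_of_ne h]

/-- The interaction term `σ⁽ᵃ⁾_j σ⁽ᵇ⁾_{j+1}`. -/
def bond {n : ℕ} (k : Fin 3 × Fin 3 × Fin n) : Matrix (Fin n → Fin 2) (Fin n → Fin 2) ℂ :=
  sitePauli k.1 k.2.2 * sitePauli k.2.1 (finRotate n k.2.2)

theorem bond_isHermitian {n : ℕ} (hn : 2 ≤ n) (k : Fin 3 × Fin 3 × Fin n) :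
    (bond k).IsHermitian := by
  rw [bond, Matrix.IsHermitian, Matrix.conjTranspose_mul, (sitePauli_isHermitian _ _).eq,
    (sitePauli_isHermitian _ _).eq]
  exact (sitePauli_commute _ _ (finRotate_ne_self hn k.2.2)).eq.symm

theorem bond_mul_self {n : ℕ} (hn : 2 ≤ n) (k : Fin 3 × Fin 3 × Fin n) : bond k * bond k = 1 := by
  have h := sitePauli_commute k.1 k.2.1 (finRotate_ne_self hn k.2.2)
  rw [bond, h.symm.mul_mul_mul_comm, sitePauli_mul_self, sitePauli_mul_self, Matrix.one_mul]

theorem bond_unitary {n : ℕ} (hn : 2 ≤ n) (k : Fin 3 × Fin 3 × Fin n) :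
    (bond k)ᴴ * bond k = 1 := by
  rw [(bond_isHermitian hn k).eq, bond_mul_self hn]

theorem finRotate_finRotate_ne_self {n : ℕ} (hn : 3 ≤ n) (j : Fin n) :
    finRotate n (finRotate n j) ≠ j := by
  obtain ⟨m, rfl⟩ : ∃ m, n = m + 3 := ⟨n - 3, by omega⟩
  have h := j.2
  intro hj
  have h2 := congrArg Fin.val hj
  simp only [finRotate_apply, Fin.val_add, Fin.val_one'] at h2
  rw [Nat.mod_eq_of_lt (by omega : 1 < m + 3)] at h2
  rcases Nat.lt_or_ge (j.1 + 1) (m + 3) with h3 | h3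
  · rw [Nat.mod_eq_of_lt h3] at h2
    rcases Nat.lt_or_ge (j.1 + 1 + 1) (m + 3) with h4 | h4
    · rw [Nat.mod_eq_of_lt h4] at h2; omega
    · have : j.1 + 1 + 1 = m + 3 := by omega
      rw [this, Nat.mod_self] at h2; omega
  · have : j.1 + 1 = m + 3 := by omega
    rw [this, Nat.mod_self, Nat.mod_eq_of_lt (by omega)] at h2; omega

/-- The factor of a bond at a given site. -/
def bondFactor {n : ℕ} (k : Fin 3 × Fin 3 × Fin n) (i : Fin n) : Matrix (Fin 2) (Fin 2) ℂ :=
  Function.update (fun _ => (1 : Matrix (Fin 2) (Fin 2) ℂ)) k.2.2 (pauli k.1) i *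
    Function.update (fun _ => (1 : Matrix (Fin 2) (Fin 2) ℂ)) (finRotate n k.2.2) (pauli k.2.1) i

theorem bond_eq_tensorProd {n : ℕ} (k : Fin 3 × Fin 3 × Fin n) :
    bond k = tensorProd (bondFactor k) := by
  rw [bond, sitePauli, sitePauli, tensorProd_mul]
  rfl

theorem bondFactor_left {n : ℕ} (hn : 2 ≤ n) (k : Fin 3 × Fin 3 × Fin n) :
    bondFactor k k.2.2 = pauli k.1 := by
  rw [bondFactor, Function.update_self, Function.update_of_ne (finRotate_ne_self hn k.2.2),
    Matrix.mul_one]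

theorem bondFactor_right {n : ℕ} (hn : 2 ≤ n) (k : Fin 3 × Fin 3 × Fin n) :
    bondFactor k (finRotate n k.2.2) = pauli k.2.1 := by
  rw [bondFactor, Function.update_self, Function.update_of_ne (finRotate_ne_self hn k.2.2).symm,
    Matrix.one_mul]

theorem bondFactor_of_ne {n : ℕ} (k : Fin 3 × Fin 3 × Fin n) {i : Fin n} (h1 : i ≠ k.2.2)
    (h2 : i ≠ finRotate n k.2.2) : bondFactor k i = 1 := by
  rw [bondFactor, Function.update_of_ne h1, Function.update_of_ne h2, Matrix.one_mul]

/-- It is enough to find one site where the product of the local factors is traceless. If the bonds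
share their position, it is a site where their Pauli labels differ; otherwise it is an end of `k`
not covered by `l`, the right end when `k` starts where `l` stops. For `n = 2` the statement fails,
since the bonds `(a, b, 0)` and `(b, a, 1)` coincide. -/
theorem trace_bond_mul_bond {n : ℕ} (hn : 3 ≤ n) {k l : Fin 3 × Fin 3 × Fin n} (h : k ≠ l) :
    (bond k * bond l).trace = 0 := by
  rw [bond_eq_tensorProd, bond_eq_tensorProd, tensorProd_mul, trace_tensorProd]
  have h2 : 2 ≤ n := by omega
  suffices ∃ i, (bondFactor k i * bondFactor l i).trace = 0 by
    obtain ⟨i, hi⟩ := this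
    exact Finset.prod_eq_zero (Finset.mem_univ i) hi
  by_cases hj : k.2.2 = l.2.2
  · by_cases ha : k.1 = l.1
    · have hb : k.2.1 ≠ l.2.1 := fun hb => h (Prod.ext ha (Prod.ext hb hj))
      refine ⟨finRotate n k.2.2, ?_⟩
      rw [bondFactor_right h2, hj, bondFactor_right h2, trace_pauli_mul hb]
    · refine ⟨k.2.2, ?_⟩
      rw [bondFactor_left h2, hj, bondFactor_left h2, trace_pauli_mul ha]
  · by_cases hj2 : k.2.2 = finRotate n l.2.2
    · refine ⟨finRotate n k.2.2, ?_⟩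
      rw [bondFactor_right h2, bondFactor_of_ne l, Matrix.mul_one, trace_pauli]
      · rw [hj2]
        exact finRotate_finRotate_ne_self hn _
      · exact fun e => hj ((finRotate n).injective e)
    · refine ⟨k.2.2, ?_⟩
      rw [bondFactor_left h2, bondFactor_of_ne l hj hj2, Matrix.mul_one, trace_pauli]

/-- The interaction terms which need not commute with a given one. -/
def bondNeighbours {n : ℕ} (k : Fin 3 × Fin 3 × Fin n) : Finset (Fin 3 × Fin 3 × Fin n) :=
  Finset.univ ×ˢ Finset.univ ×ˢ {k.2.2, finRotate n k.2.2, (finRotate n).symm k.2.2}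

theorem card_bondNeighbours_le {n : ℕ} (k : Fin 3 × Fin 3 × Fin n) :
    (bondNeighbours k).card ≤ 27 := by
  rw [bondNeighbours, Finset.card_product, Finset.card_product]
  have : Finset.card {k.2.2, finRotate n k.2.2, (finRotate n).symm k.2.2} ≤ 3 := Finset.card_le_three
  simp only [Finset.card_univ, Fintype.card_fin]
  omega

theorem bond_commute {n : ℕ} {k l : Fin 3 × Fin 3 × Fin n} (h : l ∉ bondNeighbours k) :
    Commute (bond l) (bond k) := by
  simp only [bondNeighbours, Finset.mem_product, Finset.mem_univ, true_and, Finset.mem_insert,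
    Finset.mem_singleton, not_or] at h
  obtain ⟨h1, h2, h3⟩ := h
  have h4 : finRotate n l.2.2 ≠ k.2.2 := fun e => h3 (by rw [← e, Equiv.symm_apply_apply])
  have h5 : finRotate n l.2.2 ≠ finRotate n k.2.2 := fun e => h1 ((finRotate n).injective e)
  exact ((sitePauli_commute _ _ h1).mul_left (sitePauli_commute _ _ h4)).mul_right
    ((sitePauli_commute _ _ h2).mul_left (sitePauli_commute _ _ h5))

/-- The Hamiltonian as a function of the family of all coefficients. -/
def chainHam {n : ℕ} (x : Fin 3 × Fin 3 × Fin n → ℝ) : Matrix (Fin n → Fin 2) (Fin n → Fin 2) ℂ :=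
  hamiltonian fun a b j => x (a, b, j)

theorem chainHam_isHermitian {n : ℕ} (hn : 2 ≤ n) (x : Fin 3 × Fin 3 × Fin n → ℝ) :
    (chainHam x).IsHermitian := hamiltonian_isHermitian hn _

theorem chainHam_eq {n : ℕ} (x : Fin 3 × Fin 3 × Fin n → ℝ) :
    chainHam x = ((1 / √(9 * n) : ℝ) : ℂ) • ∑ k, (x k : ℂ) • bond k := by
  rw [chainHam, hamiltonian]
  congr 1
  rw [Fintype.sum_prod_type]
  simp_rw [Fintype.sum_prod_type]
  rw [Finset.sum_comm]
  refine Finset.sum_congr rfl fun a _ => ?_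
  rw [Finset.sum_comm]
  rfl

theorem chainHam_sub {n : ℕ} (x y : Fin 3 × Fin 3 × Fin n → ℝ) :
    chainHam x - chainHam y = chainHam (x - y) := by
  simp only [chainHam_eq, ← smul_sub, ← Finset.sum_sub_distrib, ← sub_smul, Pi.sub_apply,
    Complex.ofReal_sub]

theorem continuous_chainHam {n : ℕ} :
    Continuous (chainHam : (Fin 3 × Fin 3 × Fin n → ℝ) → _) := by
  have : (chainHam : (Fin 3 × Fin 3 × Fin n → ℝ) → _) =
      fun x => ((1 / √(9 * n) : ℝ) : ℂ) • ∑ k, (x k : ℂ) • bond k := by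
    funext x; exact chainHam_eq x
  rw [this]
  fun_prop

theorem hsSq_chainHam {n : ℕ} (hn : 3 ≤ n) (x : Fin 3 × Fin 3 × Fin n → ℝ) :
    hsSq (chainHam x) = (9 * n : ℝ)⁻¹ * ∑ k, x k ^ 2 := by
  have h2 : 2 ≤ n := by omega
  rw [chainHam_eq, hsSq_smul, hsSq_eq_ntr]
  have hH : (∑ k, (x k : ℂ) • bond k)ᴴ = ∑ k, (x k : ℂ) • bond k := by
    simp only [conjTranspose_sum, conjTranspose_smul, (bond_isHermitian h2 _).eq,
      Complex.star_def, Complex.conj_ofReal]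
  have hn0 : (0 : ℝ) ≤ 9 * n := by positivity
  rw [hH, Finset.sum_mul_sum, ntr_sum]
  congr 1
  · rw [Complex.norm_real, Real.norm_eq_abs, sq_abs, div_pow, one_pow, Real.sq_sqrt hn0, one_div]
  · refine Finset.sum_congr rfl fun k _ => ?_
    rw [ntr_sum, Finset.sum_eq_single k]
    · rw [Matrix.smul_mul, Matrix.mul_smul, ntr_smul, ntr_smul, bond_mul_self h2]
      have : ntr (1 : Matrix (Fin n → Fin 2) (Fin n → Fin 2) ℂ) = 1 := by
        simpa [hsSq_eq_ntr] using hsSq_one (ι := Fin n → Fin 2)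
      rw [this]; ring
    · intro l _ hl
      rw [Matrix.smul_mul, Matrix.mul_smul, ntr_smul, ntr_smul, ntr,
        trace_bond_mul_bond hn (Ne.symm hl)]
      simp
    · simp

theorem chainHam_sub_update {n : ℕ} (x : Fin 3 × Fin 3 × Fin n → ℝ) (k : Fin 3 × Fin 3 × Fin n) :
    chainHam x - chainHam (Function.update x k 0)
      = ((x k / √(9 * n) : ℝ) : ℂ) • bond k := by
  rw [chainHam_sub, chainHam_eq, Finset.sum_eq_single k]
  · simp only [Pi.sub_apply, Function.update_self, sub_zero, smul_smul]
    congr 1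
    push_cast
    ring
  · intro l _ hl
    simp [Function.update_of_ne hl]
  · simp

theorem hsSq_commutator_bond_le {n : ℕ} (hn : 2 ≤ n) (k l : Fin 3 × Fin 3 × Fin n) :
    hsSq (bond l * bond k - bond k * bond l) ≤ 4 := by
  have h := hsSq_add_le (bond l * bond k) (-(bond k * bond l))
  rw [hsSq_neg, hsSq_unitary_mul (bond_unitary hn l), hsSq_unitary_mul (bond_unitary hn k),
    hsSq_unitary (bond_unitary hn l), hsSq_unitary (bond_unitary hn k), ← sub_eq_add_neg] at h
  linarith

/-- Only bonds sharing a site with `k` fail to commute with it, so the norm is of order `1 / n` and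
not of order one. The constant is `108 = 27 * 4`: 27 from the number of terms, 4 from each
commutator. -/
theorem hsSq_commutator_chainHam_le {n : ℕ} (hn : 2 ≤ n) (y : Fin 3 × Fin 3 × Fin n → ℝ)
    (k : Fin 3 × Fin 3 × Fin n) :
    hsSq (chainHam y * bond k - bond k * chainHam y)
      ≤ (9 * n : ℝ)⁻¹ * (108 * ∑ l ∈ bondNeighbours k, y l ^ 2) := by
  have hn0 : (0 : ℝ) ≤ 9 * n := by positivity
  have e : chainHam y * bond k - bond k * chainHam y = ((1 / √(9 * n) : ℝ) : ℂ) •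
      ∑ l ∈ bondNeighbours k, (y l : ℂ) • (bond l * bond k - bond k * bond l) := by
    rw [chainHam_eq, Matrix.smul_mul, Matrix.mul_smul, ← smul_sub, Finset.sum_mul, Finset.mul_sum,
      ← Finset.sum_sub_distrib]
    congr 1
    rw [Finset.sum_subset (Finset.subset_univ (bondNeighbours k))]
    · refine Finset.sum_congr rfl fun l _ => ?_
      rw [Matrix.smul_mul, Matrix.mul_smul, smul_sub]
    · intro l _ hl
      rw [(bond_commute hl).eq, sub_self, smul_zero]
  rw [e, hsSq_smul, Complex.norm_real, Real.norm_eq_abs, sq_abs, div_pow, one_pow,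
    Real.sq_sqrt hn0, one_div]
  refine mul_le_mul_of_nonneg_left ?_ (by positivity)
  refine (hsSq_sum_le _ _).trans ?_
  have h1 : ∑ l ∈ bondNeighbours k, hsSq ((y l : ℂ) • (bond l * bond k - bond k * bond l))
      ≤ ∑ l ∈ bondNeighbours k, y l ^ 2 * 4 := by
    refine Finset.sum_le_sum fun l _ => ?_
    rw [hsSq_smul, Complex.norm_real, Real.norm_eq_abs, sq_abs]
    exact mul_le_mul_of_nonneg_left (hsSq_commutator_bond_le hn k l) (sq_nonneg _)
  have h2 : ((bondNeighbours k).card : ℝ) ≤ 27 := by exact_mod_cast card_bondNeighbours_le k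
  calc _ ≤ 27 * ∑ l ∈ bondNeighbours k, y l ^ 2 * 4 :=
        mul_le_mul h2 h1 (Finset.sum_nonneg fun _ _ => hsSq_nonneg _) (by norm_num)
    _ = _ := by rw [← Finset.sum_mul]; ring

/-- Removing the coefficient `x k` changes the Hamiltonian by `d • bond k`, and the second
difference is `d` times a commutator plus the scalar `d ^ 2`. Since `d ^ 2` and the squared norm of
the commutator are both of order `1 / n`, the result is of order `1 / n ^ 2`, as it would be for
commuting matrices. -/
theorem hsSq_second_difference_chainHam_le {n : ℕ} (hn : 2 ≤ n) (x : Fin 3 × Fin 3 × Fin n → ℝ)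
    (k : Fin 3 × Fin 3 × Fin n) :
    hsSq (chainHam x * (chainHam x - chainHam (Function.update x k 0)) -
        (chainHam x - chainHam (Function.update x k 0)) * chainHam (Function.update x k 0))
      ≤ ((9 * n : ℝ)⁻¹) ^ 2 *
        (216 * (x k ^ 2 * ∑ l ∈ bondNeighbours k, x l ^ 2) + 2 * x k ^ 4) := by
  have hn0 : (0 : ℝ) ≤ 9 * n := by positivity
  set y := Function.update x k 0 with hy
  set d : ℝ := x k / √(9 * n) with hd
  have hd2 : d ^ 2 = (9 * n : ℝ)⁻¹ * x k ^ 2 := by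
    rw [hd, div_pow, Real.sq_sqrt hn0]; ring
  have e1 := chainHam_sub_update x k
  rw [← hd, ← hy] at e1
  have e2 : chainHam x = chainHam y + (d : ℂ) • bond k := by rw [← e1]; abel
  have e : chainHam x * (chainHam x - chainHam y) - (chainHam x - chainHam y) * chainHam y
      = (d : ℂ) • (chainHam y * bond k - bond k * chainHam y) + ((d ^ 2 : ℝ) : ℂ) • 1 := by
    rw [e1, e2, Matrix.add_mul, Matrix.mul_smul, Matrix.smul_mul, Matrix.smul_mul, Matrix.mul_smul,
      bond_mul_self hn, smul_smul, smul_sub]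
    push_cast
    rw [sq]
    abel
  rw [e]
  refine (hsSq_add_le _ _).trans ?_
  rw [hsSq_smul, hsSq_smul, Complex.norm_real, Complex.norm_real, Real.norm_eq_abs,
    Real.norm_eq_abs, sq_abs, sq_abs, hsSq_one, hd2]
  have h1 := hsSq_commutator_chainHam_le hn y k
  have h2 : ∑ l ∈ bondNeighbours k, y l ^ 2 ≤ ∑ l ∈ bondNeighbours k, x l ^ 2 := by
    refine Finset.sum_le_sum fun l _ => ?_
    by_cases hl : l = k
    · subst hl; simp [hy, sq_nonneg]
    · simp [hy, Function.update_of_ne hl]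
  set M := (9 * n : ℝ)⁻¹ with hM
  have hM0 : 0 ≤ M := by positivity
  calc _ ≤ 2 * (M * x k ^ 2 * (M * (108 * ∑ l ∈ bondNeighbours k, x l ^ 2)) +
        (M * x k ^ 2) ^ 2 * 1) := by
        gcongr
        exact h1.trans (by gcongr)
    _ = _ := by ring

end

/-! ### Mills ratio and Stein's equation -/

noncomputable section

/-- The unnormalised Gaussian density. -/
def gaussWeight (y : ℝ) : ℝ := Real.exp (-y ^ 2 / 2)

theorem gaussWeight_pos (y : ℝ) : 0 < gaussWeight y := Real.exp_pos _

theorem gaussWeight_neg (y : ℝ) : gaussWeight (-y) = gaussWeight y := by simp [gaussWeight]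

theorem continuous_gaussWeight : Continuous gaussWeight := by unfold gaussWeight; fun_prop

theorem integrable_gaussWeight : Integrable gaussWeight := by
  have := integrable_exp_neg_mul_sq (b := 1 / 2) (by norm_num)
  refine this.congr (ae_of_all _ fun y => ?_)
  simp only [gaussWeight]
  ring_nf

theorem hasDerivAt_gaussWeight (y : ℝ) : HasDerivAt gaussWeight (-y * gaussWeight y) y := by
  have h : HasDerivAt (fun y : ℝ => -y ^ 2 / 2) (-y) y := by
    have := ((hasDerivAt_pow 2 y).neg).div_const 2
    refine this.congr_deriv ?_
    push_cast
    ring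
  exact h.exp.congr_deriv (by simp only [gaussWeight]; ring)

theorem integrable_mul_gaussWeight : Integrable fun y => y * gaussWeight y := by
  have := integrable_mul_exp_neg_mul_sq (b := 1 / 2) (by norm_num)
  refine this.congr (ae_of_all _ fun y => ?_)
  simp only [gaussWeight]
  ring_nf

theorem tendsto_gaussWeight_atTop : Tendsto gaussWeight atTop (𝓝 0) := by
  unfold gaussWeight
  refine Real.tendsto_exp_atBot.comp ?_
  have h : Tendsto (fun y : ℝ => y ^ 2 / 2) atTop atTop :=
    (tendsto_pow_atTop (by norm_num)).atTop_div_const (by norm_num)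
  refine (tendsto_neg_atTop_atBot.comp h).congr fun y => ?_
  simp only [Function.comp]
  ring

theorem integrable_bounded_mul_gaussWeight {h : ℝ → ℝ} (hc : Continuous h) {b : ℝ}
    (hb : ∀ x, |h x| ≤ b) : Integrable fun y => h y * gaussWeight y :=
  integrable_gaussWeight.bdd_mul hc.aestronglyMeasurable (ae_of_all _ hb)

theorem integral_Ioi_mul_gaussWeight (x : ℝ) :
    ∫ y in Set.Ioi x, y * gaussWeight y = gaussWeight x := by
  have h := integral_Ioi_of_hasDerivAt_of_tendsto' (a := x) (m := 0)
    (f := fun y => -gaussWeight y) (f' := fun y => y * gaussWeight y)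
    (fun y _ => (hasDerivAt_gaussWeight y).neg.congr_deriv (by ring))
    integrable_mul_gaussWeight.integrableOn (by simpa using tendsto_gaussWeight_atTop.neg)
  simpa using h

theorem mul_integral_Ioi_gaussWeight_le (x : ℝ) :
    x * ∫ y in Set.Ioi x, gaussWeight y ≤ gaussWeight x := by
  rw [← integral_const_mul, ← integral_Ioi_mul_gaussWeight x]
  refine setIntegral_mono_on (integrable_gaussWeight.const_mul _).integrableOn
    integrable_mul_gaussWeight.integrableOn measurableSet_Ioi fun y hy => ?_
  exact mul_le_mul_of_nonneg_right (le_of_lt hy) (gaussWeight_pos y).le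

/-- The lower Mills ratio bound. -/
theorem mul_gaussWeight_le_integral_Ioi (x : ℝ) :
    x * gaussWeight x ≤ (1 + x ^ 2) * ∫ y in Set.Ioi x, gaussWeight y := by
  -- Minus the derivative of the minorant `y / (1 + y ^ 2) * gaussWeight y` is the density times a
  -- factor at most one; integrating over the half-line gives the bound.
  have hd : ∀ y : ℝ, HasDerivAt (fun y => -(y / (1 + y ^ 2) * gaussWeight y))
      ((1 - 2 / (1 + y ^ 2) ^ 2) * gaussWeight y) y := by
    intro y
    have hy : (1 + y ^ 2 : ℝ) ≠ 0 := by positivity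
    have h1 : HasDerivAt (fun y : ℝ => 1 + y ^ 2) (2 * y) y := by
      simpa using (hasDerivAt_pow 2 y).const_add 1
    have h2 := (((hasDerivAt_id y).div h1 hy).mul (hasDerivAt_gaussWeight y)).neg
    refine h2.congr_deriv ?_
    simp only [id, Pi.div_apply]
    field_simp
    ring
  have hbd : ∀ y : ℝ, |1 - 2 / (1 + y ^ 2) ^ 2| ≤ 1 := by
    intro y
    have h1 : 0 ≤ 2 / (1 + y ^ 2) ^ 2 := by positivity
    have h2 : 2 / (1 + y ^ 2) ^ 2 ≤ 2 := by
      rw [div_le_iff₀ (by positivity)]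
      nlinarith [sq_nonneg y, sq_nonneg (y ^ 2)]
    rw [abs_le]
    constructor <;> linarith
  have hcont : Continuous fun y : ℝ => 1 - 2 / (1 + y ^ 2) ^ 2 :=
    continuous_const.sub (continuous_const.div (by fun_prop) fun y => by positivity)
  have hint := integrable_bounded_mul_gaussWeight hcont hbd
  have hlim : Tendsto (fun y => -(y / (1 + y ^ 2) * gaussWeight y)) atTop (𝓝 0) := by
    refine squeeze_zero_norm (fun y => ?_) tendsto_gaussWeight_atTop
    rw [norm_neg, norm_mul, Real.norm_eq_abs, Real.norm_eq_abs, abs_of_pos (gaussWeight_pos y)]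
    refine mul_le_of_le_one_left (gaussWeight_pos y).le ?_
    rw [abs_div, abs_of_pos (by positivity : (0 : ℝ) < 1 + y ^ 2), div_le_one (by positivity)]
    nlinarith [sq_abs y, sq_nonneg (|y| - 1)]
  have h := integral_Ioi_of_hasDerivAt_of_tendsto' (a := x) (fun y _ => hd y) hint.integrableOn hlim
  have hle : ∫ y in Set.Ioi x, (1 - 2 / (1 + y ^ 2) ^ 2) * gaussWeight y
      ≤ ∫ y in Set.Ioi x, gaussWeight y := by
    refine integral_mono hint.integrableOn integrable_gaussWeight.integrableOn fun y => ?_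
    exact mul_le_of_le_one_left (gaussWeight_pos y).le (le_of_abs_le (hbd y))
  rw [h] at hle
  have hx : (0 : ℝ) < 1 + x ^ 2 := by positivity
  have e : x * gaussWeight x = (1 + x ^ 2) * (0 - -(x / (1 + x ^ 2) * gaussWeight x)) := by
    field_simp
    ring
  rw [e]
  exact mul_le_mul_of_nonneg_left hle hx.le

/-- The Mills ratio of the standard Gaussian distribution. -/
def millsRatio (x : ℝ) : ℝ := (gaussWeight x)⁻¹ * ∫ y in Set.Ioi x, gaussWeight y

theorem millsRatio_nonneg (x : ℝ) : 0 ≤ millsRatio x :=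
  mul_nonneg (inv_nonneg.2 (gaussWeight_pos x).le) (integral_nonneg fun y => (gaussWeight_pos y).le)

theorem mul_millsRatio_le_one (x : ℝ) : x * millsRatio x ≤ 1 := by
  rw [millsRatio, mul_left_comm, inv_mul_le_iff₀ (gaussWeight_pos x), mul_one]
  exact mul_integral_Ioi_gaussWeight_le x

theorem le_mul_millsRatio (x : ℝ) : x ≤ (1 + x ^ 2) * millsRatio x := by
  rw [millsRatio, mul_left_comm, le_inv_mul_iff₀ (gaussWeight_pos x), mul_comm]
  exact mul_gaussWeight_le_integral_Ioi x

/-- A constant bounding the Mills ratio on the positive half-line. -/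
def millsBound : ℝ := 1 + Real.exp (1 / 2) * ∫ y, gaussWeight y

theorem millsBound_ge_one : 1 ≤ millsBound := by
  have : 0 ≤ ∫ y, gaussWeight y := integral_nonneg fun y => (gaussWeight_pos y).le
  rw [millsBound]
  have := mul_nonneg (Real.exp_pos (1 / 2)).le this
  linarith

theorem millsRatio_le {x : ℝ} (hx : 0 ≤ x) : millsRatio x ≤ millsBound := by
  rcases le_total x 1 with h | h
  · have h1 : (gaussWeight x)⁻¹ ≤ Real.exp (1 / 2) := by
      rw [gaussWeight, ← Real.exp_neg]
      refine Real.exp_le_exp.2 ?_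
      nlinarith
    have h2 : ∫ y in Set.Ioi x, gaussWeight y ≤ ∫ y, gaussWeight y :=
      setIntegral_le_integral integrable_gaussWeight (ae_of_all _ fun y => (gaussWeight_pos y).le)
    have h3 : 0 ≤ ∫ y in Set.Ioi x, gaussWeight y := integral_nonneg fun y => (gaussWeight_pos y).le
    have h4 : millsRatio x ≤ Real.exp (1 / 2) * ∫ y, gaussWeight y :=
      mul_le_mul h1 h2 h3 (Real.exp_pos _).le
    rw [millsBound]
    linarith
  · have h1 := mul_millsRatio_le_one x
    have h2 := millsRatio_nonneg x
    have := millsBound_ge_one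
    nlinarith

theorem abs_weighted_tail_le {h : ℝ → ℝ} {b : ℝ} (hb : ∀ x, |h x| ≤ b) (x : ℝ) :
    |(gaussWeight x)⁻¹ * ∫ y in Set.Ioi x, h y * gaussWeight y| ≤ b * millsRatio x := by
  rw [abs_mul, abs_of_pos (inv_pos.2 (gaussWeight_pos x)), millsRatio, mul_left_comm,
    ← integral_const_mul]
  refine mul_le_mul_of_nonneg_left ?_ (inv_pos.2 (gaussWeight_pos x)).le
  refine (abs_integral_le_integral_abs).trans ?_
  refine integral_mono_of_nonneg (ae_of_all _ fun y => abs_nonneg _)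
    (integrable_gaussWeight.const_mul _).integrableOn (ae_of_all _ fun y => ?_)
  simp only [abs_mul, abs_of_pos (gaussWeight_pos y)]
  exact mul_le_mul_of_nonneg_right (hb y) (gaussWeight_pos y).le

/-- Up to sign, this bounds the derivative of `x * f x` for the Stein solution `f`. Writing `h y = h
x + (h y - h x)`, the constant part leaves `(1 + x ^ 2) * millsRatio x - x`, at most `millsRatio x`;
the Lipschitz part is at most `(1 + x ^ 2) * (1 - x * millsRatio x)`, at most one by the lower Mills
bound. -/
theorem abs_weighted_tail_sub_le {h : ℝ → ℝ} {b : ℝ} (hb : ∀ x, |h x| ≤ b)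
    (hL : ∀ x y, |h x - h y| ≤ |x - y|) {x : ℝ} (hx : 0 ≤ x) :
    |(1 + x ^ 2) * ((gaussWeight x)⁻¹ * ∫ y in Set.Ioi x, h y * gaussWeight y) - x * h x|
      ≤ b * millsBound + 1 := by
  have hc : Continuous h := by
    refine (LipschitzWith.of_dist_le_mul (K := 1) fun x y => ?_).continuous
    simpa [Real.dist_eq] using hL x y
  have hi := integrable_bounded_mul_gaussWeight hc hb
  have hdi : Integrable fun y => (h y - h x) * gaussWeight y := by
    simp_rw [sub_mul]
    exact hi.sub (integrable_gaussWeight.const_mul _)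
  set T := (gaussWeight x)⁻¹ * ∫ y in Set.Ioi x, (h y - h x) * gaussWeight y with hT
  have hsplit : (gaussWeight x)⁻¹ * ∫ y in Set.Ioi x, h y * gaussWeight y
      = h x * millsRatio x + T := by
    rw [millsRatio, hT, mul_left_comm, ← mul_add, ← integral_const_mul (h x), ← integral_add
      (integrable_gaussWeight.const_mul _).integrableOn hdi.integrableOn]
    congr 2
    funext y
    ring
  have hTb : |T| ≤ 1 - x * millsRatio x := by
    have e : 1 - x * millsRatio x
        = (gaussWeight x)⁻¹ * ∫ y in Set.Ioi x, (y - x) * gaussWeight y := by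
      have : ∫ y in Set.Ioi x, (y - x) * gaussWeight y
          = gaussWeight x - x * ∫ y in Set.Ioi x, gaussWeight y := by
        simp_rw [sub_mul]
        rw [integral_sub integrable_mul_gaussWeight.integrableOn
          (integrable_gaussWeight.const_mul _).integrableOn, integral_Ioi_mul_gaussWeight,
          integral_const_mul]
      rw [this, mul_sub, inv_mul_cancel₀ (gaussWeight_pos x).ne', millsRatio]
      ring
    rw [e, hT, abs_mul, abs_of_pos (inv_pos.2 (gaussWeight_pos x))]
    refine mul_le_mul_of_nonneg_left ?_ (inv_pos.2 (gaussWeight_pos x)).le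
    refine (abs_integral_le_integral_abs).trans ?_
    refine setIntegral_mono_on hdi.abs.integrableOn ?_ measurableSet_Ioi fun y hy => ?_
    · simp_rw [sub_mul]
      exact (integrable_mul_gaussWeight.sub (integrable_gaussWeight.const_mul _)).integrableOn
    · simp only [abs_mul, abs_of_pos (gaussWeight_pos y)]
      refine mul_le_mul_of_nonneg_right ((hL y x).trans ?_) (gaussWeight_pos y).le
      rw [abs_of_pos (sub_pos.2 hy)]
  have hx2 : (0 : ℝ) ≤ 1 + x ^ 2 := by positivity
  have hm1 := le_mul_millsRatio x
  have hm2 := mul_millsRatio_le_one x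
  have hm3 := millsRatio_le hx
  rw [hsplit]
  have e : (1 + x ^ 2) * (h x * millsRatio x + T) - x * h x
      = h x * ((1 + x ^ 2) * millsRatio x - x) + (1 + x ^ 2) * T := by ring
  rw [e]
  refine (abs_add_le _ _).trans (add_le_add ?_ ?_)
  · rw [abs_mul, abs_of_nonneg (sub_nonneg.2 hm1)]
    refine mul_le_mul (hb x) ?_ (sub_nonneg.2 hm1) ((abs_nonneg _).trans (hb x))
    nlinarith
  · rw [abs_mul, abs_of_nonneg hx2]
    calc (1 + x ^ 2) * |T| ≤ (1 + x ^ 2) * (1 - x * millsRatio x) := by gcongr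
      _ ≤ 1 := by nlinarith

theorem integral_gaussianReal_eq (s : ℝ → ℝ) :
    ∫ x, s x ∂(gaussianReal 0 1) = (√(2 * Real.pi))⁻¹ * ∫ x, s x * gaussWeight x := by
  rw [integral_gaussianReal_eq_integral_smul one_ne_zero, ← integral_const_mul]
  refine integral_congr_ae (ae_of_all _ fun x => ?_)
  simp only [gaussianPDFReal, gaussWeight, smul_eq_mul]
  simp
  ring

/-- The solution is the integral of `h * gaussWeight` over `Iic x`, divided by `gaussWeight x`.
Because the total integral vanishes it is also minus the integral over `Ioi x`, so tail estimates
apply for `x ≥ 0`; reflection covers `x ≤ 0`. The last bound controls the derivative of `x * f x`,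
which yields the Lipschitz bound on `f'`. -/
theorem exists_stein_solution_of_mean_zero {h : ℝ → ℝ} (hb : ∀ x, |h x| ≤ 2)
    (hL : ∀ x y, |h x - h y| ≤ |x - y|) (h0 : ∫ y, h y * gaussWeight y = 0) :
    ∃ f : ℝ → ℝ, (∀ x, HasDerivAt f (x * f x + h x) x) ∧ (∀ x, |x * f x| ≤ 2) ∧
      ∀ x, |(1 + x ^ 2) * f x + x * h x| ≤ 2 * millsBound + 1 := by
  have hc : Continuous h := by
    refine (LipschitzWith.of_dist_le_mul (K := 1) fun x y => ?_).continuous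
    simpa [Real.dist_eq] using hL x y
  have hi := integrable_bounded_mul_gaussWeight hc hb
  have hcw : Continuous fun y => h y * gaussWeight y := hc.mul continuous_gaussWeight
  set f : ℝ → ℝ := fun x => (gaussWeight x)⁻¹ * ∫ y in Set.Iic x, h y * gaussWeight y with hf
  have hpos : ∀ x, f x = -((gaussWeight x)⁻¹ * ∫ y in Set.Ioi x, h y * gaussWeight y) := by
    intro x
    have h1 := intervalIntegral.integral_Iic_add_Ioi (b := x) hi.integrableOn hi.integrableOn
    rw [h0] at h1
    simp only [hf]
    rw [eq_neg_of_add_eq_zero_left h1]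
    ring
  have hneg : ∀ x, f (-x) = (gaussWeight x)⁻¹ * ∫ y in Set.Ioi x, h (-y) * gaussWeight y := by
    intro x
    simp only [hf, gaussWeight_neg]
    rw [← integral_comp_neg_Ioi]
    simp only [gaussWeight_neg]
  have hLn : ∀ x y, |h (-x) - h (-y)| ≤ |x - y| := fun x y => by
    refine (hL _ _).trans (le_of_eq ?_)
    rw [← abs_neg]
    congr 1
    ring
  have hmul : ∀ x, 0 ≤ x → x * (2 * millsRatio x) ≤ 2 := fun x hx => by
    have := mul_millsRatio_le_one x
    nlinarith
  refine ⟨f, fun x => ?_, fun x => ?_, fun x => ?_⟩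
  · have h1 : HasDerivAt (fun x => ∫ y in Set.Iic x, h y * gaussWeight y) (h x * gaussWeight x) x := by
      have h2 : (fun x => ∫ y in Set.Iic x, h y * gaussWeight y)
          = fun x => (∫ y in Set.Iic 0, h y * gaussWeight y) + ∫ y in (0)..x, h y * gaussWeight y := by
        funext x
        rw [← intervalIntegral.integral_Iic_sub_Iic hi.integrableOn hi.integrableOn]
        ring
      rw [h2]
      exact (intervalIntegral.integral_hasDerivAt_right (hi.intervalIntegrable)
        (hcw.stronglyMeasurableAtFilter _ _) hcw.continuousAt).const_add _
    have h3 := ((hasDerivAt_gaussWeight x).inv (gaussWeight_pos x).ne').mul h1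
    refine h3.congr_deriv ?_
    have := (gaussWeight_pos x).ne'
    simp only [hf]
    simp only [Pi.inv_apply]
    field_simp
  · rcases le_total 0 x with hx | hx
    · rw [hpos, abs_mul, abs_neg, abs_of_nonneg hx]
      exact (mul_le_mul_of_nonneg_left (abs_weighted_tail_le hb x) hx).trans (hmul x hx)
    · obtain ⟨u, rfl⟩ : ∃ u, x = -u := ⟨-x, by ring⟩
      have hu : 0 ≤ u := by linarith
      rw [hneg, abs_mul, abs_neg, abs_of_nonneg hu]
      exact (mul_le_mul_of_nonneg_left (abs_weighted_tail_le (h := fun y => h (-y)) (fun x => hb _) u) hu).trans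
        (hmul u hu)
  · rcases le_total 0 x with hx | hx
    · rw [hpos, ← abs_neg]
      refine le_trans (le_of_eq ?_) (abs_weighted_tail_sub_le hb hL hx)
      congr 1
      ring
    · obtain ⟨u, rfl⟩ : ∃ u, x = -u := ⟨-x, by ring⟩
      have hu : 0 ≤ u := by linarith
      rw [hneg]
      refine le_trans (le_of_eq ?_) (abs_weighted_tail_sub_le (h := fun y => h (-y))
        (fun x => hb _) hLn hu)
      congr 1
      ring

/-- The constant in the bounds on solutions of Stein's equation. -/
def steinConst : ℝ := 2 * millsBound + 4

theorem steinConst_pos : 0 < steinConst := by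
  have := millsBound_ge_one
  rw [steinConst]
  linarith

theorem abs_sub_le_of_hasDerivAt_le {f f' : ℝ → ℝ} {K : ℝ} (hd : ∀ x, HasDerivAt f (f' x) x)
    (hK : ∀ x, |f' x| ≤ K) (x y : ℝ) : |f x - f y| ≤ K * |x - y| := by
  have := Convex.norm_image_sub_le_of_norm_hasDerivWithin_le (s := Set.univ) (x := y) (y := x)
    (fun z _ => (hd z).hasDerivWithinAt) (fun z _ => hK z) convex_univ (Set.mem_univ _)
    (Set.mem_univ _)
  simpa using this

/-- Stein's equation for a bounded Lipschitz right-hand side. -/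
theorem exists_stein_solution {s : ℝ → ℝ} (hb : ∀ x, |s x| ≤ 1)
    (hL : ∀ x y, |s x - s y| ≤ |x - y|) :
    ∃ f f' : ℝ → ℝ, (∀ x, f' x = x * f x + (s x - ∫ y, s y ∂(gaussianReal 0 1))) ∧
      (∀ x, |f x| ≤ steinConst) ∧ (∀ x, |f' x| ≤ steinConst) ∧ (∀ x y, |f' x - f' y| ≤ steinConst * |x - y|) ∧
      (∀ x y, |f x - f y| ≤ steinConst * |x - y|) ∧
      ∀ x y, |f x - f y - f' y * (x - y)| ≤ steinConst * (x - y) ^ 2 := by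
  set a := ∫ y, s y ∂(gaussianReal 0 1) with ha
  have hc : Continuous s := by
    refine (LipschitzWith.of_dist_le_mul (K := 1) fun x y => ?_).continuous
    simpa [Real.dist_eq] using hL x y
  have hab : |a| ≤ 1 := by
    have := norm_integral_le_of_norm_le_const (μ := gaussianReal 0 1) (f := s) (C := 1)
      (ae_of_all _ hb)
    simpa using this
  have hsi := integrable_bounded_mul_gaussWeight hc hb
  have hmean : ∫ y, (s y - a) * gaussWeight y = 0 := by
    simp_rw [sub_mul]
    rw [integral_sub hsi (integrable_gaussWeight.const_mul _), integral_const_mul]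
    have h1 := integral_gaussianReal_eq s
    have h2 := integral_gaussianReal_eq fun _ => 1
    simp only [integral_const, probReal_univ, smul_eq_mul, one_mul] at h2
    rw [← ha] at h1
    have h3 : (√(2 * Real.pi))⁻¹ ≠ 0 := by
      intro h; rw [h] at h2; simp at h2
    have h4 : (√(2 * Real.pi))⁻¹ * ((∫ y, s y * gaussWeight y) - a * ∫ y, gaussWeight y) = 0 := by
      rw [mul_sub, ← h1, mul_left_comm, ← h2]
      ring
    exact (mul_eq_zero.1 h4).resolve_left h3
  have hb2 : ∀ x, |s x - a| ≤ 2 := fun x => (abs_sub _ _).trans (by linarith [hb x])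
  obtain ⟨f, hd, hxf, hq⟩ := exists_stein_solution_of_mean_zero hb2
    (fun x y => by simpa using hL x y) hmean
  have hM := millsBound_ge_one
  have hf'b : ∀ x, |x * f x + (s x - a)| ≤ steinConst := fun x => by
    refine (abs_add_le _ _).trans ?_
    have := hxf x
    have := hb2 x
    rw [steinConst]
    linarith
  -- For `|x| ≥ 1` the bound on `x * f x` suffices; near zero the bound on `(1 + x ^ 2) * f x + x *
  -- (s x - a)` takes over.
  have hfb : ∀ x, |f x| ≤ steinConst := fun x => by
    have h1 := hxf x
    have h2 := hq x
    have h3 := hb2 x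
    rw [steinConst]
    rcases le_total 1 |x| with hx | hx
    · rw [abs_mul] at h1
      nlinarith [abs_nonneg (f x)]
    · have e : (1 + x ^ 2) * f x = ((1 + x ^ 2) * f x + x * (s x - a)) - x * (s x - a) := by ring
      have h4 : |(1 + x ^ 2) * f x| ≤ 2 * millsBound + 1 + 2 := by
        rw [e]
        refine (abs_sub _ _).trans (add_le_add h2 ?_)
        rw [abs_mul]
        nlinarith [abs_nonneg (s x - a), abs_nonneg x]
      rw [abs_mul, abs_of_pos (by positivity : (0 : ℝ) < 1 + x ^ 2)] at h4
      nlinarith [abs_nonneg (f x), mul_nonneg (sq_nonneg x) (abs_nonneg (f x))]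
  have hxfd : ∀ x, HasDerivAt (fun x => x * f x) ((1 + x ^ 2) * f x + x * (s x - a)) x := fun x => by
    refine ((hasDerivAt_id x).mul (hd x)).congr_deriv ?_
    simp only [id]
    ring
  have hf'L : ∀ x y, |(x * f x + (s x - a)) - (y * f y + (s y - a))| ≤ steinConst * |x - y| := by
    intro x y
    have h1 := abs_sub_le_of_hasDerivAt_le hxfd hq x y
    have h2 := hL x y
    have e : (x * f x + (s x - a)) - (y * f y + (s y - a)) = (x * f x - y * f y) + (s x - s y) := by
      ring
    rw [e]
    refine (abs_add_le _ _).trans ?_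
    rw [steinConst]
    nlinarith [abs_nonneg (x - y)]
  refine ⟨f, fun x => x * f x + (s x - a), fun x => rfl, hfb, hf'b, hf'L,
    abs_sub_le_of_hasDerivAt_le hd hf'b, fun x y => ?_⟩
  -- After subtraction of the tangent slope at `y`, the derivative on the segment from `y` to `x` is
  -- at most `steinConst * |x - y|`, which gives the quadratic remainder without a second derivative
  -- of `f`.
  have hdy : ∀ z, HasDerivAt (fun z => f z - (y * f y + (s y - a)) * z)
      ((z * f z + (s z - a)) - (y * f y + (s y - a))) z := fun z =>
    ((hd z).sub ((hasDerivAt_id z).const_mul (y * f y + (s y - a)))).congr_deriv (by simp)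
  have h := Convex.norm_image_sub_le_of_norm_hasDerivWithin_le (s := Set.uIcc y x) (x := y) (y := x)
    (C := steinConst * |x - y|) (fun z _ => (hdy z).hasDerivWithinAt) (fun z hz => ?_)
    (convex_uIcc y x) Set.left_mem_uIcc Set.right_mem_uIcc
  · rw [Real.norm_eq_abs, Real.norm_eq_abs, mul_assoc, ← sq, sq_abs] at h
    refine le_trans (le_of_eq ?_) h
    congr 1
    ring
  · refine (hf'L z y).trans (mul_le_mul_of_nonneg_left ?_ steinConst_pos.le)
    rw [abs_sub_comm z y, abs_sub_comm x y]
    have := Set.abs_sub_left_of_mem_uIcc hz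
    rwa [abs_sub_comm, abs_sub_comm x y] at this

end

/-! ### Integration by parts along one coefficient and the bias -/

noncomputable section

open Matrix

section PiGaussian

variable {ι : Type*} [Fintype ι]

/-- The law of a family of independent standard Gaussian random variables. -/
def piGaussian (ι : Type*) [Fintype ι] : Measure (ι → ℝ) := Measure.pi fun _ => gaussianReal 0 1

instance : IsProbabilityMeasure (piGaussian ι) := by unfold piGaussian; infer_instance

theorem measurePreserving_eval_piGaussian (k : ι) :
    MeasurePreserving (fun x : ι → ℝ => x k) (piGaussian ι) (gaussianReal 0 1) :=
  measurePreserving_eval _ k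

theorem integrable_pow_gaussianReal (p : ℕ) : Integrable (fun x : ℝ => x ^ p) (gaussianReal 0 1) := by
  have h := IsGaussian.memLp_id (gaussianReal 0 1) p (by simp)
  have := h.integrable_norm_pow'
  refine this.mono (by fun_prop) (ae_of_all _ fun x => ?_)
  simp

theorem integrable_eval_pow (k : ι) (p : ℕ) :
    Integrable (fun x : ι → ℝ => x k ^ p) (piGaussian ι) :=
  (measurePreserving_eval_piGaussian k).integrable_comp_of_integrable
    (integrable_pow_gaussianReal p)

theorem integral_eval_comp (k : ι) {φ : ℝ → ℝ} (hφ : Measurable φ) :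
    ∫ x, φ (x k) ∂(piGaussian ι) = ∫ x, φ x ∂(gaussianReal 0 1) := by
  rw [← (measurePreserving_eval_piGaussian k).map_eq,
    integral_map (measurePreserving_eval_piGaussian k).aemeasurable]
  exact hφ.aestronglyMeasurable

theorem integral_sq_gaussianReal : ∫ x, x ^ 2 ∂(gaussianReal 0 1) = 1 := by
  have h := variance_fun_id_gaussianReal (μ := 0) (v := 1)
  rw [variance_eq_integral (by fun_prop)] at h
  simpa using h

theorem integral_eval_sq (k : ι) : ∫ x, x k ^ 2 ∂(piGaussian ι) = 1 := by
  rw [integral_eval_comp k (φ := fun x => x ^ 2) (by fun_prop), integral_sq_gaussianReal]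

variable [DecidableEq ι]

/-- Setting the coordinate `k` to zero keeps exactly the information in the other coordinates. -/
theorem indepFun_eval_update (k : ι) :
    IndepFun (fun x : ι → ℝ => x k) (fun x => Function.update x k 0) (piGaussian ι) := by
  have h : iIndepFun (fun (i : ι) (x : ι → ℝ) => x i) (piGaussian ι) :=
    iIndepFun_pi (X := fun _ (x : ℝ) => x) fun _ => aemeasurable_id
  have h2 := h.indepFun_finset {k} (Finset.univ.erase k) (by simp) fun i => measurable_pi_apply i
  let φ : (({k} : Finset ι) → ℝ) → ℝ := fun a => a ⟨k, Finset.mem_singleton_self k⟩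
  let ψ : (↥(Finset.univ.erase k) → ℝ) → ι → ℝ :=
    fun a i => if hi : i ∈ Finset.univ.erase k then a ⟨i, hi⟩ else 0
  have hφ : Measurable φ := measurable_pi_apply _
  have hψ : Measurable ψ := measurable_pi_lambda _ fun i => by
    by_cases hi : i ∈ Finset.univ.erase k
    · simp only [ψ, hi, dite_true]; exact measurable_pi_apply _
    · simp only [ψ, hi, dite_false]; exact measurable_const
  have h3 := h2.comp hφ hψ
  convert! h3 using 1
  funext x i
  by_cases hi : i = k
  · subst hi; simp [ψ]
  · simp [ψ, hi]

theorem integral_eval_mul_update (k : ι) {φ : ℝ → ℝ} (hφ : Measurable φ) {g : (ι → ℝ) → ℝ}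
    (hg : Measurable g) :
    ∫ x, φ (x k) * g (Function.update x k 0) ∂(piGaussian ι)
      = (∫ x, φ x ∂(gaussianReal 0 1)) * ∫ x, g (Function.update x k 0) ∂(piGaussian ι) := by
  have h := (indepFun_eval_update k).comp hφ hg
  have h2 := h.integral_fun_mul_eq_mul_integral
    (hφ.comp (measurable_pi_apply k)).aestronglyMeasurable
    (hg.comp (by fun_prop)).aestronglyMeasurable
  rw [← integral_eval_comp k hφ]
  exact h2

end PiGaussian

section Continuity

variable {ι α : Type*} [Fintype ι] [DecidableEq ι] [TopologicalSpace α]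

/-- The functional calculus is Lipschitz in the Hilbert-Schmidt norm, which controls every entry. It
supplies the measurability used in all integrals over the coefficients. -/
theorem continuous_cfc_of_lipschitz {A : α → Matrix ι ι ℂ} (hc : Continuous A)
    (hA : ∀ x, (A x).IsHermitian) {f : ℝ → ℝ} {K : ℝ} (hf : ∀ x y, |f x - f y| ≤ K * |x - y|) :
    Continuous fun x => (hA x).cfc f := by
  refine continuous_pi fun i => continuous_pi fun j => ?_
  rw [continuous_iff_continuousAt]
  intro x₀
  rw [ContinuousAt, tendsto_iff_norm_sub_tendsto_zero]
  have h1 : Tendsto (fun x => √(Fintype.card ι * (K ^ 2 * hsSq (A x - A x₀)))) (𝓝 x₀) (𝓝 0) := by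
    have h2 : Continuous fun x => √(Fintype.card ι * (K ^ 2 * hsSq (A x - A x₀))) := by
      have := (continuous_hsSq (ι := ι)).comp (hc.sub continuous_const : Continuous fun x =>
        A x - A x₀)
      simp only [Function.comp_def] at this
      fun_prop
    have h3 := h2.tendsto x₀
    simpa [hsSq] using h3
  refine squeeze_zero (fun x => norm_nonneg _) (fun x => ?_) h1
  refine Real.le_sqrt_of_sq_le ?_
  have h4 := norm_entry_sq_le_hsSq ((hA x).cfc f - (hA x₀).cfc f) i j
  rw [Matrix.sub_apply] at h4
  exact h4.trans (mul_le_mul_of_nonneg_left (hsSq_cfc_sub_le (hA x) (hA x₀) hf) (by positivity))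

theorem abs_ntr_cfc_le {A : Matrix ι ι ℂ} (hA : A.IsHermitian) {f : ℝ → ℝ} {K : ℝ} (hK0 : 0 ≤ K)
    (hK : ∀ x, |f x| ≤ K) : |ntr (hA.cfc f)| ≤ K := by
  rw [ntr_cfc, abs_mul, abs_of_nonneg (by positivity)]
  have h1 : |∑ i, f (hA.eigenvalues i)| ≤ Fintype.card ι * K := by
    refine (Finset.abs_sum_le_sum_abs _ _).trans ((Finset.sum_le_sum fun i _ => hK _).trans ?_)
    simp
  calc _ ≤ (Fintype.card ι : ℝ)⁻¹ * (Fintype.card ι * K) := by gcongr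
    _ = ((Fintype.card ι : ℝ)⁻¹ * Fintype.card ι) * K := by ring
    _ ≤ 1 * K := by gcongr; exact inv_mul_le_one
    _ = K := one_mul K

theorem hsSq_cfc_le {A : Matrix ι ι ℂ} (hA : A.IsHermitian) {f : ℝ → ℝ} {K : ℝ}
    (hK : ∀ x, |f x| ≤ K) : hsSq (hA.cfc f) ≤ K ^ 2 := by
  have h := hsSq_eq_sum_overlap hA hA (hA.cfc f) (fun i _ => f (hA.eigenvalues i)) fun i j => by
    have := mixedBasis_cfc_mul_cfc hA hA f (fun _ => 1) i j
    rwa [hermitian_cfc_one, Matrix.mul_one, mul_one] at this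
  rw [h]
  have h1 := sum_overlap_le_one hA hA
  calc _ ≤ ∑ i, ∑ j, overlap hA hA i j * K ^ 2 := by
        refine Finset.sum_le_sum fun i _ => Finset.sum_le_sum fun j _ => ?_
        refine mul_le_mul_of_nonneg_left ?_ (overlap_nonneg hA hA i j)
        rw [← sq_abs]
        have := hK (hA.eigenvalues i)
        gcongr
    _ = (∑ i, ∑ j, overlap hA hA i j) * K ^ 2 := by simp_rw [Finset.sum_mul]
    _ ≤ 1 * K ^ 2 := by gcongr
    _ = K ^ 2 := one_mul _

end Continuity

section Bias

variable {n : ℕ}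

/-- The fourth moment of the standard Gaussian distribution. -/
def gaussFourthMoment : ℝ := ∫ x, x ^ 4 ∂(gaussianReal 0 1)

theorem gaussFourthMoment_nonneg : 0 ≤ gaussFourthMoment := integral_nonneg fun x => by positivity

/-- The pointwise error in the integration by parts along one coefficient. -/
def biasError (K : ℝ) (k : Fin 3 × Fin 3 × Fin n) (x : Fin 3 × Fin 3 × Fin n → ℝ) : ℝ :=
  K / 2 * (x k ^ 2 + (108 * ∑ l ∈ bondNeighbours k, (x k ^ 4 + x l ^ 4)) + 2 * x k ^ 4) +
    K / 2 * (1 + x k ^ 2)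

theorem integrable_biasError (K : ℝ) (k : Fin 3 × Fin 3 × Fin n) :
    Integrable (biasError K k) (piGaussian _) := by
  unfold biasError
  have h2 := integrable_eval_pow k 2
  have h4 := fun l : Fin 3 × Fin 3 × Fin n => integrable_eval_pow l 4
  refine Integrable.add (Integrable.const_mul ((h2.add (Integrable.const_mul
    (integrable_finsetSum _ fun l _ => (h4 k).fun_add (h4 l)) _)).add ((h4 k).const_mul _)) _) ?_
  exact ((integrable_const _).add h2).const_mul _

/-- The constants are `3 = 1 + 1 + 1`, from the constant and the two second moments, and `5834 = 108
* 27 * 2 + 2`, from the fourth moments. -/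
theorem integral_biasError_le {K : ℝ} (hK : 0 ≤ K) (k : Fin 3 × Fin 3 × Fin n) :
    ∫ x, biasError K k x ∂(piGaussian _) ≤ K / 2 * (3 + 5834 * gaussFourthMoment) := by
  have h2 := integrable_eval_pow k 2
  have h4 := fun l : Fin 3 × Fin 3 × Fin n => integrable_eval_pow l 4
  have hs : Integrable (fun x : Fin 3 × Fin 3 × Fin n → ℝ =>
      ∑ l ∈ bondNeighbours k, (x k ^ 4 + x l ^ 4)) (piGaussian _) :=
    integrable_finsetSum _ fun l _ => (h4 k).fun_add (h4 l)
  have e4 : ∀ l : Fin 3 × Fin 3 × Fin n, ∫ x, x l ^ 4 ∂(piGaussian _) = gaussFourthMoment :=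
    fun l => integral_eval_comp l (φ := fun x => x ^ 4) (by fun_prop)
  have es : ∫ x, ∑ l ∈ bondNeighbours k, (x k ^ 4 + x l ^ 4) ∂(piGaussian _)
      = (bondNeighbours k).card * (2 * gaussFourthMoment) := by
    rw [integral_finsetSum _ fun l _ => (h4 k).fun_add (h4 l)]
    simp_rw [integral_add (h4 k) (h4 _), e4]
    rw [Finset.sum_const, nsmul_eq_mul]
    ring
  have i1 := hs.const_mul 108
  have i2 := (h4 k).const_mul 2
  have e : ∫ x, biasError K k x ∂(piGaussian _) = K / 2 * (1 + 108 * ((bondNeighbours k).card *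
      (2 * gaussFourthMoment)) + 2 * gaussFourthMoment) + K / 2 * (1 + 1) := by
    unfold biasError
    rw [integral_add (((h2.fun_add i1).fun_add i2).const_mul _) (((integrable_const _).fun_add h2).const_mul _),
      integral_const_mul, integral_const_mul, integral_add (h2.fun_add i1) i2, integral_add h2 i1,
      integral_add (integrable_const _) h2, integral_const_mul, integral_const_mul, es, e4,
      integral_eval_sq]
    simp
  rw [e]
  have hc : ((bondNeighbours k).card : ℝ) ≤ 27 := by exact_mod_cast card_bondNeighbours_le k
  have hQ := gaussFourthMoment_nonneg
  have h5 : ((bondNeighbours k).card : ℝ) * (2 * gaussFourthMoment) ≤ 27 * (2 * gaussFourthMoment) := by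
    gcongr
  rw [← mul_add]
  refine mul_le_mul_of_nonneg_left ?_ (by positivity)
  linarith

variable (hn : 2 ≤ n)

/-- A pathwise form of Gaussian integration by parts. The bracketed terms involve the Hamiltonian
without the coefficient `x k`, multiplied by `x k` or by `x k ^ 2 - 1`, so independence makes their
means vanish. The two halves of `biasError` come from the Taylor remainder and from exchanging `f'`
at the reduced Hamiltonian for `f'` at the full one. -/
theorem abs_bond_ntr_expansion_le {f f' : ℝ → ℝ} {K : ℝ} (hK : 0 ≤ K)
    (hf'L : ∀ x y, |f' x - f' y| ≤ K * |x - y|)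
    (hT : ∀ x y, |f x - f y - f' y * (x - y)| ≤ K * (x - y) ^ 2)
    (k : Fin 3 × Fin 3 × Fin n) (x : Fin 3 × Fin 3 × Fin n → ℝ) :
    |x k / √(9 * n) * ntr (bond k * (chainHam_isHermitian hn x).cfc f)
        - (9 * n : ℝ)⁻¹ * ntr ((chainHam_isHermitian hn x).cfc f')
        - (x k / √(9 * n) * ntr (bond k * (chainHam_isHermitian hn (Function.update x k 0)).cfc f)
          + (9 * n : ℝ)⁻¹ * ((x k ^ 2 - 1) *
            ntr ((chainHam_isHermitian hn (Function.update x k 0)).cfc f')))|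
      ≤ (9 * n : ℝ)⁻¹ * (√(9 * n))⁻¹ * biasError K k x := by
  set y := Function.update x k 0 with hy
  set hA := chainHam_isHermitian hn x
  set hB := chainHam_isHermitian hn y
  have hn0 : (0 : ℝ) < 9 * n := by
    have : (2 : ℝ) ≤ n := by exact_mod_cast hn
    linarith
  set m := √(9 * n : ℝ) with hm
  have hm0 : 0 < m := Real.sqrt_pos.2 hn0
  have hm2 : (9 * n : ℝ) = m ^ 2 := (Real.sq_sqrt hn0.le).symm
  set d := x k / m with hd
  have hD : chainHam x - chainHam y = (d : ℂ) • bond k := chainHam_sub_update x k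
  have hDD : (chainHam x - chainHam y) * (chainHam x - chainHam y)
      = ((d ^ 2 : ℝ) : ℂ) • (1 : Matrix (Fin n → Fin 2) (Fin n → Fin 2) ℂ) := by
    rw [hD, Matrix.smul_mul, Matrix.mul_smul, bond_mul_self hn, smul_smul]
    push_cast
    rw [sq]
  have hDs : hsSq (chainHam x - chainHam y) = d ^ 2 := by
    rw [hD, hsSq_smul, hsSq_unitary (bond_unitary hn k), Complex.norm_real, Real.norm_eq_abs,
      sq_abs, mul_one]
  -- The choice `c = m⁻¹` balances `c * d ^ 2` with `c⁻¹` times the second difference: both are of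
  -- order `m ^ (-3)`.
  have h1 := abs_ntr_sub_mul_cfc_sub_le hA hB (c := m⁻¹) (inv_pos.2 hm0) hT hDD
  have h2 := hsSq_second_difference_chainHam_le hn x k
  have h3 := abs_ntr_cfc_sub_le hA hB hK hf'L
  rw [hDs, Real.sqrt_sq_eq_abs] at h3
  rw [hDs] at h1
  rw [hm2] at h2 ⊢
  have e1 : ntr ((chainHam x - chainHam y) * (hA.cfc f - hB.cfc f))
      = d * ntr (bond k * hA.cfc f) - d * ntr (bond k * hB.cfc f) := by
    rw [hD, Matrix.smul_mul, Matrix.mul_sub, ntr_smul, ntr_sub, mul_sub]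
  -- AM-GM turns `x k ^ 2 * x l ^ 2` into half the sum of fourth powers, so 216 becomes 108.
  have hbd : hsSq (chainHam x * (chainHam x - chainHam y) - (chainHam x - chainHam y) * chainHam y)
      ≤ ((m ^ 2)⁻¹) ^ 2 * ((108 * ∑ l ∈ bondNeighbours k, (x k ^ 4 + x l ^ 4)) + 2 * x k ^ 4) := by
    refine h2.trans (mul_le_mul_of_nonneg_left (add_le_add_left ?_ _) (by positivity))
    rw [Finset.mul_sum, Finset.mul_sum, Finset.mul_sum]
    refine Finset.sum_le_sum fun l _ => ?_
    nlinarith [sq_nonneg (x k ^ 2 - x l ^ 2)]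
  set S := (108 * ∑ l ∈ bondNeighbours k, (x k ^ 4 + x l ^ 4)) + 2 * x k ^ 4 with hS
  set F := ntr (hA.cfc f')
  set G := ntr (hB.cfc f')
  have e2 : d * ntr (bond k * hA.cfc f) - (m ^ 2)⁻¹ * F -
      (d * ntr (bond k * hB.cfc f) + (m ^ 2)⁻¹ * ((x k ^ 2 - 1) * G))
      = (ntr ((chainHam x - chainHam y) * (hA.cfc f - hB.cfc f)) - d ^ 2 * G)
        - (m ^ 2)⁻¹ * (F - G) := by
    rw [e1, hd]
    field_simp
    ring
  rw [e2]
  refine (abs_sub _ _).trans ?_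
  have h4 : |(m ^ 2)⁻¹ * (F - G)| ≤ (m ^ 2)⁻¹ * m⁻¹ * (K / 2 * (1 + x k ^ 2)) := by
    rw [abs_mul, abs_of_pos (by positivity : 0 < (m ^ 2)⁻¹), mul_assoc]
    refine mul_le_mul_of_nonneg_left (h3.trans ?_) (by positivity)
    have e3 : |d| = m⁻¹ * |x k| := by
      rw [hd, abs_div, abs_of_pos hm0]; ring
    have h5 : |x k| ≤ (1 + x k ^ 2) / 2 := by
      nlinarith [sq_abs (x k), sq_nonneg (|x k| - 1)]
    rw [e3]
    calc K * (m⁻¹ * |x k|) ≤ K * (m⁻¹ * ((1 + x k ^ 2) / 2)) := by gcongr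
      _ = _ := by ring
  have h6 : K / 2 * (m⁻¹ * d ^ 2 + m⁻¹⁻¹ * hsSq (chainHam x * (chainHam x - chainHam y) -
      (chainHam x - chainHam y) * chainHam y)) ≤ (m ^ 2)⁻¹ * m⁻¹ * (K / 2 * (x k ^ 2 + S)) := by
    calc _ ≤ K / 2 * (m⁻¹ * d ^ 2 + m⁻¹⁻¹ * (((m ^ 2)⁻¹) ^ 2 * S)) := by gcongr
      _ = _ := by rw [hd]; field_simp
  have e5 : biasError K k x = K / 2 * (x k ^ 2 + S) + K / 2 * (1 + x k ^ 2) := by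
    rw [biasError, hS]; ring
  rw [e5, mul_add]
  exact add_le_add (h1.trans h6) h4

theorem continuous_ntr_cfc_chainHam {f : ℝ → ℝ} {K : ℝ} (hf : ∀ x y, |f x - f y| ≤ K * |x - y|) :
    Continuous fun x => ntr ((chainHam_isHermitian hn x).cfc f) :=
  continuous_ntr.comp (continuous_cfc_of_lipschitz continuous_chainHam _ hf)

theorem continuous_ntr_bond_mul_cfc_chainHam {f : ℝ → ℝ} {K : ℝ}
    (hf : ∀ x y, |f x - f y| ≤ K * |x - y|) (k : Fin 3 × Fin 3 × Fin n) :
    Continuous fun x => ntr (bond k * (chainHam_isHermitian hn x).cfc f) :=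
  continuous_ntr.comp (continuous_const.mul (continuous_cfc_of_lipschitz continuous_chainHam _ hf))

theorem abs_ntr_bond_mul_cfc_le {f : ℝ → ℝ} {K : ℝ} (hK : ∀ x, |f x| ≤ K)
    (k : Fin 3 × Fin 3 × Fin n) (x : Fin 3 × Fin 3 × Fin n → ℝ) :
    |ntr (bond k * (chainHam_isHermitian hn x).cfc f)| ≤ (1 + K ^ 2) / 2 := by
  refine (abs_ntr_mul_le _ _).trans ?_
  rw [hsSq_unitary (bond_unitary hn k)]
  have := hsSq_cfc_le (chainHam_isHermitian hn x) hK
  linarith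

theorem integrable_eval_mul_bounded (k : Fin 3 × Fin 3 × Fin n) (p : ℕ)
    {g : (Fin 3 × Fin 3 × Fin n → ℝ) → ℝ} (hg : Continuous g) {b : ℝ} (hb : ∀ x, |g x| ≤ b) :
    Integrable (fun x => x k ^ p * g x) (piGaussian _) :=
  (integrable_eval_pow k p).mul_bdd hg.aestronglyMeasurable (ae_of_all _ hb)

theorem abs_integral_bond_expansion_le {f f' : ℝ → ℝ} {K : ℝ} (hK : 0 ≤ K)
    (hfb : ∀ x, |f x| ≤ K) (hf'b : ∀ x, |f' x| ≤ K) (hfL : ∀ x y, |f x - f y| ≤ K * |x - y|)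
    (hf'L : ∀ x y, |f' x - f' y| ≤ K * |x - y|)
    (hT : ∀ x y, |f x - f y - f' y * (x - y)| ≤ K * (x - y) ^ 2)
    (k : Fin 3 × Fin 3 × Fin n) :
    |(∫ x, x k / √(9 * n) * ntr (bond k * (chainHam_isHermitian hn x).cfc f) ∂(piGaussian _))
        - (9 * n : ℝ)⁻¹ * ∫ x, ntr ((chainHam_isHermitian hn x).cfc f') ∂(piGaussian _)|
      ≤ (9 * n : ℝ)⁻¹ * (√(9 * n))⁻¹ * (K / 2 * (3 + 5834 * gaussFourthMoment)) := by
  have hu : Continuous fun x : Fin 3 × Fin 3 × Fin n → ℝ => Function.update x k 0 := by fun_prop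
  have c1 := continuous_ntr_bond_mul_cfc_chainHam hn hfL k
  have c2 := continuous_ntr_cfc_chainHam hn hf'L
  have c3 := c1.comp hu
  have c4 := c2.comp hu
  have b1 := abs_ntr_bond_mul_cfc_le hn hfb k
  have b2 := fun x => abs_ntr_cfc_le (chainHam_isHermitian hn x) hK hf'b
  have j1 := integrable_eval_mul_bounded k 1 c1 b1
  have j2 := integrable_eval_mul_bounded k 0 c2 b2
  have j3 := integrable_eval_mul_bounded k 1 c3 (fun x => b1 _)
  have j4 := (integrable_eval_mul_bounded k 2 c4 (fun x => b2 _)).sub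
    (integrable_eval_mul_bounded k 0 c4 (fun x => b2 _))
  simp only [pow_one, pow_zero, one_mul] at j1 j2 j3 j4
  have i1 : Integrable (fun x => x k / √(9 * n) *
      ntr (bond k * (chainHam_isHermitian hn x).cfc f)) (piGaussian _) := by
    refine (j1.const_mul (√(9 * n))⁻¹).congr (ae_of_all _ fun x => ?_)
    simp only
    ring
  have i2 := j2.const_mul (9 * n : ℝ)⁻¹
  have i3 : Integrable (fun x => x k / √(9 * n) *
      ntr (bond k * (chainHam_isHermitian hn (Function.update x k 0)).cfc f)) (piGaussian _) := by
    refine (j3.const_mul (√(9 * n))⁻¹).congr (ae_of_all _ fun x => ?_)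
    simp only [Function.comp]
    ring
  have i4 : Integrable (fun x => (9 * n : ℝ)⁻¹ * ((x k ^ 2 - 1) *
      ntr ((chainHam_isHermitian hn (Function.update x k 0)).cfc f'))) (piGaussian _) := by
    refine (j4.const_mul (9 * n : ℝ)⁻¹).congr (ae_of_all _ fun x => ?_)
    simp only [Function.comp, Pi.sub_apply]
    ring
  have z3 : ∫ x, x k / √(9 * n) *
      ntr (bond k * (chainHam_isHermitian hn (Function.update x k 0)).cfc f) ∂(piGaussian _) = 0 := by
    rw [integral_eval_mul_update k (φ := fun t => t / √(9 * n)) (by fun_prop) c1.measurable,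
      integral_div, integral_id_gaussianReal]
    simp
  have z4 : ∫ x, (9 * n : ℝ)⁻¹ * ((x k ^ 2 - 1) *
      ntr ((chainHam_isHermitian hn (Function.update x k 0)).cfc f')) ∂(piGaussian _) = 0 := by
    rw [integral_const_mul, integral_eval_mul_update k (φ := fun t => t ^ 2 - 1) (by fun_prop)
      c2.measurable, integral_sub (integrable_pow_gaussianReal 2) (integrable_const _),
      integral_sq_gaussianReal]
    simp
  have hpt := abs_bond_ntr_expansion_le hn hK hf'L hT k
  have key : (∫ x, x k / √(9 * n) * ntr (bond k * (chainHam_isHermitian hn x).cfc f) ∂(piGaussian _))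
        - (9 * n : ℝ)⁻¹ * ∫ x, ntr ((chainHam_isHermitian hn x).cfc f') ∂(piGaussian _)
      = ∫ x, (x k / √(9 * n) * ntr (bond k * (chainHam_isHermitian hn x).cfc f)
        - (9 * n : ℝ)⁻¹ * ntr ((chainHam_isHermitian hn x).cfc f')
        - (x k / √(9 * n) * ntr (bond k * (chainHam_isHermitian hn (Function.update x k 0)).cfc f)
          + (9 * n : ℝ)⁻¹ * ((x k ^ 2 - 1) *
            ntr ((chainHam_isHermitian hn (Function.update x k 0)).cfc f')))) ∂(piGaussian _) := by
    have e := integral_sub (i1.sub i2) (i3.add i4)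
    simp only [Pi.sub_apply, Pi.add_apply] at e
    rw [e, integral_sub i1 i2, integral_add i3 i4, z3, z4,
      integral_const_mul]
    ring
  rw [key]
  refine (abs_integral_le_integral_abs).trans ?_
  refine (integral_mono_of_nonneg (ae_of_all _ fun x => abs_nonneg _)
    ((integrable_biasError K k).const_mul _) (ae_of_all _ hpt)).trans ?_
  rw [integral_const_mul]
  exact mul_le_mul_of_nonneg_left (integral_biasError_le hK k) (by positivity)

/-- The constant in the bound on the bias of linear statistics. -/
def biasConst : ℝ := steinConst / 2 * (3 + 5834 * gaussFourthMoment)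

/-- The mean spectral measure is close to the Gaussian distribution, when tested against a bounded
Lipschitz function. -/
theorem abs_integral_ntr_cfc_sub_le {s : ℝ → ℝ} (hb : ∀ x, |s x| ≤ 1)
    (hL : ∀ x y, |s x - s y| ≤ |x - y|) :
    |(∫ x, ntr ((chainHam_isHermitian hn x).cfc s) ∂(piGaussian _)) - ∫ y, s y ∂(gaussianReal 0 1)|
      ≤ biasConst * (√(9 * n))⁻¹ := by
  obtain ⟨f, f', hf', hfb, hf'b, hf'L, hfL, hT⟩ := exists_stein_solution hb hL
  set a := ∫ y, s y ∂(gaussianReal 0 1)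
  have hK := steinConst_pos.le
  have hn0 : (0 : ℝ) < 9 * n := by
    have : (2 : ℝ) ≤ n := by exact_mod_cast hn
    linarith
  set A := fun x : Fin 3 × Fin 3 × Fin n → ℝ => chainHam_isHermitian hn x
  have i1 : ∀ k, Integrable (fun x => x k / √(9 * n) * ntr (bond k * (A x).cfc f))
      (piGaussian _) := fun k => by
    have := integrable_eval_mul_bounded k 1 (continuous_ntr_bond_mul_cfc_chainHam hn hfL k)
      (abs_ntr_bond_mul_cfc_le hn hfb k)
    refine (this.const_mul (√(9 * n))⁻¹).congr (ae_of_all _ fun x => ?_)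
    simp only [pow_one]
    ring
  have i2 : Integrable (fun x => ntr ((A x).cfc f')) (piGaussian _) :=
    Integrable.of_bound (continuous_ntr_cfc_chainHam hn hf'L).aestronglyMeasurable steinConst
      (ae_of_all _ fun x => abs_ntr_cfc_le (A x) hK hf'b)
  have hsum : ∀ x, ∑ k, x k / √(9 * n) * ntr (bond k * (A x).cfc f)
      = ntr (chainHam x * (A x).cfc f) := fun x => by
    have e := congrArg (fun M => ntr (M * (A x).cfc f)) (chainHam_eq x)
    rw [e, Matrix.smul_mul, ntr_smul, Finset.sum_mul, ntr_sum, Finset.mul_sum]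
    refine Finset.sum_congr rfl fun k _ => ?_
    rw [Matrix.smul_mul, ntr_smul]
    ring
  -- Stein's equation in the functional calculus, with the factor `x` of `x * f x` replaced by the
  -- Hamiltonian and expanded in bonds.
  have hstein : ∀ x, ntr ((A x).cfc s) - a = ntr ((A x).cfc f')
      - ∑ k, x k / √(9 * n) * ntr (bond k * (A x).cfc f) := fun x => by
    have h1 : ntr ((A x).cfc f') = ntr ((A x).cfc fun t => t * f t) + (ntr ((A x).cfc s) - a) := by
      simp only [ntr_cfc, hf', Finset.sum_add_distrib, Finset.sum_sub_distrib, mul_add, mul_sub]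
      simp
    rw [hsum, hermitian_mul_cfc, h1]
    ring
  -- The mean of `f'` is shared equally among the `9n` bonds, so that each summand is one
  -- integration by parts.
  have hmain : (∫ x, ntr ((A x).cfc s) ∂(piGaussian _)) - a
      = -∑ k : Fin 3 × Fin 3 × Fin n, ((∫ x, x k / √(9 * n) * ntr (bond k * (A x).cfc f)
        ∂(piGaussian _)) - (9 * n : ℝ)⁻¹ * ∫ x, ntr ((A x).cfc f') ∂(piGaussian _)) := by
    have i0 : Integrable (fun x => ntr ((A x).cfc s)) (piGaussian _) :=
      Integrable.of_bound (continuous_ntr_cfc_chainHam hn (K := 1) (by simpa using hL)).aestronglyMeasurable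
        1 (ae_of_all _ fun x => abs_ntr_cfc_le (A x) zero_le_one hb)
    have h1 : (∫ x, ntr ((A x).cfc s) ∂(piGaussian _)) - a
        = ∫ x, (ntr ((A x).cfc s) - a) ∂(piGaussian _) := by
      rw [integral_sub i0 (integrable_const _)]
      simp
    rw [h1]
    simp_rw [hstein]
    rw [integral_sub i2 (integrable_finsetSum _ fun k _ => i1 k), integral_finsetSum _ fun k _ => i1 k,
      Finset.sum_sub_distrib, Finset.sum_const, Finset.card_univ, Fintype.card_prod,
      Fintype.card_prod, Fintype.card_fin, Fintype.card_fin, nsmul_eq_mul]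
    have : ((3 * (3 * n) : ℕ) : ℝ) = 9 * n := by push_cast; ring
    rw [this, mul_inv_cancel_left₀ hn0.ne']
    ring
  rw [hmain, abs_neg]
  refine (Finset.abs_sum_le_sum_abs _ _).trans ((Finset.sum_le_sum fun k _ =>
    abs_integral_bond_expansion_le hn hK hfb hf'b hfL hf'L hT k).trans (le_of_eq ?_))
  rw [Finset.sum_const, Finset.card_univ, Fintype.card_prod, Fintype.card_prod, Fintype.card_fin,
    Fintype.card_fin, nsmul_eq_mul, biasConst]
  push_cast
  field_simp
  ring

end Bias

end

/-! ### The bounded-Lipschitz distance and reduction to finitely many test functions -/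

noncomputable section

theorem abs_le_one_of_blNorm_le_one {f : ℝ → ℝ} (hf : blNorm f ≤ 1) (x : ℝ) : |f x| ≤ 1 := by
  have h1 : ‖f x‖ₑ ≤ 1 := (le_iSup (fun x => ‖f x‖ₑ) x).trans (le_self_add.trans hf)
  rwa [Real.enorm_eq_ofReal_abs, ENNReal.ofReal_le_one] at h1

theorem abs_sub_le_of_blNorm_le_one {f : ℝ → ℝ} (hf : blNorm f ≤ 1) (x y : ℝ) :
    |f x - f y| ≤ |x - y| := by
  rcases eq_or_ne x y with rfl | hxy
  · simp
  have h1 : edist (f x) (f y) / edist x y ≤ 1 :=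
    (le_iSup₂ (f := fun x y => edist (f x) (f y) / edist x y) x y).trans (le_add_self.trans hf)
  have h0 : edist x y ≠ 0 := fun h => hxy (edist_eq_zero.1 h)
  rw [ENNReal.div_le_iff h0 (edist_ne_top x y), one_mul, edist_dist, edist_dist,
    ENNReal.ofReal_le_ofReal_iff dist_nonneg, Real.dist_eq, Real.dist_eq] at h1
  exact h1

theorem blNorm_zero : blNorm (fun _ => 0) ≤ 1 := by simp [blNorm]

theorem continuous_of_abs_sub_le {f : ℝ → ℝ} (hL : ∀ x y, |f x - f y| ≤ |x - y|) :
    Continuous f := by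
  refine (LipschitzWith.of_dist_le_mul (K := 1) fun x y => ?_).continuous
  simpa [Real.dist_eq] using hL x y

section

variable {μ ν : Measure ℝ}

theorem dBL_le {r : ℝ}
    (h : ∀ f : ℝ → ℝ, (∀ x, |f x| ≤ 1) → (∀ x y, |f x - f y| ≤ |x - y|) →
      |∫ x, f x ∂μ - ∫ x, f x ∂ν| ≤ r) : dBL μ ν ≤ r := by
  refine csSup_le ⟨0, fun _ => 0, blNorm_zero, by simp⟩ ?_
  rintro _ ⟨f, hf, rfl⟩
  exact h f (abs_le_one_of_blNorm_le_one hf) (abs_sub_le_of_blNorm_le_one hf)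

variable [IsProbabilityMeasure μ] [IsProbabilityMeasure ν]

theorem abs_integral_le_of_abs_le {f : ℝ → ℝ} {b : ℝ} (hb : ∀ x, |f x| ≤ b) :
    |∫ x, f x ∂μ| ≤ b := by
  have := norm_integral_le_of_norm_le_const (μ := μ) (f := f) (C := b) (ae_of_all _ hb)
  simpa using this

theorem abs_integral_sub_integral_le_two {f : ℝ → ℝ} (hb : ∀ x, |f x| ≤ 1) :
    |∫ x, f x ∂μ - ∫ x, f x ∂ν| ≤ 2 := by
  refine (abs_sub _ _).trans ?_
  have h1 := abs_integral_le_of_abs_le (μ := μ) hb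
  have h2 := abs_integral_le_of_abs_le (μ := ν) hb
  linarith

theorem dBL_le_two : dBL μ ν ≤ 2 := dBL_le fun _ hb _ => abs_integral_sub_integral_le_two hb

theorem le_dBL {f : ℝ → ℝ} (hf : blNorm f ≤ 1) : |∫ x, f x ∂μ - ∫ x, f x ∂ν| ≤ dBL μ ν := by
  refine le_csSup ⟨2, ?_⟩ ⟨f, hf, rfl⟩
  rintro _ ⟨g, hg, rfl⟩
  exact abs_integral_sub_integral_le_two (abs_le_one_of_blNorm_le_one hg)

theorem dBL_nonneg : 0 ≤ dBL μ ν := (abs_nonneg _).trans (le_dBL blNorm_zero)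

end

theorem dBL_spectralMeasure_le_add {ι : Type*} [Fintype ι] [DecidableEq ι] [Nonempty ι]
    {A B : Matrix ι ι ℂ} (hA : A.IsHermitian) (hB : B.IsHermitian) (ν : Measure ℝ)
    [IsProbabilityMeasure ν] :
    dBL (spectralMeasure hA) ν ≤ dBL (spectralMeasure hB) ν + √(hsSq (A - B)) := by
  have := isProbabilityMeasure_spectralMeasure hA
  have := isProbabilityMeasure_spectralMeasure hB
  refine csSup_le ⟨0, fun _ => 0, blNorm_zero, by simp⟩ ?_
  rintro _ ⟨f, hf, rfl⟩
  have h1 := le_dBL (μ := spectralMeasure hB) (ν := ν) hf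
  have h2 := abs_ntr_cfc_sub_le hA hB (f := f) zero_le_one
    (by simpa using abs_sub_le_of_blNorm_le_one hf)
  rw [one_mul, ← integral_spectralMeasure, ← integral_spectralMeasure] at h2
  have h3 := abs_sub_le (∫ x, f x ∂(spectralMeasure hA)) (∫ x, f x ∂(spectralMeasure hB))
    (∫ x, f x ∂ν)
  linarith

theorem abs_dBL_spectralMeasure_sub_le {ι : Type*} [Fintype ι] [DecidableEq ι] [Nonempty ι]
    {A B : Matrix ι ι ℂ} (hA : A.IsHermitian) (hB : B.IsHermitian) (ν : Measure ℝ)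
    [IsProbabilityMeasure ν] :
    |dBL (spectralMeasure hA) ν - dBL (spectralMeasure hB) ν| ≤ √(hsSq (A - B)) := by
  have h1 := dBL_spectralMeasure_le_add hA hB ν
  have h2 := dBL_spectralMeasure_le_add hB hA ν
  rw [hsSq_sub_comm] at h2
  rw [abs_le]
  constructor <;> linarith

section Interpolation

/-- The function which increases with slope one from `0` to `ε` on `[c, c + ε]` and is constant
elsewhere. -/
def ramp (c ε x : ℝ) : ℝ := max 0 (min (x - c) ε)

theorem ramp_of_le {c ε x : ℝ} (h : x ≤ c) : ramp c ε x = 0 :=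
  max_eq_left ((min_le_left _ _).trans (by linarith))

theorem ramp_of_ge {c ε x : ℝ} (hε : 0 ≤ ε) (h : c + ε ≤ x) : ramp c ε x = ε := by
  rw [ramp, min_eq_right (by linarith), max_eq_right hε]

theorem ramp_of_mem {c ε x : ℝ} (h1 : c ≤ x) (h2 : x ≤ c + ε) : ramp c ε x = x - c := by
  rw [ramp, min_eq_left (by linarith), max_eq_right (by linarith)]

theorem abs_ramp_le {c ε x : ℝ} (hε : 0 ≤ ε) : |ramp c ε x| ≤ ε := by
  rw [abs_of_nonneg (le_max_left _ _)]
  exact max_le hε (min_le_right _ _)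

theorem abs_ramp_sub_le (c ε x y : ℝ) : |ramp c ε x - ramp c ε y| ≤ |x - y| := by
  unfold ramp
  rw [max_comm, max_comm 0]
  refine (abs_max_sub_max_le_abs _ _ _).trans ?_
  have h := abs_min_sub_min_le_max (x - c) ε (y - c) ε
  simpa using h

theorem continuous_ramp (c ε : ℝ) : Continuous (ramp c ε) := by unfold ramp; fun_prop

/-- The slope of `f` over the `k`-th cell of a grid. -/
def gridSlope (f : ℝ → ℝ) (a ε : ℝ) (k : ℕ) : ℝ := (f (a + (k + 1) * ε) - f (a + k * ε)) / ε

/-- Piecewise linear interpolation of `f` on the grid `a, a + ε, …, a + K ε`. -/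
def gridInterp (f : ℝ → ℝ) (a ε : ℝ) (K : ℕ) (x : ℝ) : ℝ :=
  f a + ∑ k ∈ Finset.range K, gridSlope f a ε k * ramp (a + k * ε) ε x

variable {f : ℝ → ℝ} {a ε : ℝ}

theorem abs_gridSlope_le (hε : 0 < ε) (hL : ∀ x y, |f x - f y| ≤ |x - y|) (k : ℕ) :
    |gridSlope f a ε k| ≤ 1 := by
  rw [gridSlope, abs_div, abs_of_pos hε, div_le_one hε]
  refine (hL _ _).trans (le_of_eq ?_)
  rw [show a + (k + 1) * ε - (a + k * ε) = ε by ring, abs_of_pos hε]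

theorem gridInterp_succ (f : ℝ → ℝ) (a ε : ℝ) (K : ℕ) (x : ℝ) :
    gridInterp f a ε (K + 1) x
      = gridInterp f a ε K x + gridSlope f a ε K * ramp (a + K * ε) ε x := by
  rw [gridInterp, Finset.sum_range_succ, ← add_assoc, gridInterp]

theorem gridInterp_of_le (hε : 0 < ε) (K : ℕ) {x : ℝ} (hx : x ≤ a) :
    gridInterp f a ε K x = f a := by
  rw [gridInterp, Finset.sum_eq_zero, add_zero]
  intro k _
  rw [ramp_of_le, mul_zero]
  have : 0 ≤ k * ε := by positivity
  linarith

theorem gridInterp_of_ge (hε : 0 < ε) (K : ℕ) {x : ℝ} (hx : a + K * ε ≤ x) :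
    gridInterp f a ε K x = f (a + K * ε) := by
  induction K with
  | zero => simp [gridInterp]
  | succ K ih =>
    push_cast at hx ⊢
    rw [gridInterp_succ, ih (by linarith), ramp_of_ge hε.le (by linarith), gridSlope,
      div_mul_cancel₀ _ hε.ne']
    ring

/-- In the last cell the interpolant starts from the value of `f` at the left node, and both it and
`f` move by at most `ε` from there. -/
theorem abs_sub_gridInterp_le (hε : 0 < ε) (hL : ∀ x y, |f x - f y| ≤ |x - y|) (K : ℕ) {x : ℝ}
    (h1 : a ≤ x) (h2 : x ≤ a + K * ε) : |f x - gridInterp f a ε K x| ≤ 2 * ε := by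
  induction K with
  | zero =>
    have : x = a := by
      simp at h2
      linarith
    subst this
    simp [gridInterp, hε.le]
  | succ K ih =>
    push_cast at h2
    rw [gridInterp_succ]
    rcases le_total x (a + K * ε) with h | h
    · rw [ramp_of_le h, mul_zero, add_zero]
      exact ih h
    · rw [gridInterp_of_ge hε K h, ramp_of_mem h (by linarith)]
      have e1 := hL x (a + K * ε)
      have e2 := abs_gridSlope_le (a := a) hε hL K
      have e3 : |x - (a + K * ε)| ≤ ε := by
        rw [abs_of_nonneg (by linarith)]; linarith
      rw [← sub_sub]
      refine (abs_sub _ _).trans ?_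
      rw [abs_mul]
      have e4 := mul_le_mul e2 e3 (abs_nonneg _) zero_le_one
      linarith

/-- Outside `[-R, R]` the interpolant is still a value of `f`, so the error is at most `2 ≤ 2 * x ^
2 / R ^ 2`; this is what brings in second moments. -/
theorem abs_sub_gridInterp_le_of_symm (hε : 0 < ε) (hb : ∀ x, |f x| ≤ 1)
    (hL : ∀ x y, |f x - f y| ≤ |x - y|) (K : ℕ) {R : ℝ} (hR : 0 < R) (hK : K * ε = 2 * R) (x : ℝ) :
    |f x - gridInterp f (-R) ε K x| ≤ 2 * ε + 2 / R ^ 2 * x ^ 2 := by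
  have hpos : 0 ≤ 2 / R ^ 2 * x ^ 2 := by positivity
  have hfar : ∀ y, R ≤ |x| → |f x - f y| ≤ 2 * ε + 2 / R ^ 2 * x ^ 2 := by
    intro y hx
    have h1 : |f x - f y| ≤ 2 := by
      refine (abs_sub _ _).trans ?_
      linarith [hb x, hb y]
    have h2 : 1 ≤ x ^ 2 / R ^ 2 := by
      rw [le_div_iff₀ (by positivity), one_mul, ← sq_abs x]
      gcongr
    have h3 : 2 / R ^ 2 * x ^ 2 = 2 * (x ^ 2 / R ^ 2) := by ring
    rw [h3]
    linarith
  rcases le_total x (-R) with h1 | h1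
  · rw [gridInterp_of_le hε K h1]
    exact hfar _ (by rw [le_abs]; right; linarith)
  · rcases le_total x R with h2 | h2
    · have := abs_sub_gridInterp_le (a := -R) hε hL K h1 (by rw [hK]; linarith)
      linarith
    · rw [gridInterp_of_ge hε K (by rw [hK]; linarith)]
      exact hfar _ (by rw [le_abs]; left; exact h2)

theorem integrable_of_abs_le {μ : Measure ℝ} [IsFiniteMeasure μ] {g : ℝ → ℝ} {b : ℝ}
    (hc : Continuous g) (hb : ∀ x, |g x| ≤ b) : Integrable g μ :=
  Integrable.of_bound hc.aestronglyMeasurable b (ae_of_all _ hb)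

theorem integral_gridInterp {μ : Measure ℝ} [IsProbabilityMeasure μ] (hε : 0 < ε) (f : ℝ → ℝ) (a : ℝ)
    (K : ℕ) : Integrable (gridInterp f a ε K) μ ∧ ∫ x, gridInterp f a ε K x ∂μ
      = f a + ∑ k ∈ Finset.range K, gridSlope f a ε k * ∫ x, ramp (a + k * ε) ε x ∂μ := by
  have hi : ∀ k ∈ Finset.range K,
      Integrable (fun x => gridSlope f a ε k * ramp (a + k * ε) ε x) μ := fun k _ =>
    (integrable_of_abs_le (continuous_ramp _ _) fun x => abs_ramp_le hε.le).const_mul _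
  unfold gridInterp
  refine ⟨(integrable_const _).add (integrable_finsetSum _ hi), ?_⟩
  rw [integral_add (integrable_const _) (integrable_finsetSum _ hi), integral_finsetSum _ hi]
  simp_rw [integral_const_mul]
  simp

/-- The bounded-Lipschitz distance is controlled by finitely many test functions and by second
moments. -/
theorem dBL_le_sum_ramp {μ ν : Measure ℝ} [IsProbabilityMeasure μ] [IsProbabilityMeasure ν]
    (hμ : Integrable (fun x => x ^ 2) μ) (hν : Integrable (fun x => x ^ 2) ν) (hε : 0 < ε) (K : ℕ)
    {R : ℝ} (hR : 0 < R) (hK : K * ε = 2 * R) :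
    dBL μ ν ≤ 4 * ε + 2 / R ^ 2 * (∫ x, x ^ 2 ∂μ + ∫ x, x ^ 2 ∂ν) +
      ∑ k ∈ Finset.range K,
        |∫ x, ramp (-R + k * ε) ε x ∂μ - ∫ x, ramp (-R + k * ε) ε x ∂ν| := by
  refine dBL_le fun f hb hL => ?_
  have hc := continuous_of_abs_sub_le hL
  have hone : ∀ (ρ : Measure ℝ) [IsProbabilityMeasure ρ], Integrable (fun x => x ^ 2) ρ →
      |∫ x, f x ∂ρ - ∫ x, gridInterp f (-R) ε K x ∂ρ| ≤ 2 * ε + 2 / R ^ 2 * ∫ x, x ^ 2 ∂ρ := by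
    intro ρ _ hρ
    rw [← integral_sub (integrable_of_abs_le hc hb) (integral_gridInterp hε f _ K).1]
    refine (abs_integral_le_integral_abs).trans ?_
    refine (integral_mono_of_nonneg (ae_of_all _ fun x => abs_nonneg _)
      ((integrable_const (2 * ε)).add (hρ.const_mul (2 / R ^ 2)))
      (ae_of_all _ (abs_sub_gridInterp_le_of_symm hε hb hL K hR hK))).trans (le_of_eq ?_)
    have := integral_add (μ := ρ) (integrable_const (2 * ε)) (hρ.const_mul (2 / R ^ 2))
    simp only [Pi.add_apply]
    rw [this, integral_const_mul (2 / R ^ 2)]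
    simp
  have h1 := hone μ hμ
  have h2 := hone ν hν
  -- The slopes depend on `f` but are at most one in absolute value, so only the ramps, which are
  -- independent of `f`, remain.
  have h3 : |∫ x, gridInterp f (-R) ε K x ∂μ - ∫ x, gridInterp f (-R) ε K x ∂ν|
      ≤ ∑ k ∈ Finset.range K,
        |∫ x, ramp (-R + k * ε) ε x ∂μ - ∫ x, ramp (-R + k * ε) ε x ∂ν| := by
    rw [(integral_gridInterp hε f _ K).2, (integral_gridInterp hε f _ K).2, add_sub_add_left_eq_sub,
      ← Finset.sum_sub_distrib]
    refine (Finset.abs_sum_le_sum_abs _ _).trans (Finset.sum_le_sum fun k _ => ?_)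
    rw [← mul_sub, abs_mul]
    exact mul_le_of_le_one_left (abs_nonneg _) (abs_gridSlope_le hε hL k)
  rw [abs_le] at h1 h2 h3 ⊢
  constructor <;> linarith

end Interpolation

end

/-! ### Assembly: mean distance, tail bound and almost sure bound -/

noncomputable section

section Chain

variable {n : ℕ} (hn : 2 ≤ n)

/-- The bounded-Lipschitz distance between the spectral measure of the chain and the Gaussian
distribution, as a function of the coefficients. -/
def chainDist (x : Fin 3 × Fin 3 × Fin n → ℝ) : ℝ :=
  dBL (spectralMeasure (chainHam_isHermitian hn x)) (gaussianReal 0 1)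

theorem chainDist_nonneg (x : Fin 3 × Fin 3 × Fin n → ℝ) : 0 ≤ chainDist hn x := by
  have := isProbabilityMeasure_spectralMeasure (chainHam_isHermitian hn x)
  exact dBL_nonneg

theorem chainDist_le_two (x : Fin 3 × Fin 3 × Fin n → ℝ) : chainDist hn x ≤ 2 := by
  have := isProbabilityMeasure_spectralMeasure (chainHam_isHermitian hn x)
  exact dBL_le_two

theorem abs_chainDist_sub_le (x y : Fin 3 × Fin 3 × Fin n → ℝ) :
    |chainDist hn x - chainDist hn y| ≤ √(hsSq (chainHam x - chainHam y)) :=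
  abs_dBL_spectralMeasure_sub_le _ _ _

theorem continuous_chainDist : Continuous (chainDist hn) := by
  rw [continuous_iff_continuousAt]
  intro y
  rw [ContinuousAt, tendsto_iff_norm_sub_tendsto_zero]
  have h1 : Continuous fun x : Fin 3 × Fin 3 × Fin n → ℝ => √(hsSq (chainHam x - chainHam y)) :=
    (continuous_hsSq.comp (continuous_chainHam.sub continuous_const)).sqrt
  have h2 := h1.tendsto y
  simp only [sub_self] at h2
  have h3 : √(hsSq (0 : Matrix (Fin n → Fin 2) (Fin n → Fin 2) ℂ)) = 0 := by simp [hsSq]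
  rw [h3] at h2
  exact squeeze_zero (fun x => norm_nonneg _) (fun x => abs_chainDist_sub_le hn x y) h2

theorem integrable_chainDist : Integrable (chainDist hn) (piGaussian _) :=
  Integrable.of_bound (continuous_chainDist hn).aestronglyMeasurable 2 (ae_of_all _ fun x => by
    rw [Real.norm_eq_abs, abs_of_nonneg (chainDist_nonneg hn x)]
    exact chainDist_le_two hn x)

theorem sqrt_hsSq_chainHam_sub (hn3 : 3 ≤ n) (x y : Fin 3 × Fin 3 × Fin n → ℝ) :
    √(hsSq (chainHam x - chainHam y))
      = ((Real.toNNReal (√(9 * n))⁻¹ : ℝ≥0) : ℝ) * √(∑ k, (x k - y k) ^ 2) := by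
  rw [chainHam_sub, hsSq_chainHam hn3, Real.sqrt_mul (by positivity), Real.sqrt_inv,
    Real.coe_toNNReal _ (by positivity)]
  rfl

theorem toNNReal_inv_sqrt_pos {n : ℕ} (hn : 2 ≤ n) : 0 < Real.toNNReal (√(9 * n : ℝ))⁻¹ := by
  have : (2 : ℝ) ≤ n := by exact_mod_cast hn
  rw [Real.toNNReal_pos]
  have : 0 < (9 * n : ℝ) := by linarith
  positivity

/-- The constant in the bound on the mean deviation of a linear statistic. -/
def statConst : ℝ := 2 * Real.exp ((Real.pi / 2) ^ 2 / 2) + biasConst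

theorem statConst_nonneg : 0 ≤ statConst := by
  have h1 := steinConst_pos
  have h2 := gaussFourthMoment_nonneg
  unfold statConst biasConst
  positivity

theorem integral_spectralMeasure_lipschitz (hn3 : 3 ≤ n) {s : ℝ → ℝ}
    (hL : ∀ x y, |s x - s y| ≤ |x - y|) (x y : Fin 3 × Fin 3 × Fin n → ℝ) :
    |∫ t, s t ∂(spectralMeasure (chainHam_isHermitian hn x)) -
        ∫ t, s t ∂(spectralMeasure (chainHam_isHermitian hn y))|
      ≤ ((Real.toNNReal (√(9 * n))⁻¹ : ℝ≥0) : ℝ) * √(∑ k, (x k - y k) ^ 2) := by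
  rw [integral_spectralMeasure, integral_spectralMeasure, ← sqrt_hsSq_chainHam_sub hn3]
  have := abs_ntr_cfc_sub_le (chainHam_isHermitian hn x) (chainHam_isHermitian hn y) (f := s)
    zero_le_one (by simpa using hL)
  rwa [one_mul] at this

/-- Mean fluctuation around the expectation plus the bias of the expectation, both of order `n ^ (-1
/ 2)`. -/
theorem integral_abs_linear_statistic_le (hn3 : 3 ≤ n) {s : ℝ → ℝ} (hb : ∀ x, |s x| ≤ 1)
    (hL : ∀ x y, |s x - s y| ≤ |x - y|) :
    Integrable (fun x => |∫ t, s t ∂(spectralMeasure (chainHam_isHermitian hn x)) -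
        ∫ t, s t ∂(gaussianReal 0 1)|) (piGaussian _) ∧
    ∫ x, |∫ t, s t ∂(spectralMeasure (chainHam_isHermitian hn x)) -
        ∫ t, s t ∂(gaussianReal 0 1)| ∂(piGaussian _) ≤ statConst * (√(9 * n))⁻¹ := by
  have hlip := integral_spectralMeasure_lipschitz hn hn3 hL
  have hint := integrable_pi_gaussian_of_lipschitz hlip
  have hconc := integral_abs_sub_integral_pi_gaussian_le (toNNReal_inv_sqrt_pos hn) hlip
  have hbias := abs_integral_ntr_cfc_sub_le hn hb hL
  simp_rw [← integral_spectralMeasure] at hbias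
  rw [Real.coe_toNNReal _ (by positivity)] at hconc
  set G := fun x : Fin 3 × Fin 3 × Fin n → ℝ =>
    ∫ t, s t ∂(spectralMeasure (chainHam_isHermitian hn x)) with hG
  set b := ∫ t, s t ∂(gaussianReal 0 1)
  change Integrable G (piGaussian _) at hint
  change ∫ x, |G x - ∫ y, G y ∂(piGaussian _)| ∂(piGaussian _) ≤ _ at hconc
  have hi : Integrable (fun x => |G x - b|) (piGaussian _) := (hint.sub (integrable_const b)).abs
  refine ⟨hi, ?_⟩
  have hi2 : Integrable (fun x => |G x - ∫ y, G y ∂(piGaussian _)|) (piGaussian _) :=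
    (hint.sub (integrable_const _)).abs
  calc ∫ x, |G x - b| ∂(piGaussian _)
      ≤ ∫ x, (|G x - ∫ y, G y ∂(piGaussian _)| + |(∫ y, G y ∂(piGaussian _)) - b|) ∂(piGaussian _) :=
        integral_mono hi (hi2.add (integrable_const _)) fun x => abs_sub_le _ _ _
    _ = (∫ x, |G x - ∫ y, G y ∂(piGaussian _)| ∂(piGaussian _)) +
          |(∫ y, G y ∂(piGaussian _)) - b| := by
        rw [integral_add hi2 (integrable_const _)]
        simp
    _ ≤ _ := by
        rw [statConst, add_mul]
        exact add_le_add hconc hbias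

theorem integral_sq_spectralMeasure_chainHam (hn3 : 3 ≤ n) (x : Fin 3 × Fin 3 × Fin n → ℝ) :
    ∫ t, t ^ 2 ∂(spectralMeasure (chainHam_isHermitian hn x)) = (9 * n : ℝ)⁻¹ * ∑ k, x k ^ 2 := by
  rw [integral_spectralMeasure, hermitian_cfc_sq, ← hsSq_chainHam hn3, hsSq_eq_ntr,
    (chainHam_isHermitian hn x).eq]

theorem integral_second_moment_chainHam :
    Integrable (fun x : Fin 3 × Fin 3 × Fin n → ℝ => (9 * n : ℝ)⁻¹ * ∑ k, x k ^ 2) (piGaussian _) ∧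
    ∫ x : Fin 3 × Fin 3 × Fin n → ℝ, (9 * n : ℝ)⁻¹ * ∑ k, x k ^ 2 ∂(piGaussian _) ≤ 1 := by
  refine ⟨(integrable_finsetSum _ fun k _ => integrable_eval_pow k 2).const_mul _, ?_⟩
  rw [integral_const_mul, integral_finsetSum _ fun k _ => integrable_eval_pow k 2]
  simp_rw [integral_eval_sq]
  rw [Finset.sum_const, Finset.card_univ, Fintype.card_prod, Fintype.card_prod, Fintype.card_fin,
    Fintype.card_fin, nsmul_eq_mul, mul_one]
  have : ((3 * (3 * n) : ℕ) : ℝ) = 9 * n := by push_cast; ring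
  rw [this]
  exact inv_mul_le_one

/-- The mean second moment of the spectral measure is at most one and that of the Gaussian is one,
whence `4 / R ^ 2`. -/
theorem integral_chainDist_le_of_grid (hn3 : 3 ≤ n) {ε R : ℝ} (hε : 0 < ε) (hε1 : ε ≤ 1)
    (hR : 0 < R) {K : ℕ} (hK : K * ε = 2 * R) :
    ∫ x, chainDist hn x ∂(piGaussian _)
      ≤ 4 * ε + 4 / R ^ 2 + K * (statConst * (√(9 * n))⁻¹) := by
  set D : ℕ → (Fin 3 × Fin 3 × Fin n → ℝ) → ℝ := fun k x =>
    |∫ t, ramp (-R + k * ε) ε t ∂(spectralMeasure (chainHam_isHermitian hn x)) -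
      ∫ t, ramp (-R + k * ε) ε t ∂(gaussianReal 0 1)| with hD
  have hDk : ∀ k, Integrable (D k) (piGaussian _) ∧
      ∫ x, D k x ∂(piGaussian _) ≤ statConst * (√(9 * n))⁻¹ := fun k =>
    integral_abs_linear_statistic_le hn hn3 (fun x => (abs_ramp_le hε.le).trans hε1)
      (abs_ramp_sub_le _ _)
  obtain ⟨hM, hM1⟩ := integral_second_moment_chainHam (n := n)
  have hpt : ∀ x, chainDist hn x ≤ (4 * ε + 2 / R ^ 2) +
      2 / R ^ 2 * ((9 * n : ℝ)⁻¹ * ∑ k, x k ^ 2) + ∑ k ∈ Finset.range K, D k x := fun x => by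
    have := isProbabilityMeasure_spectralMeasure (chainHam_isHermitian hn x)
    have h := dBL_le_sum_ramp (integrable_spectralMeasure (chainHam_isHermitian hn x) _)
      (integrable_pow_gaussianReal 2) hε K hR hK
    rw [integral_sq_spectralMeasure_chainHam hn hn3, integral_sq_gaussianReal] at h
    refine h.trans (le_of_eq ?_)
    simp only [hD]
    ring
  have i1 := hM.const_mul (2 / R ^ 2)
  have i2 : Integrable (fun x => ∑ k ∈ Finset.range K, D k x) (piGaussian _) :=
    integrable_finsetSum _ fun k _ => (hDk k).1
  have i0 : Integrable (fun _ : Fin 3 × Fin 3 × Fin n → ℝ => 4 * ε + 2 / R ^ 2) (piGaussian _) :=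
    integrable_const _
  refine (integral_mono (integrable_chainDist hn) ((i0.add i1).add i2) hpt).trans ?_
  have e1 := integral_add (i0.add i1) i2
  have e2 := integral_add i0 i1
  simp only [Pi.add_apply] at e1 e2 ⊢
  rw [e1, e2, integral_const_mul, integral_finsetSum _ fun k _ => (hDk k).1]
  have h3 : ∑ k ∈ Finset.range K, ∫ x, D k x ∂(piGaussian _) ≤ K * (statConst * (√(9 * n))⁻¹) := by
    refine (Finset.sum_le_sum fun k _ => (hDk k).2).trans ?_
    simp
  have h4 : 2 / R ^ 2 * ∫ x : Fin 3 × Fin 3 × Fin n → ℝ, (9 * n : ℝ)⁻¹ * ∑ k, x k ^ 2 ∂(piGaussian _)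
      ≤ 2 / R ^ 2 * 1 := by gcongr
  have h5 : ∫ _ : Fin 3 × Fin 3 × Fin n → ℝ, (4 * ε + 2 / R ^ 2) ∂(piGaussian _)
      = 4 * ε + 2 / R ^ 2 := by simp
  have h6 : 4 / R ^ 2 = 2 / R ^ 2 + 2 / R ^ 2 := by ring
  rw [h5, h6]
  linarith

/-- The constant in the bound on the mean distance. -/
def meanConst : ℝ := 20 + statConst

theorem rpow_sixth_pow (n : ℕ) : ((n : ℝ) ^ (1 / 6 : ℝ)) ^ 6 = n := by
  rw [← Real.rpow_natCast, ← Real.rpow_mul (Nat.cast_nonneg n)]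
  norm_num

theorem one_le_rpow_sixth (h : 1 ≤ n) : 1 ≤ (n : ℝ) ^ (1 / 6 : ℝ) :=
  Real.one_le_rpow (by exact_mod_cast h) (by norm_num)

theorem integral_chainDist_le_of_three_le (hn3 : 3 ≤ n) :
    ∫ x, chainDist hn x ∂(piGaussian _) ≤ meanConst / (n : ℝ) ^ (1 / 6 : ℝ) := by
  set q := (n : ℝ) ^ (1 / 6 : ℝ) with hq
  have hq1 : 1 ≤ q := one_le_rpow_sixth (by omega)
  have hq0 : 0 < q := by linarith
  have hq6 : (n : ℝ) = q ^ 6 := (rpow_sixth_pow n).symm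
  -- The mesh is `q⁻¹`, and `R` is defined from the integer `K` so that the cells tile `[-R, R]`
  -- exactly. Since `√(9n) = 3 q ^ 3`, about `q ^ 2` ramps cost `O(1 / q)`.
  set K := ⌈q ^ 2⌉₊ with hKdef
  have hK1 : q ^ 2 ≤ K := Nat.le_ceil _
  have hK2 : (K : ℝ) ≤ 2 * q ^ 2 := by
    have := Nat.ceil_lt_add_one (sq_nonneg q)
    nlinarith
  have hK0 : (0 : ℝ) < K := lt_of_lt_of_le (by positivity) hK1
  set R := K * q⁻¹ / 2 with hR
  have hR0 : 0 < R := by positivity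
  have hR1 : q / 2 ≤ R := by
    rw [hR, div_le_div_iff_of_pos_right (by norm_num), ← div_eq_mul_inv, le_div_iff₀ hq0]
    nlinarith
  have h := integral_chainDist_le_of_grid hn hn3 (inv_pos.2 hq0) (inv_le_one_of_one_le₀ hq1) hR0
    (K := K) (by rw [hR]; ring)
  have hsqrt : √(9 * n : ℝ) = 3 * q ^ 3 := by
    rw [hq6, show 9 * q ^ 6 = (3 * q ^ 3) ^ 2 by ring, Real.sqrt_sq (by positivity)]
  rw [hsqrt] at h
  refine h.trans ?_
  have e1 : 4 / R ^ 2 ≤ 16 / q := by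
    have : q ^ 2 / 4 ≤ R ^ 2 := by nlinarith
    calc 4 / R ^ 2 ≤ 4 / (q ^ 2 / 4) := by gcongr
      _ = 16 / q * q⁻¹ := by field_simp; norm_num
      _ ≤ 16 / q * 1 := by gcongr; exact inv_le_one_of_one_le₀ hq1
      _ = 16 / q := mul_one _
  have e2 : K * (statConst * (3 * q ^ 3)⁻¹) ≤ statConst / q := by
    have h0 := statConst_nonneg
    calc K * (statConst * (3 * q ^ 3)⁻¹) ≤ 2 * q ^ 2 * (statConst * (3 * q ^ 3)⁻¹) := by gcongr
      _ = 2 / 3 * (statConst / q) := by field_simp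
      _ ≤ 1 * (statConst / q) := by gcongr; norm_num
      _ = statConst / q := one_mul _
  have e3 : meanConst / q = 4 * q⁻¹ + 16 / q + statConst / q := by
    rw [meanConst]; field_simp; ring
  rw [e3]
  linarith

/-- Settles `n = 2`, where the bonds are not orthonormal: the claimed bounds exceed the trivial
bound `2` on the distance. -/
theorem two_lt_meanConst_div (h : n = 2) : 2 < meanConst / (n : ℝ) ^ (1 / 6 : ℝ) := by
  have hq1 : 1 ≤ (n : ℝ) ^ (1 / 6 : ℝ) := one_le_rpow_sixth (by omega)
  have hq2 : (n : ℝ) ^ (1 / 6 : ℝ) ≤ 2 := by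
    subst h
    have : ((2 : ℕ) : ℝ) ^ (1 / 6 : ℝ) ≤ ((2 : ℕ) : ℝ) ^ (1 : ℝ) :=
      Real.rpow_le_rpow_of_exponent_le (by norm_num) (by norm_num)
    simpa using this
  rw [lt_div_iff₀ (by linarith), meanConst]
  have := statConst_nonneg
  linarith

theorem integral_chainDist_le :
    ∫ x, chainDist hn x ∂(piGaussian _) ≤ meanConst / (n : ℝ) ^ (1 / 6 : ℝ) := by
  rcases Nat.lt_or_ge 2 n with h | h
  · exact integral_chainDist_le_of_three_le hn h
  · refine le_trans ?_ (two_lt_meanConst_div (by omega : n = 2)).le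
    refine (integral_mono (integrable_chainDist hn) (integrable_const 2)
      (chainDist_le_two hn)).trans ?_
    simp

/-- The rate in the Gaussian concentration of the distance. -/
def concRate : ℝ := 9 / (2 * (Real.pi / 2) ^ 2)

theorem concRate_pos : 0 < concRate := by
  have := Real.pi_pos
  unfold concRate
  positivity

theorem chainDist_tail_le {t : ℝ} (ht : 0 ≤ t) :
    (piGaussian (Fin 3 × Fin 3 × Fin n)).real
        {x | meanConst / (n : ℝ) ^ (1 / 6 : ℝ) + t ≤ chainDist hn x}
      ≤ Real.exp (-(concRate * n * t ^ 2)) := by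
  rcases Nat.lt_or_ge 2 n with h | h
  · have hlip : ∀ x y, |chainDist hn x - chainDist hn y|
        ≤ ((Real.toNNReal (√(9 * n))⁻¹ : ℝ≥0) : ℝ) * √(∑ k, (x k - y k) ^ 2) := fun x y => by
      rw [← sqrt_hsSq_chainHam_sub h]
      exact abs_chainDist_sub_le hn x y
    have hs := (hasSubgaussianMGF_pi_gaussian_of_lipschitz hlip).measure_ge_le ht
    have hm := integral_chainDist_le hn
    refine (measureReal_mono (fun x hx => ?_)).trans (hs.trans (le_of_eq ?_))
    · simp only [Set.mem_ofPred_eq] at hx ⊢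
      change t ≤ chainDist hn x - ∫ y, chainDist hn y ∂(piGaussian _)
      linarith
    · congr 1
      push_cast
      have hn0 : (0 : ℝ) < 9 * n := by
        have : (2 : ℝ) ≤ n := by exact_mod_cast hn
        linarith
      have hpi := Real.pi_pos
      rw [Real.coe_toNNReal _ (by positivity), Real.coe_toNNReal _ (by positivity), inv_pow,
        Real.sq_sqrt hn0.le, concRate]
      field_simp
  · have hempty : {x | meanConst / (n : ℝ) ^ (1 / 6 : ℝ) + t ≤ chainDist hn x} = ∅ := by
      refine Set.eq_empty_of_forall_notMem fun x hx => ?_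
      have h1 := two_lt_meanConst_div (by omega : n = 2)
      have h2 := chainDist_le_two hn x
      simp only [Set.mem_ofPred_eq] at hx
      linarith
    rw [hempty, measureReal_empty]
    exact (Real.exp_pos _).le

end Chain

section Transfer

variable {Ω : Type u} [MeasurableSpace Ω] {P : Measure Ω} [IsProbabilityMeasure P] {n : ℕ}
  {Z : Fin 3 → Fin 3 → Fin n → Ω → ℝ}

theorem IsGaussianCoupling.hasLaw (h : IsGaussianCoupling P Z) :
    HasLaw (fun ω (k : Fin 3 × Fin 3 × Fin n) => Z k.1 k.2.1 k.2.2 ω) (piGaussian _) P := by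
  have hm : ∀ k : Fin 3 × Fin 3 × Fin n, AEMeasurable (Z k.1 k.2.1 k.2.2) P := fun k =>
    (h.law k.1 k.2.1 k.2.2).aemeasurable
  refine ⟨aemeasurable_pi_lambda _ hm, ?_⟩
  rw [(iIndepFun_iff_map_fun_eq_pi_map hm).1 h.indep, piGaussian]
  congr 1
  funext k
  exact (h.law _ _ _).map_eq

variable (hn : 2 ≤ n)

theorem IsGaussianCoupling.integrable_dBL (h : IsGaussianCoupling P Z) :
    Integrable (fun ω => dBL (chainMeasure hn fun a b j => Z a b j ω) (gaussianReal 0 1)) P := by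
  have h1 := integrable_chainDist hn
  rw [← h.hasLaw.map_eq] at h1
  exact h1.comp_aemeasurable h.hasLaw.aemeasurable

theorem IsGaussianCoupling.integral_dBL_le (h : IsGaussianCoupling P Z) :
    ∫ ω, dBL (chainMeasure hn fun a b j => Z a b j ω) (gaussianReal 0 1) ∂P
      ≤ meanConst / (n : ℝ) ^ (1 / 6 : ℝ) := by
  have h1 := integral_chainDist_le hn
  rw [← h.hasLaw.map_eq, integral_map h.hasLaw.aemeasurable
    (continuous_chainDist hn).aestronglyMeasurable] at h1
  exact h1

theorem IsGaussianCoupling.dBL_tail_le (h : IsGaussianCoupling P Z) {t : ℝ} (ht : 0 ≤ t) :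
    P.real {ω | meanConst / (n : ℝ) ^ (1 / 6 : ℝ) + t
        ≤ dBL (chainMeasure hn fun a b j => Z a b j ω) (gaussianReal 0 1)}
      ≤ Real.exp (-(concRate * n * t ^ 2)) := by
  have h1 := chainDist_tail_le hn ht
  rw [← h.hasLaw.map_eq, map_measureReal_apply_of_aemeasurable h.hasLaw.aemeasurable
    (measurableSet_le measurable_const (continuous_chainDist hn).measurable)] at h1
  exact h1

/-- With `t = n ^ (-1 / 6)` the exponent is a multiple of `n ^ (2 / 3)`; its third power in the
exponential series gives decay like `n ^ (-2)`. -/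
theorem summable_exp_neg_rate :
    Summable fun n : ℕ => Real.exp (-(concRate * n * (((n : ℝ) ^ (1 / 6 : ℝ))⁻¹) ^ 2)) := by
  have hs : Summable fun n : ℕ => 6 / concRate ^ 3 * (1 / (n : ℝ) ^ 2) :=
    (Real.summable_one_div_nat_pow.2 one_lt_two).mul_left _
  refine hs.of_norm_bounded_eventually_nat ?_
  filter_upwards [eventually_ge_atTop 1] with n hn
  rw [Real.norm_eq_abs, Real.abs_exp]
  set q := (n : ℝ) ^ (1 / 6 : ℝ) with hq
  have hq1 : 1 ≤ q := one_le_rpow_sixth hn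
  have hq0 : 0 < q := by linarith
  have hq6 : (n : ℝ) = q ^ 6 := (rpow_sixth_pow n).symm
  have hc := concRate_pos
  have e : concRate * n * (q⁻¹) ^ 2 = concRate * q ^ 4 := by
    rw [hq6]; field_simp
  rw [e, hq6]
  have h1 := Real.pow_div_factorial_le_exp (concRate * q ^ 4) (by positivity) 3
  rw [Real.exp_neg]
  refine (inv_anti₀ (by positivity) h1).trans (le_of_eq ?_)
  simp [Nat.factorial]
  field_simp

end Transfer

theorem ae_eventually_dBL_le {Ω : Type u} [MeasurableSpace Ω] {P : Measure Ω}
    [IsProbabilityMeasure P] {Z : (n : ℕ) → Fin 3 → Fin 3 → Fin n → Ω → ℝ}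
    (h : ∀ n : ℕ, 2 ≤ n → IsGaussianCoupling P (Z n)) :
    ∀ᵐ ω ∂P, ∃ N : ℕ, ∀ (n : ℕ) (hn : 2 ≤ n), N ≤ n →
      dBL (chainMeasure hn fun a b j => Z n a b j ω) (gaussianReal 0 1)
        ≤ (meanConst + 1) / (n : ℝ) ^ (1 / 6 : ℝ) := by
  set s : ℕ → Set Ω := fun n => {ω | ∃ hn : 2 ≤ n,
    meanConst / (n : ℝ) ^ (1 / 6 : ℝ) + ((n : ℝ) ^ (1 / 6 : ℝ))⁻¹
      ≤ dBL (chainMeasure hn fun a b j => Z n a b j ω) (gaussianReal 0 1)} with hs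
  have hle : ∀ n, P (s n) ≤
      ENNReal.ofReal (Real.exp (-(concRate * n * (((n : ℝ) ^ (1 / 6 : ℝ))⁻¹) ^ 2))) := by
    intro n
    by_cases hn : 2 ≤ n
    · have h1 := (h n hn).dBL_tail_le hn (t := ((n : ℝ) ^ (1 / 6 : ℝ))⁻¹) (by positivity)
      rw [← ofReal_measureReal]
      refine ENNReal.ofReal_le_ofReal (le_trans (le_of_eq ?_) h1)
      congr 1
      ext ω
      simp [hs, hn]
    · have : s n = ∅ := by
        ext ω
        simp [hs, hn]
      rw [this]
      simp
  have hsum : ∑' n, P (s n) ≠ ∞ := by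
    refine ne_top_of_le_ne_top ?_ (ENNReal.tsum_le_tsum hle)
    rw [← ENNReal.ofReal_tsum_of_nonneg (fun n => (Real.exp_pos _).le) summable_exp_neg_rate]
    exact ENNReal.ofReal_ne_top
  -- The first Borel-Cantelli lemma needs only summability, so the joint law of the coefficients for
  -- different `n` plays no role.
  filter_upwards [ae_eventually_notMem hsum] with ω hω
  obtain ⟨N, hN⟩ := eventually_atTop.1 hω
  refine ⟨N, fun n hn hNn => ?_⟩
  by_contra hcon
  refine hN n hNn ⟨hn, ?_⟩
  have e : (meanConst + 1) / (n : ℝ) ^ (1 / 6 : ℝ)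
      = meanConst / (n : ℝ) ^ (1 / 6 : ℝ) + ((n : ℝ) ^ (1 / 6 : ℝ))⁻¹ := by
    rw [add_div, one_div ((n : ℝ) ^ (1 / 6 : ℝ))]
  rw [e] at hcon
  exact (not_le.1 hcon).le

end

theorem theorem1 :
    ∃ C C' c : ℝ, 0 < C ∧ 0 < C' ∧ 0 < c ∧
      (∀ (Ω : Type u) [MeasurableSpace Ω] (P : Measure Ω) [IsProbabilityMeasure P]
        (n : ℕ) (hn : 2 ≤ n) (Z : Fin 3 → Fin 3 → Fin n → Ω → ℝ), IsGaussianCoupling P Z →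
          (Integrable
              (fun ω => dBL (chainMeasure hn fun a b j => Z a b j ω) (gaussianReal 0 1)) P ∧
            ∫ ω, dBL (chainMeasure hn fun a b j => Z a b j ω) (gaussianReal 0 1) ∂P
              ≤ C / (n : ℝ) ^ (1 / 6 : ℝ)) ∧
          (∀ t : ℝ, 0 ≤ t →
            P.real {ω | C / (n : ℝ) ^ (1 / 6 : ℝ) + t
                ≤ dBL (chainMeasure hn fun a b j => Z a b j ω) (gaussianReal 0 1)}
              ≤ C * Real.exp (-(c * n * t ^ 2)))) ∧
      (∀ (Ω : Type u) [MeasurableSpace Ω] (P : Measure Ω) [IsProbabilityMeasure P]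
        (Z : (n : ℕ) → Fin 3 → Fin 3 → Fin n → Ω → ℝ),
          (∀ n : ℕ, 2 ≤ n → IsGaussianCoupling P (Z n)) →
          ∀ᵐ ω ∂P, ∃ N : ℕ, ∀ (n : ℕ) (hn : 2 ≤ n), N ≤ n →
            dBL (chainMeasure hn fun a b j => Z n a b j ω) (gaussianReal 0 1)
              ≤ C' / (n : ℝ) ^ (1 / 6 : ℝ)) := by
  have hC := statConst_nonneg
  have hM : (20 : ℝ) ≤ meanConst := by
    rw [meanConst]
    linarith
  refine ⟨meanConst, meanConst + 1, concRate, by linarith, by linarith, concRate_pos, ?_, ?_⟩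
  · intro Ω _ P _ n hn Z hZ
    refine ⟨⟨hZ.integrable_dBL hn, hZ.integral_dBL_le hn⟩, fun t ht => ?_⟩
    refine (hZ.dBL_tail_le hn ht).trans ?_
    exact le_mul_of_one_le_left (Real.exp_pos _).le (by linarith)
  · intro Ω _ P _ Z hZ
    exact ae_eventually_dBL_le hZ
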